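/- Let $n\ge 1$ and, for $z=(z_1,\dots,z_n)\in\mathbb C^n$, let $$v(z)=n^{2/n}\,(1+|z_1|^2+\cdots+|z_{n-1}|^2)\,|z_n|^{2/n}.$$ Then the following hold. (1) $v$ is a generalized solution of $\det(u_{i\bar j})=1$ on $\mathbb C^n$ in the sense of Bedford and Taylor: $v$ is continuous and plurisubharmonic, and its Monge–Ampère measure, i.e. the current $(\sqrt{-1}\,\partial\bar\partial v)^n$ defined inductively by $(\sqrt{-1}\,\partial\bar\partial v)^{k+1}=\sqrt{-1}\,\partial\bar\partial\big(v\,(\sqrt{-1}\,\partial\bar\partial v)^k\big)$ and normalized so that for $u\in C^2$ it is $\det(u_{i\bar j})$ times Lebesgue measure, is Lebesgue measure. (2) For $\varepsilon>0$ the functions $v_\varepsilon(z)=n^{2/n}(1+|z_1|^2+\cdots+|z_{n-1}|^2)(|z_n|^2+\varepsilon)^{1/n}$ are smooth and plurisubharmonic; as $\varepsilon\to0^+$, $v_\varepsilon\to v$ locally uniformly, and $\det\big((v_\varepsilon)_{i\bar j}\big)\to 1$ in $L^q(K)$ for every compact $K\subset\mathbb C^n$ and every $q<\infty$. (3) $v$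 is a viscosity solution of $\det(u_{i\bar j})=1$ on $\mathbb C^n$: for a complex $n\times n$ matrix $X$ put $G(X)=1-\det X$ if $X$ is Hermitian positive semidefinite and $G(X)=+\infty$ otherwise. Then $v$ is continuous, and for every real function $\varphi$ of class $C^2$ near a point $p\in\mathbb C^n$, if $v-\varphi$ has a local minimum at $p$, then $G\big((\varphi_{i\bar j}(p))\big)\ge 0$, and if $v-\varphi$ has a local maximum at $p$, then $G\big((\varphi_{i\bar j}(p))\big)\le 0$. (4) If $n\ge2$, then $v$ is Hölder continuous with exponent $2/n$ on every compact set, and for no $\beta>2/n$ is $v$ Hölder continuous with exponent $\beta$ on a neighbourhood of a point of $\{z_n=0\}$. (5) For $1\le p\le\infty$, $v\in W^{2,p}_{\mathrm{loc}}(\mathbb C^n)$ if and only if $p\,(n-1)<n$ (with $\infty\cdot 0=0$). -/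

import Mathlib

open Set Filter Topology MeasureTheory
open scoped NNReal ENNReal ContDiff CompactlySupported ComplexOrder

noncomputable section

/-! ### Wirtinger derivatives, complex Hessian -/

/-- `∂f/∂z_i = (1/2) (∂f/∂x_i - √-1 ∂f/∂y_i)` for a complex-valued function on `ℂⁿ`. -/
def dz {n : ℕ} (i : Fin n) (f : (Fin n → ℂ) → ℂ) (z : Fin n → ℂ) : ℂ :=
  (1 / 2) * (fderiv ℝ f z (Pi.single i 1) - Complex.I * fderiv ℝ f z (Pi.single i Complex.I))

/-- `∂f/∂z̄_i = (1/2) (∂f/∂x_i + √-1 ∂f/∂y_i)` for a complex-valued function on `ℂⁿ`. -/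
def dzbar {n : ℕ} (i : Fin n) (f : (Fin n → ℂ) → ℂ) (z : Fin n → ℂ) : ℂ :=
  (1 / 2) * (fderiv ℝ f z (Pi.single i 1) + Complex.I * fderiv ℝ f z (Pi.single i Complex.I))

/-- The complex Hessian `(u_{i j̄}) = (∂²u / ∂z_i ∂z̄_j)` of a real-valued function. -/
def complexHessian {n : ℕ} (u : (Fin n → ℂ) → ℝ) (z : Fin n → ℂ) : Matrix (Fin n) (Fin n) ℂ :=
  Matrix.of fun i j => dz i (dzbar j (fun x => (u x : ℂ))) z

/-! ### Continuous plurisubharmonic functions on `ℂⁿ` -/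

/-- A continuous function on `ℂⁿ` is plurisubharmonic if it satisfies the sub-mean value
inequality `u(z) ≤ (1/2π) ∫₀^{2π} u(z + e^{iθ} ζ) dθ` for all `z, ζ ∈ ℂⁿ`. -/
def ContinuousPSH {n : ℕ} (u : (Fin n → ℂ) → ℝ) : Prop :=
  Continuous u ∧
    ∀ z ζ : Fin n → ℂ, u z ≤ Real.circleAverage (fun ξ : ℂ => u (z + ξ • ζ)) 0 1

/-! ### Generalized solutions of the complex Monge-Ampère equation -/

theorem contDiff_dz {n : ℕ} (i : Fin n) {f : (Fin n → ℂ) → ℂ} (hf : ContDiff ℝ ∞ f) :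
    ContDiff ℝ ∞ (dz i f) := by
  have h : ContDiff ℝ ∞ (fderiv ℝ f) := hf.fderiv_right (by simp)
  unfold dz
  fun_prop

theorem contDiff_dzbar {n : ℕ} (i : Fin n) {f : (Fin n → ℂ) → ℂ} (hf : ContDiff ℝ ∞ f) :
    ContDiff ℝ ∞ (dzbar i f) := by
  have h : ContDiff ℝ ∞ (fderiv ℝ f) := hf.fderiv_right (by simp)
  unfold dzbar
  fun_prop

theorem hasCompactSupport_dz {n : ℕ} (i : Fin n) {f : (Fin n → ℂ) → ℂ}
    (hf : HasCompactSupport f) : HasCompactSupport (dz i f) :=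
  (hf.fderiv ℝ).comp_left
    (g := fun L : (Fin n → ℂ) →L[ℝ] ℂ =>
      (1 / 2) * (L (Pi.single i 1) - Complex.I * L (Pi.single i Complex.I))) (by simp)

theorem hasCompactSupport_dzbar {n : ℕ} (i : Fin n) {f : (Fin n → ℂ) → ℂ}
    (hf : HasCompactSupport f) : HasCompactSupport (dzbar i f) :=
  (hf.fderiv ℝ).comp_left
    (g := fun L : (Fin n → ℂ) →L[ℝ] ℂ =>
      (1 / 2) * (L (Pi.single i 1) + Complex.I * L (Pi.single i Complex.I))) (by simp)

/-- For continuous `u` and a smooth compactly supported `φ`, the continuous compactly supported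
function `u · ∂²φ/∂z_i∂z̄_j`. -/
def mulDdbar {n : ℕ} (u : C(Fin n → ℂ, ℝ)) (φ : C_c(Fin n → ℂ, ℂ)) (hφ : ContDiff ℝ ∞ φ)
    (i j : Fin n) : C_c(Fin n → ℂ, ℂ) where
  toFun z := (u z : ℂ) * dz i (dzbar j φ) z
  continuous_toFun := by
    have h := (contDiff_dz i (contDiff_dzbar j hφ)).continuous
    fun_prop
  hasCompactSupport' :=
    (hasCompactSupport_dz i (hasCompactSupport_dzbar j φ.hasCompactSupport)).mul_left

/-- A linear functional on `C_c(ℂⁿ)` is of order zero (that is, a complex Radon measure) if it is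
bounded, with respect to the sup norm, on functions supported in a fixed compact set. -/
def IsOrderZero {n : ℕ} (T : C_c(Fin n → ℂ, ℂ) →ₗ[ℂ] ℂ) : Prop :=
  ∀ K : Set (Fin n → ℂ), IsCompact K → ∃ C : ℝ, ∀ (f : C_c(Fin n → ℂ, ℂ)) (M : ℝ),
    tsupport f ⊆ K → (∀ z, ‖f z‖ ≤ M) → ‖T f‖ ≤ C * M

/-- The inductive construction by Bedford and Taylor of the currents `(√-1 ∂∂̄u)^k`, `k ≤ n`, for
continuous `u`, written in coefficients.

`D k a b`, for multi-indices `a = (a₁, …, a_k)` and `b = (b₁, …, b_k)`, is the coefficient of the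
`(k,k)`-current `(√-1 ∂∂̄u)^k` on `dz_a ∧ dz̄_b`, normalized such that for `u` of class `C²`
it is the function `det (u_{a_r b̄_s})_{r,s}` (times Lebesgue measure). All of these coefficients
are of order zero, so that they can be multiplied by the continuous function `u`; the current of
order `0` is the constant `1`; and `(√-1 ∂∂̄u)^{k+1} = √-1 ∂∂̄ (u (√-1 ∂∂̄u)^k)`
in the sense of currents, which in coefficients reads
`(k+1) D_{k+1}(a, b) = ∑_{r,s} (-1)^{r+s} ∂²/∂z_{a_r}∂z̄_{b_s} (u · D_k(a without a_r, b without b_s))`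
in the sense of distributions. These properties determine `D k a b` for all `k ≤ n`. -/
structure IsBedfordTaylor {n : ℕ} (u : C(Fin n → ℂ, ℝ))
    (D : (k : ℕ) → (Fin k → Fin n) → (Fin k → Fin n) → (C_c(Fin n → ℂ, ℂ) →ₗ[ℂ] ℂ)) : Prop where
  orderZero : ∀ k ≤ n, ∀ a b : Fin k → Fin n, IsOrderZero (D k a b)
  zero : ∀ (a b : Fin 0 → Fin n) (f : C_c(Fin n → ℂ, ℂ)), D 0 a b f = ∫ z, f z
  succ : ∀ k < n, ∀ (a b : Fin (k + 1) → Fin n) (φ : C_c(Fin n → ℂ, ℂ)) (hφ : ContDiff ℝ ∞ φ),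
    ((k : ℂ) + 1) * D (k + 1) a b φ =
      ∑ r : Fin (k + 1), ∑ s : Fin (k + 1), (-1) ^ ((r : ℕ) + (s : ℕ)) *
        D k (a ∘ r.succAbove) (b ∘ s.succAbove) (mulDdbar u φ hφ (a r) (b s))

/-- `u` is a generalized solution (in the sense of Bedford and Taylor) of `det (u_{i j̄}) = ψ` on
`ℂⁿ`: it is continuous and plurisubharmonic, and its Monge-Ampère measure, the top coefficient of
`(√-1 ∂∂̄u)^n`, is `ψ` times Lebesgue measure. -/
def IsGeneralizedSolution {n : ℕ} (u : (Fin n → ℂ) → ℝ) (ψ : (Fin n → ℂ) → ℝ) : Prop :=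
  ContinuousPSH u ∧
    ∃ (hu : Continuous u)
      (D : (k : ℕ) → (Fin k → Fin n) → (Fin k → Fin n) → (C_c(Fin n → ℂ, ℂ) →ₗ[ℂ] ℂ)),
      IsBedfordTaylor ⟨u, hu⟩ D ∧
        ∀ f : C_c(Fin n → ℂ, ℂ), D n id id f = ∫ z, f z * (ψ z : ℂ)

/-! ### Viscosity solutions -/

open Classical in
/-- `G(X) = 1 - det X` if `X ≥ 0`, and `+∞` otherwise. -/
def maOperator {n : ℕ} (X : Matrix (Fin n) (Fin n) ℂ) : EReal :=
  if X.PosSemidef then ((1 - X.det.re : ℝ) : EReal) else ⊤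

/-- `u` is a viscosity solution of `G(∂∂̄u) = 0`, that is of `det (u_{i j̄}) = 1`, on `ℂⁿ`:
whenever `u - φ`, with `φ` of class `C²` near `p`, has a local minimum (maximum) at `p`, then
`G(∂∂̄φ) ≥ 0` (respectively `≤ 0`) at `p`. -/
def IsViscositySolution {n : ℕ} (u : (Fin n → ℂ) → ℝ) : Prop :=
  Continuous u ∧
    ∀ (φ : (Fin n → ℂ) → ℝ) (p : Fin n → ℂ), ContDiffAt ℝ 2 φ p →
      (IsLocalMin (fun z => u z - φ z) p → 0 ≤ maOperator (complexHessian φ p)) ∧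
      (IsLocalMax (fun z => u z - φ z) p → maOperator (complexHessian φ p) ≤ 0)

/-! ### The Sobolev space `W^{2,p}_loc(ℂⁿ)` -/

/-- `f ∈ L^p_loc(ℂⁿ)`. -/
def MemLpLocal {n : ℕ} (f : (Fin n → ℂ) → ℝ) (p : ℝ≥0∞) : Prop :=
  ∀ K : Set (Fin n → ℂ), IsCompact K → MemLp f p (volume.restrict K)

/-- `g` is the weak derivative of `f` in the real direction `ξ`. -/
def HasWeakDeriv {n : ℕ} (f g : (Fin n → ℂ) → ℝ) (ξ : Fin n → ℂ) : Prop :=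
  ∀ φ : (Fin n → ℂ) → ℝ, ContDiff ℝ ∞ φ → HasCompactSupport φ →
    ∫ z, f z * fderiv ℝ φ z ξ = - ∫ z, g z * φ z

/-- `f ∈ W^{2,p}_loc(ℂⁿ)`: `f` and its weak derivatives of order one and two are in `L^p_loc`. -/
def MemW2Local {n : ℕ} (f : (Fin n → ℂ) → ℝ) (p : ℝ≥0∞) : Prop :=
  MemLpLocal f p ∧ ∀ ξ : Fin n → ℂ, ∃ g, MemLpLocal g p ∧ HasWeakDeriv f g ξ ∧
    ∀ η : Fin n → ℂ, ∃ h, MemLpLocal h p ∧ HasWeakDeriv g h η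

/-! ### The Pogorelov-type functions

The dimension is `n = m + 1`; the coordinates `z_1, …, z_{n-1}` are `z i.castSucc`, `i : Fin m`,
and `z_n` is `z (Fin.last m)`. -/

/-- `v(z) = n^{2/n} (1 + |z_1|² + ⋯ + |z_{n-1}|²) |z_n|^{2/n}` on `ℂⁿ`, `n = m + 1`. -/
def pogorelov (m : ℕ) (z : Fin (m + 1) → ℂ) : ℝ :=
  ((m : ℝ) + 1) ^ (2 / ((m : ℝ) + 1)) * (1 + ∑ i : Fin m, ‖z i.castSucc‖ ^ 2) *
    ‖z (Fin.last m)‖ ^ (2 / ((m : ℝ) + 1))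

/-- `v_ε(z) = n^{2/n} (1 + |z_1|² + ⋯ + |z_{n-1}|²) (|z_n|² + ε)^{1/n}` on `ℂⁿ`, `n = m + 1`. -/
def pogorelovApprox (m : ℕ) (ε : ℝ) (z : Fin (m + 1) → ℂ) : ℝ :=
  ((m : ℝ) + 1) ^ (2 / ((m : ℝ) + 1)) * (1 + ∑ i : Fin m, ‖z i.castSucc‖ ^ 2) *
    (‖z (Fin.last m)‖ ^ 2 + ε) ^ (1 / ((m : ℝ) + 1))

end

/-! Write `w = z_n`, `A = 1 + |z_1|² + ⋯ + |z_{n-1}|²`, `s = |w|² + ε`, `α = 1/n`, `c = n^{2/n}`, so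
that `v_ε = c A s^α` and `v = v_0`. The complex Hessian of `v_ε` is explicit wherever `s > 0`: its
upper left block is the scalar matrix `c s^α`, and a Schur complement gives the determinant `(|w|² +
n A ε) / s` (`det_complexHessian_pogorelovApprox`). Hence the determinant is `1` for `ε = 0` off the
hyperplane `{w = 0}`. For `ε > 0` the error `(nA - 1) ε / s` is bounded on compact sets and tends to
`0` off the hyperplane.

Every statement about distributions is proved for the smooth `v_ε` and passed to the limit by
dominated convergence (`tendsto_integral_mul_of_lastBound`); what is needed is a majorant `C |w|^t`
with `t > -2`, uniform in `ε`. Derivatives of order at most two are `O(|w|^{2α-2})`. This power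
decides the Sobolev class: it is in `L^p_loc` exactly when `p (2 - 2α) < 2`, that is `p (n - 1) <
n`, and it is attained because the Laplacian of `v` in the variable `w` is `4 c α² A |w|^{2α-2}`.

For the Bedford–Taylor currents the candidates are the `k × k` minors of the Hessian of `v`, as
densities. For smooth functions the recursion (`hessianMinor_recursion`) is Laplace expansion
followed by two integrations by parts, in which the derivatives of the minors cancel because minors
of a Hessian are divergence free. For the limit, an entry loses a factor `s^{-1/2}` for each index
equal to `n`; a nonzero minor uses that index at most once among its rows and once among its
columns, so it is `O(|w|^{2αk-2})` (`exists_bound_hessianMinor`). Thus no mass is lost or created on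
the hyperplane, and the top density is `1`.

Plurisubharmonicity comes from Cauchy–Schwarz: along a complex line `A` and `s` dominate their
values at the centre times `|1 + aξ|²` and `|1 + bξ|²`. With `e^x ≥ 1 + x` it remains that `log |1 +
aξ|` has nonnegative mean on the unit circle.

In the viscosity statement, points where `v` is smooth are handled by monotonicity of `det` on
positive semidefinite matrices. On `{w = 0}` with `n ≥ 2`, `v` vanishes along the hyperplane, so a
test function from below has a nonpositive diagonal entry in its complex Hessian, and if that matrix
is semidefinite its determinant is `0`; a test function from above does not exist because `v ≥ c
|w|` for `|w| ≤ 1`. The same growth in `w`, in the form `v ≥ c |w|^{2/n}`, bounds the Hölder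
exponent. For `n = 1`, `v = |z|²` is smooth. -/

noncomputable section

/-! ### Explicit derivatives of the Pogorelov-type functions -/

section Derivatives

variable {m : ℕ}

/-- The exponent `1 / n`. -/
def pogExp (m : ℕ) : ℝ := 1 / ((m : ℝ) + 1)

/-- The constant `n ^ (2 / n)`. -/
def pogConst (m : ℕ) : ℝ := ((m : ℝ) + 1) ^ (2 / ((m : ℝ) + 1))

/-- The factor `1 + |z_1|² + ⋯ + |z_{n-1}|²`. -/
def pogBase (z : Fin (m + 1) → ℂ) : ℝ := 1 + ∑ i : Fin m, ‖z i.castSucc‖ ^ 2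

/-- The regularized square `|z_n|² + ε`. -/
def regSq (ε : ℝ) (z : Fin (m + 1) → ℂ) : ℝ := ‖z (Fin.last m)‖ ^ 2 + ε

/-- The derivative of `pogBase` in direction `ξ`. -/
def pogBaseD (ξ z : Fin (m + 1) → ℂ) : ℝ := 2 * ∑ i : Fin m, inner ℝ (z i.castSucc) (ξ i.castSucc)

/-- The derivative of `regSq` in direction `ξ`. -/
def regSqD (ξ z : Fin (m + 1) → ℂ) : ℝ := 2 * inner ℝ (z (Fin.last m)) (ξ (Fin.last m))

/-- The derivative of `pogorelovApprox m ε` in direction `ξ`. -/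
def pogD1 (ε : ℝ) (ξ z : Fin (m + 1) → ℂ) : ℝ :=
  pogConst m * (pogBaseD ξ z * regSq ε z ^ pogExp m +
    pogBase z * (pogExp m * regSq ε z ^ (pogExp m - 1) * regSqD ξ z))

/-- The second derivative of `pogorelovApprox m ε` in directions `ξ` and `η`. -/
def pogD2 (ε : ℝ) (ξ η z : Fin (m + 1) → ℂ) : ℝ :=
  pogConst m * (pogBaseD ξ η * regSq ε z ^ pogExp m +
    pogBaseD ξ z * (pogExp m * regSq ε z ^ (pogExp m - 1) * regSqD η z) +
    pogBaseD η z * (pogExp m * regSq ε z ^ (pogExp m - 1) * regSqD ξ z) +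
    pogBase z * (pogExp m * ((pogExp m - 1) * regSq ε z ^ (pogExp m - 2) * regSqD η z) *
      regSqD ξ z) +
    pogBase z * (pogExp m * regSq ε z ^ (pogExp m - 1) * regSqD ξ η))

theorem pogorelovApprox_eq (ε : ℝ) (z : Fin (m + 1) → ℂ) :
    pogorelovApprox m ε z = pogConst m * pogBase z * regSq ε z ^ pogExp m := rfl

theorem pogExp_pos (m : ℕ) : 0 < pogExp m := by unfold pogExp; positivity

theorem pogExp_le_one (m : ℕ) : pogExp m ≤ 1 := by
  unfold pogExp
  rw [div_le_one (by positivity)]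
  linarith [(Nat.cast_nonneg m : (0 : ℝ) ≤ m)]

theorem pogConst_pos (m : ℕ) : 0 < pogConst m := by unfold pogConst; positivity

theorem one_le_pogBase (z : Fin (m + 1) → ℂ) : 1 ≤ pogBase z := by
  unfold pogBase
  have : 0 ≤ ∑ i : Fin m, ‖z i.castSucc‖ ^ 2 := by positivity
  linarith

theorem pogBase_pos (z : Fin (m + 1) → ℂ) : 0 < pogBase z :=
  one_pos.trans_le (one_le_pogBase z)

theorem regSq_nonneg {ε : ℝ} (hε : 0 ≤ ε) (z : Fin (m + 1) → ℂ) : 0 ≤ regSq ε z := by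
  unfold regSq; positivity

theorem regSq_pos {ε : ℝ} (hε : 0 < ε) (z : Fin (m + 1) → ℂ) : 0 < regSq ε z := by
  unfold regSq; positivity

theorem regSq_pos_of_ne {ε : ℝ} (hε : 0 ≤ ε) {z : Fin (m + 1) → ℂ} (hz : z (Fin.last m) ≠ 0) :
    0 < regSq ε z := by
  have := norm_pos_iff.2 hz
  unfold regSq; positivity

theorem norm_sq_rpow_pogExp (x : ℝ) (hx : 0 ≤ x) :
    (x ^ 2) ^ pogExp m = x ^ (2 / ((m : ℝ) + 1)) := by
  rw [← Real.rpow_natCast, ← Real.rpow_mul hx, pogExp]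
  congr 1
  push_cast
  ring

/-- Makes the limit a member of the family, so that every formula valid for `0 < regSq ε z` applies
to `v` off the hyperplane. -/
theorem pogorelovApprox_zero (m : ℕ) : pogorelovApprox m 0 = pogorelov m := by
  ext z
  rw [pogorelovApprox_eq, regSq, add_zero, norm_sq_rpow_pogExp _ (norm_nonneg _)]
  rfl

theorem contDiff_pogBase : ContDiff ℝ ∞ (pogBase : (Fin (m + 1) → ℂ) → ℝ) := by
  unfold pogBase
  refine contDiff_const.add (ContDiff.sum fun i _ => ?_)
  exact (contDiff_norm_sq ℝ).comp (contDiff_apply ℝ ℂ _)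

theorem contDiff_regSq (ε : ℝ) : ContDiff ℝ ∞ (regSq ε : (Fin (m + 1) → ℂ) → ℝ) := by
  unfold regSq
  exact ((contDiff_norm_sq ℝ).comp (contDiff_apply ℝ ℂ _)).add contDiff_const

/-- Positivity of `regSq` is the one condition that covers both `ε > 0` everywhere and `ε = 0` off
the hyperplane; the derivative formulas below are stated under it for the same reason. -/
theorem contDiffAt_pogorelovApprox {ε : ℝ} {z : Fin (m + 1) → ℂ} (hz : 0 < regSq ε z) :
    ContDiffAt ℝ ∞ (pogorelovApprox m ε) z := by
  change ContDiffAt ℝ ∞ (fun z => pogConst m * pogBase z * regSq ε z ^ pogExp m) z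
  exact (contDiffAt_const.mul contDiff_pogBase.contDiffAt).mul
    ((contDiff_regSq ε).contDiffAt.rpow_const_of_ne hz.ne')

theorem contDiff_pogorelovApprox {ε : ℝ} (hε : 0 < ε) : ContDiff ℝ ∞ (pogorelovApprox m ε) :=
  contDiff_iff_contDiffAt.2 fun z => contDiffAt_pogorelovApprox (regSq_pos hε z)

theorem hasFDerivAt_normSq_apply (i : Fin (m + 1)) (z : Fin (m + 1) → ℂ) :
    HasFDerivAt (fun z : Fin (m + 1) → ℂ => ‖z i‖ ^ 2)
      ((2 • innerSL ℝ (z i)).comp (ContinuousLinearMap.proj (R := ℝ) i)) z := by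
  have h := (hasStrictFDerivAt_norm_sq (z i)).hasFDerivAt
  exact h.comp z (ContinuousLinearMap.proj (R := ℝ) (φ := fun _ : Fin (m + 1) => ℂ) i).hasFDerivAt

/-- Only the values of the derivative are used later, so the linear map itself is kept existential.
-/
theorem hasFDerivAt_pogBase (z : Fin (m + 1) → ℂ) :
    ∃ L : (Fin (m + 1) → ℂ) →L[ℝ] ℝ, HasFDerivAt pogBase L z ∧ ∀ ξ, L ξ = pogBaseD ξ z := by
  refine ⟨_, (HasFDerivAt.fun_sum fun i _ => hasFDerivAt_normSq_apply i.castSucc z).const_add 1, ?_⟩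
  intro ξ
  simp [pogBaseD, Finset.mul_sum, -Complex.inner]

theorem hasFDerivAt_regSq (ε : ℝ) (z : Fin (m + 1) → ℂ) :
    ∃ L : (Fin (m + 1) → ℂ) →L[ℝ] ℝ, HasFDerivAt (regSq ε) L z ∧ ∀ ξ, L ξ = regSqD ξ z := by
  refine ⟨_, (hasFDerivAt_normSq_apply (Fin.last m) z).add_const ε, ?_⟩
  intro ξ
  simp [regSqD, -Complex.inner]

theorem hasFDerivAt_pogBaseD (ξ z : Fin (m + 1) → ℂ) :
    ∃ L : (Fin (m + 1) → ℂ) →L[ℝ] ℝ, HasFDerivAt (pogBaseD ξ) L z ∧ ∀ η, L η = pogBaseD ξ η := by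
  let L : (Fin (m + 1) → ℂ) →L[ℝ] ℝ := (2 : ℝ) • ∑ i : Fin m,
    (innerSL ℝ (ξ i.castSucc)).comp (ContinuousLinearMap.proj (R := ℝ) i.castSucc)
  have h : (pogBaseD ξ : (Fin (m + 1) → ℂ) → ℝ) = L := by
    ext z
    simp [L, pogBaseD, -Complex.inner, real_inner_comm]
  exact ⟨L, h ▸ L.hasFDerivAt, fun η => by rw [h]⟩

theorem hasFDerivAt_regSqD (ξ z : Fin (m + 1) → ℂ) :
    ∃ L : (Fin (m + 1) → ℂ) →L[ℝ] ℝ, HasFDerivAt (regSqD ξ) L z ∧ ∀ η, L η = regSqD ξ η := by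
  let L : (Fin (m + 1) → ℂ) →L[ℝ] ℝ := (2 : ℝ) •
    (innerSL ℝ (ξ (Fin.last m))).comp (ContinuousLinearMap.proj (R := ℝ) (Fin.last m))
  have h : (regSqD ξ : (Fin (m + 1) → ℂ) → ℝ) = L := by
    ext z
    simp [L, regSqD, -Complex.inner, real_inner_comm]
  exact ⟨L, h ▸ L.hasFDerivAt, fun η => by rw [h]⟩

theorem fderiv_pogorelovApprox {ε : ℝ} {z : Fin (m + 1) → ℂ} (hz : 0 < regSq ε z)
    (ξ : Fin (m + 1) → ℂ) : fderiv ℝ (pogorelovApprox m ε) z ξ = pogD1 ε ξ z := by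
  obtain ⟨L, hL, hLξ⟩ := hasFDerivAt_pogBase z
  obtain ⟨S, hS, hSξ⟩ := hasFDerivAt_regSq ε z
  have h := (hL.const_mul (pogConst m)).mul (hS.rpow_const (p := pogExp m) (Or.inl hz.ne'))
  have h' : HasFDerivAt (pogorelovApprox m ε) _ z := h
  rw [h'.fderiv]
  simp [hLξ, hSξ, pogD1]
  ring

theorem fderiv_pogD1 {ε : ℝ} {z : Fin (m + 1) → ℂ} (hz : 0 < regSq ε z)
    (ξ η : Fin (m + 1) → ℂ) : fderiv ℝ (pogD1 ε ξ) z η = pogD2 ε ξ η z := by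
  obtain ⟨L, hL, hLξ⟩ := hasFDerivAt_pogBase z
  obtain ⟨S, hS, hSξ⟩ := hasFDerivAt_regSq ε z
  obtain ⟨L', hL', hLξ'⟩ := hasFDerivAt_pogBaseD ξ z
  obtain ⟨S', hS', hSξ'⟩ := hasFDerivAt_regSqD ξ z
  have h := ((hL'.mul (hS.rpow_const (p := pogExp m) (Or.inl hz.ne'))).add
    (hL.mul (((hS.rpow_const (p := pogExp m - 1) (Or.inl hz.ne')).const_mul (pogExp m)).mul
      hS'))).const_mul (pogConst m)
  have h' : HasFDerivAt (pogD1 ε ξ) _ z := h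
  rw [h'.fderiv]
  simp only [_root_.smul_apply, _root_.add_apply, smul_eq_mul, hLξ, hSξ, hLξ', hSξ', pogD2, Pi.mul_apply]
  rw [show pogExp m - 1 - 1 = pogExp m - 2 by ring]
  ring

theorem contDiffAt_pogD1 {ε : ℝ} {z : Fin (m + 1) → ℂ} (hz : 0 < regSq ε z)
    (ξ : Fin (m + 1) → ℂ) : ContDiffAt ℝ ∞ (pogD1 ε ξ) z := by
  have h1 : ContDiffAt ℝ ∞ (fun y => fderiv ℝ (pogorelovApprox m ε) y ξ) z :=
    ((contDiffAt_pogorelovApprox hz).fderiv_right (m := ∞) (by simp)).clm_apply contDiffAt_const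
  refine h1.congr_of_eventuallyEq ?_
  filter_upwards [(contDiff_regSq ε).continuous.continuousAt.eventually (lt_mem_nhds hz)] with y hy
  exact (fderiv_pogorelovApprox hy ξ).symm

theorem contDiff_pogD1 {ε : ℝ} (hε : 0 < ε) (ξ : Fin (m + 1) → ℂ) :
    ContDiff ℝ ∞ (pogD1 ε ξ) :=
  contDiff_iff_contDiffAt.2 fun z => contDiffAt_pogD1 (regSq_pos hε z) ξ

theorem continuous_pogBaseD (ξ : Fin (m + 1) → ℂ) : Continuous (pogBaseD ξ) :=
  continuous_iff_continuousAt.2 fun z => (hasFDerivAt_pogBaseD ξ z).choose_spec.1.continuousAt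

theorem continuous_regSqD (ξ : Fin (m + 1) → ℂ) : Continuous (regSqD ξ) :=
  continuous_iff_continuousAt.2 fun z => (hasFDerivAt_regSqD ξ z).choose_spec.1.continuousAt

theorem measurable_pogD1 (ε : ℝ) (ξ : Fin (m + 1) → ℂ) : Measurable (pogD1 ε ξ) := by
  have h1 := (continuous_pogBaseD ξ).measurable
  have h2 := (continuous_regSqD ξ).measurable
  have h3 := (contDiff_pogBase (m := m)).continuous.measurable
  have h4 := (contDiff_regSq (m := m) ε).continuous.measurable
  unfold pogD1
  fun_prop

theorem measurable_pogD2 (ε : ℝ) (ξ η : Fin (m + 1) → ℂ) : Measurable (pogD2 ε ξ η) := by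
  have h1 := (continuous_pogBaseD ξ).measurable
  have h2 := (continuous_regSqD ξ).measurable
  have h1' := (continuous_pogBaseD η).measurable
  have h2' := (continuous_regSqD η).measurable
  have h3 := (contDiff_pogBase (m := m)).continuous.measurable
  have h4 := (contDiff_regSq (m := m) ε).continuous.measurable
  unfold pogD2
  fun_prop

/-- Off the hyperplane the base of all powers stays positive at `ε = 0`; this supplies the pointwise
limit for dominated convergence. -/
theorem continuousAt_pogD1_eps {z : Fin (m + 1) → ℂ} (hz : z (Fin.last m) ≠ 0)
    (ξ : Fin (m + 1) → ℂ) : ContinuousAt (fun ε => pogD1 ε ξ z) 0 := by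
  have h := (regSq_pos_of_ne le_rfl hz).ne'
  have hc : ContinuousAt (fun ε => regSq ε z) 0 := by unfold regSq; fun_prop
  have hr : ∀ p : ℝ, ContinuousAt (fun ε => regSq ε z ^ p) 0 :=
    fun p => hc.rpow_const (Or.inl h)
  have h1 := hr (pogExp m)
  have h2 := hr (pogExp m - 1)
  exact ((h1.const_mul _).add (((h2.const_mul _).mul_const _).const_mul _)).const_mul _

theorem continuousAt_pogD2_eps {z : Fin (m + 1) → ℂ} (hz : z (Fin.last m) ≠ 0)
    (ξ η : Fin (m + 1) → ℂ) : ContinuousAt (fun ε => pogD2 ε ξ η z) 0 := by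
  have h := (regSq_pos_of_ne le_rfl hz).ne'
  have hc : ContinuousAt (fun ε => regSq ε z) 0 := by unfold regSq; fun_prop
  have hr : ∀ p : ℝ, ContinuousAt (fun ε => regSq ε z ^ p) 0 :=
    fun p => hc.rpow_const (Or.inl h)
  have h1 := hr (pogExp m)
  have h2 := hr (pogExp m - 1)
  have h3 := hr (pogExp m - 2)
  exact (((((h1.const_mul _).add (((h2.const_mul _).mul_const _).const_mul _)).add
    (((h2.const_mul _).mul_const _).const_mul _)).add
    (((((h3.const_mul _).mul_const _).const_mul _).mul_const _).const_mul _)).add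
    (((h2.const_mul _).mul_const _).const_mul _)).const_mul _

end Derivatives

/-! ### Singularities along the hyperplane `{z_n = 0}` -/

section Singularity

variable {m : ℕ}

/-- Balls for the sup norm are products of discs, so projecting to the last coordinate only produces
the volume of the other discs as a factor. This reduces integrability of powers of `|z_n|` to one
complex variable. -/
theorem map_eval_last_restrict_ball {R : ℝ} (hR : 0 < R) :
    ∃ c : ℝ≥0∞, c ≠ 0 ∧ c ≠ ⊤ ∧
      (volume.restrict (Metric.ball (0 : Fin (m + 1) → ℂ) R)).map (Function.eval (Fin.last m)) =
        c • volume.restrict (Metric.ball (0 : ℂ) R) := by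
  rw [ball_pi _ hR, volume_pi, Measure.restrict_pi_pi, Measure.pi_map_eval]
  refine ⟨_, ?_, ?_, rfl⟩
  · refine Finset.prod_ne_zero_iff.2 fun i _ => ?_
    simpa using (Metric.measure_ball_pos volume (0 : ℂ) hR).ne'
  · refine (ENNReal.prod_lt_top fun i _ => ?_).ne
    simpa using measure_ball_lt_top (μ := (volume : Measure ℂ)) (x := 0) (r := R)

theorem ae_last_ne_zero : ∀ᵐ z : Fin (m + 1) → ℂ, z (Fin.last m) ≠ 0 := by
  have h := Measure.pi_hyperplane (fun _ : Fin (m + 1) => (volume : Measure ℂ)) (Fin.last m) 0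
  exact (measure_eq_zero_iff_ae_notMem.1 h)

theorem integrableOn_ball_norm_rpow_iff {R t : ℝ} (hR : 0 < R) :
    IntegrableOn (fun w : ℂ => ‖w‖ ^ t) (Metric.ball 0 R) ↔ -2 < t := by
  rw [integrableOn_fun_norm_addHaar volume (f := fun r : ℝ => r ^ t), Complex.finrank_real_complex]
  -- The factor `y ^ (2 - 1)` is the Jacobian of polar coordinates in the plane; it turns the
  -- threshold `-1` on the half line into `-2`.
  have h : ∀ y ∈ Ioo 0 R, y ^ (2 - 1) • y ^ t = y ^ (t + 1) := fun y hy => by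
    simp only [smul_eq_mul]
    rw [Real.rpow_add_one hy.1.ne', mul_comm]
    simp
  rw [integrableOn_congr_fun h measurableSet_Ioo, intervalIntegral.integrableOn_Ioo_rpow_iff hR]
  constructor <;> intro h <;> linarith

theorem integrableOn_norm_last_rpow_iff {R t : ℝ} (hR : 0 < R) :
    IntegrableOn (fun z : Fin (m + 1) → ℂ => ‖z (Fin.last m)‖ ^ t) (Metric.ball 0 R) ↔
      -2 < t := by
  obtain ⟨c, hc0, hct, hc⟩ := map_eval_last_restrict_ball (m := m) hR
  rw [← integrableOn_ball_norm_rpow_iff hR, IntegrableOn, IntegrableOn,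
    ← integrable_smul_measure (f := fun w : ℂ => ‖w‖ ^ t) hc0 hct, ← hc, integrable_map_measure]
  · rfl
  · exact (by fun_prop : Measurable fun w : ℂ => ‖w‖ ^ t).aestronglyMeasurable
  · exact (measurable_pi_apply _).aemeasurable

theorem memLp_norm_last_rpow_iff {R t : ℝ} (hR : 0 < R) {p : ℝ≥0∞} (hp : p ≠ 0) (hp' : p ≠ ⊤) :
    MemLp (fun z : Fin (m + 1) → ℂ => ‖z (Fin.last m)‖ ^ t) p
      (volume.restrict (Metric.ball 0 R)) ↔ -2 < t * p.toReal := by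
  rw [← integrable_norm_rpow_iff _ hp hp', ← integrableOn_norm_last_rpow_iff (m := m) hR,
    IntegrableOn]
  · refine integrable_congr (.of_forall fun z => ?_)
    simp only
    rw [Real.norm_of_nonneg (by positivity), ← Real.rpow_mul (norm_nonneg _)]
  · exact (by fun_prop : Measurable fun z : Fin (m + 1) → ℂ =>
      ‖z (Fin.last m)‖ ^ t).aestronglyMeasurable

/-- `g` is `O(|z_n|^t)` near the points of `{z_n = 0}` and locally bounded elsewhere. -/
def LastBound {E : Type*} [Norm E] (t : ℝ) (g : (Fin (m + 1) → ℂ) → E) : Prop :=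
  ∀ R : ℝ, 0 < R → ∃ C : ℝ, 0 ≤ C ∧ ∀ z ∈ Metric.ball (0 : Fin (m + 1) → ℂ) R,
    z (Fin.last m) ≠ 0 → ‖g z‖ ≤ C * ‖z (Fin.last m)‖ ^ t

variable {E : Type*} [NormedAddCommGroup E]

theorem LastBound.memLp {t : ℝ} {g : (Fin (m + 1) → ℂ) → E} (hg : LastBound t g)
    (hm : AEStronglyMeasurable g volume) {p : ℝ≥0∞} (hp : p ≠ ⊤) (h : -2 < t * p.toReal)
    {K : Set (Fin (m + 1) → ℂ)} (hK : IsCompact K) : MemLp g p (volume.restrict K) := by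
  rcases eq_or_ne p 0 with rfl | hp0
  · exact memLp_zero_iff_aestronglyMeasurable.2 hm.restrict
  obtain ⟨R, hR, hKR⟩ := hK.isBounded.subset_ball_lt 0 0
  obtain ⟨C, -, hC⟩ := hg R hR
  refine MemLp.mono_measure (Measure.restrict_mono_set _ hKR) ?_
  refine (((memLp_norm_last_rpow_iff hR hp0 hp).2 h).const_mul C).mono' hm.restrict ?_
  rw [ae_restrict_iff' measurableSet_ball]
  filter_upwards [ae_last_ne_zero] with z hz hzR using hC z hzR hz

theorem LastBound.locallyIntegrable {t : ℝ} {g : (Fin (m + 1) → ℂ) → E} (hg : LastBound t g)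
    (hm : AEStronglyMeasurable g volume) (ht : -2 < t) : LocallyIntegrable g volume :=
  locallyIntegrable_iff.2 fun _ hK =>
    memLp_one_iff_integrable.1 (hg.memLp hm (by simp) (by simpa using ht) hK)

/-- Dominated convergence with majorant `C |z_n|^t M` on a ball containing the support of `φ`,
integrable because `t > -2`. All passages from `v_ε` to `v` under an integral go through this
statement. -/
theorem tendsto_integral_mul_of_lastBound {𝕜 : Type*} [RCLike 𝕜] {t : ℝ} (ht : -2 < t)
    {G : ℝ → (Fin (m + 1) → ℂ) → 𝕜}
    (hm : ∀ ε > 0, AEStronglyMeasurable (G ε) volume)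
    (hb : ∀ R : ℝ, 0 < R → ∃ C : ℝ, 0 ≤ C ∧ ∀ ε ∈ Icc (0 : ℝ) 1,
      ∀ z ∈ Metric.ball (0 : Fin (m + 1) → ℂ) R,
        z (Fin.last m) ≠ 0 → ‖G ε z‖ ≤ C * ‖z (Fin.last m)‖ ^ t)
    (hl : ∀ z : Fin (m + 1) → ℂ, z (Fin.last m) ≠ 0 → ContinuousAt (fun ε => G ε z) 0)
    {φ : (Fin (m + 1) → ℂ) → 𝕜} (hφ : Continuous φ) (hφ' : HasCompactSupport φ) :
    Tendsto (fun ε => ∫ z, G ε z * φ z) (𝓝[>] 0) (𝓝 (∫ z, G 0 z * φ z)) := by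
  obtain ⟨R, hR, hKR⟩ := hφ'.isCompact.isBounded.subset_ball_lt 0 0
  obtain ⟨C, hC0, hC⟩ := hb R hR
  obtain ⟨M, hM⟩ := hφ.bounded_above_of_compact_support hφ'
  refine tendsto_integral_filter_of_dominated_convergence
    ((Metric.ball 0 R).indicator fun z => C * ‖z (Fin.last m)‖ ^ t * M) ?_ ?_ ?_ ?_
  · filter_upwards [self_mem_nhdsWithin] with ε hε
    exact (hm ε hε).mul hφ.aestronglyMeasurable
  · filter_upwards [Ioc_mem_nhdsGT (zero_lt_one : (0 : ℝ) < 1)] with ε hε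
    filter_upwards [ae_last_ne_zero] with z hz
    by_cases hzR : z ∈ Metric.ball (0 : Fin (m + 1) → ℂ) R
    · rw [indicator_of_mem hzR, norm_mul]
      exact mul_le_mul (hC ε ⟨hε.1.le, hε.2⟩ z hzR hz) (hM z) (norm_nonneg _) (by positivity)
    · have : φ z = 0 := image_eq_zero_of_notMem_tsupport fun h => hzR (hKR h)
      simp [this, indicator_of_notMem hzR]
  · rw [integrable_indicator_iff measurableSet_ball]
    exact (((integrableOn_norm_last_rpow_iff hR).2 ht).const_mul C).mul_const M
  · filter_upwards [ae_last_ne_zero] with z hz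
    exact ((hl z hz).mul_const (φ z)).tendsto.mono_left nhdsWithin_le_nhds

/-! ### Bounds, uniform in `ε`, for the approximants and their first two derivatives -/

theorem rpow_regSq_le {ε : ℝ} (hε : 0 ≤ ε) {z : Fin (m + 1) → ℂ} (hz : z (Fin.last m) ≠ 0) :
    regSq ε z ^ (pogExp m - 1) ≤ ‖z (Fin.last m)‖ ^ (2 * pogExp m - 2) := by
  have hw := norm_pos_iff.2 hz
  -- The exponent is nonpositive, so dropping `ε` from the base can only increase the power; this is
  -- the source of uniformity in `ε`.
  calc regSq ε z ^ (pogExp m - 1) ≤ (‖z (Fin.last m)‖ ^ 2) ^ (pogExp m - 1) :=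
        Real.rpow_le_rpow_of_nonpos (by positivity) (by unfold regSq; linarith)
          (by linarith [pogExp_le_one m])
    _ = ‖z (Fin.last m)‖ ^ (2 * pogExp m - 2) := by
        rw [← Real.rpow_natCast, ← Real.rpow_mul hw.le]
        congr 1
        push_cast
        ring

/-- Each first derivative of `regSq` gains a factor `√s`; two of them compensate the extra `s⁻¹` in
the most singular second order term. -/
theorem abs_regSqD_le {ε : ℝ} (hε : 0 ≤ ε) (ξ z : Fin (m + 1) → ℂ) :
    |regSqD ξ z| ≤ 2 * √(regSq ε z) * ‖ξ (Fin.last m)‖ := by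
  have h1 := abs_real_inner_le_norm (z (Fin.last m)) (ξ (Fin.last m))
  have h2 : ‖z (Fin.last m)‖ ≤ √(regSq ε z) := Real.le_sqrt_of_sq_le (by unfold regSq; linarith)
  rw [regSqD, abs_mul, abs_two, mul_assoc]
  exact mul_le_mul_of_nonneg_left
    (h1.trans (mul_le_mul_of_nonneg_right h2 (norm_nonneg _))) zero_le_two

theorem continuous_regSq_uncurry :
    Continuous fun p : ℝ × (Fin (m + 1) → ℂ) => regSq p.1 p.2 := by
  unfold regSq
  fun_prop

/-- A function which is `regSq ^ (pogExp m - 1)` times a continuous function satisfies a bound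
that is uniform in `ε`. -/
theorem exists_bound_of_eq_rpow_mul {G B : ℝ → (Fin (m + 1) → ℂ) → ℝ}
    (hB : Continuous fun p : ℝ × (Fin (m + 1) → ℂ) => B p.1 p.2)
    (hG : ∀ ε ∈ Icc (0 : ℝ) 1, ∀ z : Fin (m + 1) → ℂ, z (Fin.last m) ≠ 0 →
      |G ε z| ≤ regSq ε z ^ (pogExp m - 1) * B ε z) (R : ℝ) :
    ∃ C : ℝ, 0 ≤ C ∧ ∀ ε ∈ Icc (0 : ℝ) 1, ∀ z ∈ Metric.ball (0 : Fin (m + 1) → ℂ) R,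
      z (Fin.last m) ≠ 0 → ‖G ε z‖ ≤ C * ‖z (Fin.last m)‖ ^ (2 * pogExp m - 2) := by
  obtain ⟨C, hC⟩ := (isCompact_Icc.prod (isCompact_closedBall (0 : Fin (m + 1) → ℂ) R) :
    IsCompact (Icc (0 : ℝ) 1 ×ˢ _)).exists_bound_of_continuousOn hB.continuousOn
  refine ⟨max C 0, le_max_right _ _, fun ε hε z hzR hz => ?_⟩
  have h1 : B ε z ≤ max C 0 := (le_abs_self _).trans
    ((hC (ε, z) ⟨hε, Metric.ball_subset_closedBall hzR⟩).trans (le_max_left _ _))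
  calc ‖G ε z‖ ≤ regSq ε z ^ (pogExp m - 1) * B ε z := hG ε hε z hz
    _ ≤ regSq ε z ^ (pogExp m - 1) * max C 0 :=
        mul_le_mul_of_nonneg_left h1 (Real.rpow_nonneg (regSq_nonneg hε.1 z) _)
    _ ≤ ‖z (Fin.last m)‖ ^ (2 * pogExp m - 2) * max C 0 :=
        mul_le_mul_of_nonneg_right (rpow_regSq_le hε.1 hz) (le_max_right _ _)
    _ = _ := mul_comm _ _

theorem exists_bound_pogorelovApprox (R : ℝ) :
    ∃ C : ℝ, 0 ≤ C ∧ ∀ ε ∈ Icc (0 : ℝ) 1, ∀ z ∈ Metric.ball (0 : Fin (m + 1) → ℂ) R,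
      z (Fin.last m) ≠ 0 →
        ‖pogorelovApprox m ε z‖ ≤ C * ‖z (Fin.last m)‖ ^ (2 * pogExp m - 2) := by
  refine exists_bound_of_eq_rpow_mul (B := fun ε z => pogConst m * pogBase z * regSq ε z) ?_ ?_ R
  · have h1 := (contDiff_pogBase (m := m)).continuous
    have h2 := continuous_regSq_uncurry (m := m)
    fun_prop
  · intro ε hε z hz
    have hs := regSq_pos_of_ne hε.1 hz
    have hc := pogConst_pos m
    have hA := pogBase_pos z
    rw [pogorelovApprox_eq, abs_of_nonneg (by positivity), Real.rpow_sub_one hs.ne']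
    apply le_of_eq
    field_simp

theorem exists_bound_pogD1 (ξ : Fin (m + 1) → ℂ) (R : ℝ) :
    ∃ C : ℝ, 0 ≤ C ∧ ∀ ε ∈ Icc (0 : ℝ) 1, ∀ z ∈ Metric.ball (0 : Fin (m + 1) → ℂ) R,
      z (Fin.last m) ≠ 0 →
        ‖pogD1 ε ξ z‖ ≤ C * ‖z (Fin.last m)‖ ^ (2 * pogExp m - 2) := by
  refine exists_bound_of_eq_rpow_mul (B := fun ε z => |pogConst m *
    (pogBaseD ξ z * regSq ε z + pogBase z * (pogExp m * regSqD ξ z))|) ?_ ?_ R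
  · have h1 := (contDiff_pogBase (m := m)).continuous
    have h2 := continuous_regSq_uncurry (m := m)
    have h3 := continuous_pogBaseD ξ
    have h4 := continuous_regSqD ξ
    fun_prop
  · intro ε hε z hz
    have hs := regSq_pos_of_ne hε.1 hz
    rw [← abs_of_nonneg (Real.rpow_nonneg hs.le (pogExp m - 1)), ← abs_mul,
      Real.rpow_sub_one hs.ne', pogD1, Real.rpow_sub_one hs.ne']
    apply le_of_eq
    congr 1
    field_simp

/-- All terms but one have a power `s^{α-1}` or better. The exception carries `s^{α-2}`, but
multiplied by `regSqD ξ * regSqD η = O(s)`, so it is no worse. -/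
theorem exists_bound_pogD2 (ξ η : Fin (m + 1) → ℂ) (R : ℝ) :
    ∃ C : ℝ, 0 ≤ C ∧ ∀ ε ∈ Icc (0 : ℝ) 1, ∀ z ∈ Metric.ball (0 : Fin (m + 1) → ℂ) R,
      z (Fin.last m) ≠ 0 →
        ‖pogD2 ε ξ η z‖ ≤ C * ‖z (Fin.last m)‖ ^ (2 * pogExp m - 2) := by
  refine exists_bound_of_eq_rpow_mul (B := fun ε z => |pogConst m *
    (pogBaseD ξ η * regSq ε z + pogBaseD ξ z * (pogExp m * regSqD η z) +
      pogBaseD η z * (pogExp m * regSqD ξ z) + pogBase z * (pogExp m * regSqD ξ η))| +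
    |pogConst m * pogBase z * pogExp m * (pogExp m - 1)| *
      (4 * ‖ξ (Fin.last m)‖ * ‖η (Fin.last m)‖)) ?_ ?_ R
  · have h1 := (contDiff_pogBase (m := m)).continuous
    have h2 := continuous_regSq_uncurry (m := m)
    have h3 := continuous_pogBaseD ξ
    have h4 := continuous_regSqD ξ
    have h5 := continuous_pogBaseD η
    have h6 := continuous_regSqD η
    fun_prop
  · intro ε hε z hz
    have hs := regSq_pos_of_ne hε.1 hz
    have h1 : pogD2 ε ξ η z = regSq ε z ^ (pogExp m - 1) * (pogConst m *
        (pogBaseD ξ η * regSq ε z + pogBaseD ξ z * (pogExp m * regSqD η z) +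
          pogBaseD η z * (pogExp m * regSqD ξ z) + pogBase z * (pogExp m * regSqD ξ η)) +
        pogConst m * pogBase z * pogExp m * (pogExp m - 1) *
          (regSqD ξ z * regSqD η z / regSq ε z)) := by
      rw [pogD2, show pogExp m - 2 = pogExp m - 1 - 1 by ring]
      simp only [Real.rpow_sub_one hs.ne']
      field_simp
      ring
    have h2 : |regSqD ξ z * regSqD η z / regSq ε z| ≤ 4 * ‖ξ (Fin.last m)‖ * ‖η (Fin.last m)‖ := by
      rw [abs_div, abs_of_pos hs, div_le_iff₀ hs, abs_mul]
      calc |regSqD ξ z| * |regSqD η z|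
          ≤ (2 * √(regSq ε z) * ‖ξ (Fin.last m)‖) * (2 * √(regSq ε z) * ‖η (Fin.last m)‖) :=
            mul_le_mul (abs_regSqD_le hε.1 ξ z) (abs_regSqD_le hε.1 η z) (abs_nonneg _)
              (by positivity)
        _ = 4 * ‖ξ (Fin.last m)‖ * ‖η (Fin.last m)‖ * (√(regSq ε z) * √(regSq ε z)) := by ring
        _ = _ := by rw [Real.mul_self_sqrt hs.le]
    rw [h1, abs_mul, abs_of_nonneg (Real.rpow_nonneg hs.le _)]
    refine mul_le_mul_of_nonneg_left ((abs_add_le _ _).trans ?_) (Real.rpow_nonneg hs.le _)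
    rw [abs_mul _ (regSqD ξ z * regSqD η z / regSq ε z)]
    gcongr

/-! ### Weak derivatives -/

theorem integral_mul_fderiv_eq_neg {n : ℕ} {f φ : (Fin n → ℂ) → ℝ} (hf : ContDiff ℝ ∞ f)
    (hφ : ContDiff ℝ ∞ φ) (hφ' : HasCompactSupport φ) (ξ : Fin n → ℂ) :
    ∫ z, f z * fderiv ℝ φ z ξ = - ∫ z, fderiv ℝ f z ξ * φ z := by
  have h1 : Continuous fun z => fderiv ℝ f z ξ :=
    (hf.continuous_fderiv (by simp)).clm_apply continuous_const
  have h2 : Continuous fun z => fderiv ℝ φ z ξ :=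
    (hφ.continuous_fderiv (by simp)).clm_apply continuous_const
  have h3 : HasCompactSupport fun z => fderiv ℝ φ z ξ := hφ'.fderiv_apply ℝ ξ
  refine integral_mul_fderiv_eq_neg_fderiv_mul_of_integrable ?_ ?_ ?_
    (fun z _ => hf.differentiable (by simp) z) (fun z _ => hφ.differentiable (by simp) z)
  · exact (h1.mul hφ.continuous).integrable_of_hasCompactSupport hφ'.mul_left
  · exact (hf.continuous.mul h2).integrable_of_hasCompactSupport h3.mul_left
  · exact (hf.continuous.mul hφ.continuous).integrable_of_hasCompactSupport hφ'.mul_left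

theorem neg_two_lt_two_mul_pogExp_sub_two (m : ℕ) : -2 < 2 * pogExp m - 2 := by
  linarith [pogExp_pos m]

/-- The classical integration by parts holds for `v_ε`, and both sides converge as `ε → 0⁺`; the
pointwise derivative off the hyperplane is therefore the whole weak derivative. -/
theorem hasWeakDeriv_pogorelov (ξ : Fin (m + 1) → ℂ) :
    HasWeakDeriv (pogorelov m) (pogD1 0 ξ) ξ := by
  intro φ hφ hφ'
  have h2 : Continuous fun z => fderiv ℝ φ z ξ :=
    (hφ.continuous_fderiv (by simp)).clm_apply continuous_const
  have h3 : HasCompactSupport fun z => fderiv ℝ φ z ξ := hφ'.fderiv_apply ℝ ξ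
  have ht := neg_two_lt_two_mul_pogExp_sub_two m
  have L1 := tendsto_integral_mul_of_lastBound ht (G := pogorelovApprox m)
    (fun ε hε => (contDiff_pogorelovApprox hε).continuous.aestronglyMeasurable)
    (fun R _ => exists_bound_pogorelovApprox R) (fun z hz => ?_) h2 h3
  · have L2 := tendsto_integral_mul_of_lastBound ht (G := fun ε => pogD1 ε ξ)
      (fun ε hε => (contDiff_pogD1 hε ξ).continuous.aestronglyMeasurable)
      (fun R _ => exists_bound_pogD1 ξ R) (fun z hz => continuousAt_pogD1_eps hz ξ)
      hφ.continuous hφ'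
    rw [pogorelovApprox_zero] at L1
    refine tendsto_nhds_unique L1 (L2.neg.congr' ?_)
    filter_upwards [self_mem_nhdsWithin] with ε hε
    rw [integral_mul_fderiv_eq_neg (contDiff_pogorelovApprox hε) hφ hφ']
    simp_rw [fderiv_pogorelovApprox (regSq_pos hε _)]
  · have hc : ContinuousAt (fun ε => regSq ε z) 0 := by unfold regSq; fun_prop
    exact (hc.rpow_const (Or.inl (regSq_pos_of_ne le_rfl hz).ne')).const_mul _

theorem hasWeakDeriv_pogD1 (ξ η : Fin (m + 1) → ℂ) :
    HasWeakDeriv (pogD1 0 ξ) (pogD2 0 ξ η) η := by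
  intro φ hφ hφ'
  have h2 : Continuous fun z => fderiv ℝ φ z η :=
    (hφ.continuous_fderiv (by simp)).clm_apply continuous_const
  have h3 : HasCompactSupport fun z => fderiv ℝ φ z η := hφ'.fderiv_apply ℝ η
  have ht := neg_two_lt_two_mul_pogExp_sub_two m
  have L1 := tendsto_integral_mul_of_lastBound ht (G := fun ε => pogD1 ε ξ)
    (fun ε hε => (contDiff_pogD1 hε ξ).continuous.aestronglyMeasurable)
    (fun R _ => exists_bound_pogD1 ξ R) (fun z hz => continuousAt_pogD1_eps hz ξ) h2 h3
  have L2 := tendsto_integral_mul_of_lastBound ht (G := fun ε => pogD2 ε ξ η)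
    (fun ε hε => (measurable_pogD2 ε ξ η).aestronglyMeasurable)
    (fun R _ => exists_bound_pogD2 ξ η R) (fun z hz => continuousAt_pogD2_eps hz ξ η)
    hφ.continuous hφ'
  refine tendsto_nhds_unique L1 (L2.neg.congr' ?_)
  filter_upwards [self_mem_nhdsWithin] with ε hε
  rw [integral_mul_fderiv_eq_neg (contDiff_pogD1 hε ξ) hφ hφ']
  simp_rw [fderiv_pogD1 (regSq_pos hε _)]

end Singularity

/-! ### Sobolev regularity -/

section Sobolev

variable {m : ℕ}

/-- With `α = 1/n`, the condition `-2 < (2α - 2) p` reads `p (n - 1) < n`. The value `p = ∞` is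
admitted by the hypothesis only for `n = 1`, where the exponent `2α - 2` is `0` and the bound is a
plain sup bound. -/
theorem memLpLocal_of_lastBound {g : (Fin (m + 1) → ℂ) → ℝ}
    (hg : LastBound (2 * pogExp m - 2) g) (hm : AEStronglyMeasurable g volume) {p : ℝ≥0∞}
    (hp : p * (m : ℝ≥0∞) < (m : ℝ≥0∞) + 1) : MemLpLocal g p := by
  intro K hK
  rcases eq_or_ne p ⊤ with rfl | hp'
  · have hm0 : m = 0 := by
      by_contra h
      rw [ENNReal.top_mul (by exact_mod_cast h)] at hp
      exact not_top_lt hp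
    subst hm0
    obtain ⟨R, hR, hKR⟩ := hK.isBounded.subset_ball_lt 0 0
    obtain ⟨C, -, hC⟩ := hg R hR
    refine MemLp.mono_measure (Measure.restrict_mono_set _ hKR) ?_
    refine memLp_top_of_bound hm.restrict C ?_
    rw [ae_restrict_iff' measurableSet_ball]
    filter_upwards [ae_last_ne_zero] with z hz hzR
    simpa [pogExp] using hC z hzR hz
  · refine hg.memLp hm hp' ?_ hK
    have h : p.toReal * m < m + 1 := by
      have := (ENNReal.toReal_lt_toReal (ENNReal.mul_ne_top hp' (by simp)) (by simp)).2 hp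
      simpa [ENNReal.toReal_add] using this
    have h2 : 2 * pogExp m - 2 = - (2 * m / ((m : ℝ) + 1)) := by
      unfold pogExp
      field_simp
      ring
    have h3 : 2 * m / ((m : ℝ) + 1) * p.toReal < 2 := by
      rw [div_mul_eq_mul_div, div_lt_iff₀ (by positivity)]
      linarith
    rw [h2]
    linarith

theorem lastBound_pogorelov : LastBound (2 * pogExp m - 2) (pogorelov m) := by
  intro R _
  obtain ⟨C, hC0, hC⟩ := exists_bound_pogorelovApprox (m := m) R
  refine ⟨C, hC0, fun z hz hz' => ?_⟩
  rw [← pogorelovApprox_zero]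
  exact hC 0 (by simp) z hz hz'

theorem lastBound_pogD1 (ξ : Fin (m + 1) → ℂ) : LastBound (2 * pogExp m - 2) (pogD1 0 ξ) := by
  intro R _
  obtain ⟨C, hC0, hC⟩ := exists_bound_pogD1 ξ R
  exact ⟨C, hC0, hC 0 (by simp)⟩

theorem lastBound_pogD2 (ξ η : Fin (m + 1) → ℂ) :
    LastBound (2 * pogExp m - 2) (pogD2 0 ξ η) := by
  intro R _
  obtain ⟨C, hC0, hC⟩ := exists_bound_pogD2 ξ η R
  exact ⟨C, hC0, hC 0 (by simp)⟩

theorem continuous_pogorelov : Continuous (pogorelov m) := by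
  have h1 := (contDiff_pogBase (m := m)).continuous
  have h2 : Continuous fun z : Fin (m + 1) → ℂ =>
      ‖z (Fin.last m)‖ ^ (2 / ((m : ℝ) + 1)) :=
    (by fun_prop : Continuous fun z : Fin (m + 1) → ℂ => ‖z (Fin.last m)‖).rpow_const
      fun _ => Or.inr (by positivity)
  exact (continuous_const.mul h1).mul h2

theorem memW2Local_pogorelov {p : ℝ≥0∞} (hp : p * (m : ℝ≥0∞) < (m : ℝ≥0∞) + 1) :
    MemW2Local (pogorelov m) p :=
  ⟨memLpLocal_of_lastBound lastBound_pogorelov continuous_pogorelov.aestronglyMeasurable hp,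
    fun ξ => ⟨pogD1 0 ξ, memLpLocal_of_lastBound (lastBound_pogD1 ξ)
      (measurable_pogD1 0 ξ).aestronglyMeasurable hp, hasWeakDeriv_pogorelov ξ,
      fun η => ⟨pogD2 0 ξ η, memLpLocal_of_lastBound (lastBound_pogD2 ξ η)
        (measurable_pogD2 0 ξ η).aestronglyMeasurable hp, hasWeakDeriv_pogD1 ξ η⟩⟩⟩

theorem MemLpLocal.locallyIntegrable {n : ℕ} {f : (Fin n → ℂ) → ℝ} {p : ℝ≥0∞}
    (hf : MemLpLocal f p) (hp : 1 ≤ p) : LocallyIntegrable f volume :=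
  locallyIntegrable_iff.2 fun K hK =>
    have : IsFiniteMeasure (volume.restrict K) := ⟨by simpa using hK.measure_lt_top⟩
    (hf K hK).integrable hp

theorem HasWeakDeriv.ae_eq {n : ℕ} {f g g' : (Fin n → ℂ) → ℝ} {ξ : Fin n → ℂ}
    (h : HasWeakDeriv f g ξ) (h' : HasWeakDeriv f g' ξ) (hg : LocallyIntegrable g volume)
    (hg' : LocallyIntegrable g' volume) : g =ᵐ[volume] g' := by
  refine ae_eq_of_integral_contDiff_smul_eq hg hg' fun φ hφ hφ' => ?_
  have := (h φ hφ hφ').symm.trans (h' φ hφ hφ')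
  simpa [mul_comm] using this

theorem HasWeakDeriv.congr_ae {n : ℕ} {f f' g : (Fin n → ℂ) → ℝ} {ξ : Fin n → ℂ}
    (h : HasWeakDeriv f g ξ) (hf : f =ᵐ[volume] f') : HasWeakDeriv f' g ξ := by
  intro φ hφ hφ'
  rw [← h φ hφ hφ']
  refine integral_congr_ae ?_
  filter_upwards [hf] with z hz
  rw [hz]

/-- Weak derivatives are unique among locally integrable functions, so those provided by the Sobolev
hypothesis must be the explicit ones. -/
theorem MemW2Local.memLpLocal_pogD2 {p : ℝ≥0∞} (hp : 1 ≤ p) (h : MemW2Local (pogorelov m) p)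
    (ξ η : Fin (m + 1) → ℂ) : MemLpLocal (pogD2 0 ξ η) p := by
  obtain ⟨g, hg, hgv, hgη⟩ := h.2 ξ
  obtain ⟨k, hk, hkg⟩ := hgη η
  have ht := neg_two_lt_two_mul_pogExp_sub_two m
  have e1 : g =ᵐ[volume] pogD1 0 ξ := hgv.ae_eq (hasWeakDeriv_pogorelov ξ)
    (hg.locallyIntegrable hp)
    ((lastBound_pogD1 ξ).locallyIntegrable (measurable_pogD1 0 ξ).aestronglyMeasurable ht)
  have e2 : k =ᵐ[volume] pogD2 0 ξ η := (hkg.congr_ae e1).ae_eq (hasWeakDeriv_pogD1 ξ η)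
    (hk.locallyIntegrable hp)
    ((lastBound_pogD2 ξ η).locallyIntegrable (measurable_pogD2 0 ξ η).aestronglyMeasurable ht)
  exact fun K hK => (memLp_congr_ae (ae_restrict_of_ae e2)).1 (hk K hK)

/-- The Laplacian in `z_n` of `|z_n|^{2α}` is `4α²|z_n|^{2α-2}`. Taking this combination of second
derivatives leaves a single positive power, whose failure of integrability can be read off. -/
theorem pogD2_last_add_pogD2_last {z : Fin (m + 1) → ℂ} (hz : z (Fin.last m) ≠ 0) :
    pogD2 0 (Pi.single (Fin.last m) 1) (Pi.single (Fin.last m) 1) z +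
      pogD2 0 (Pi.single (Fin.last m) Complex.I) (Pi.single (Fin.last m) Complex.I) z =
    4 * pogConst m * pogExp m ^ 2 * pogBase z * ‖z (Fin.last m)‖ ^ (2 * pogExp m - 2) := by
  have hs := regSq_pos_of_ne le_rfl hz
  have h1 : ‖z (Fin.last m)‖ ^ (2 * pogExp m - 2) = regSq 0 z ^ (pogExp m - 1) := by
    rw [regSq, add_zero, ← Real.rpow_natCast, ← Real.rpow_mul (norm_nonneg _)]
    congr 1
    push_cast
    ring
  have h2 : regSq 0 z = (z (Fin.last m)).re ^ 2 + (z (Fin.last m)).im ^ 2 := by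
    rw [regSq, add_zero, Complex.sq_norm, Complex.normSq_apply]
    ring
  have h3 : ∀ (a : ℂ) (i : Fin m), (Pi.single (Fin.last m) a : Fin (m + 1) → ℂ) i.castSucc = 0 :=
    fun a i => Pi.single_eq_of_ne (Fin.castSucc_lt_last i).ne _
  have h4 : regSq 0 z ^ (pogExp m - 1) = regSq 0 z ^ (pogExp m - 2) * regSq 0 z := by
    rw [← Real.rpow_add_one hs.ne']
    congr 1
    ring
  rw [h1]
  simp only [pogD2, pogBaseD, regSqD, h3, Pi.single_eq_same, inner_zero_right, Complex.inner,
    Finset.sum_const_zero]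
  rw [h4]
  simp only [Complex.mul_re, Complex.conj_re, Complex.conj_im, Complex.one_re, Complex.one_im,
    Complex.I_re, Complex.I_im]
  generalize regSq 0 z ^ (pogExp m - 2) = S
  rw [h2]
  ring

theorem not_memW2Local_pogorelov {p : ℝ≥0∞} (hp : 1 ≤ p)
    (hpm : (m : ℝ≥0∞) + 1 ≤ p * (m : ℝ≥0∞)) : ¬ MemW2Local (pogorelov m) p := by
  intro h
  have hm : m ≠ 0 := by
    rintro rfl
    simp at hpm
  -- A finite exponent is needed for the power criterion. When `p = ∞`, `q = 2` suffices, since `m +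
  -- 1 ≤ 2m` for `m ≥ 1`.
  obtain ⟨q, hq1, hq, hqp, hqm⟩ : ∃ q : ℝ≥0∞, 1 ≤ q ∧ q ≠ ⊤ ∧ q ≤ p ∧
      (m : ℝ) + 1 ≤ q.toReal * m := by
    rcases eq_or_ne p ⊤ with rfl | hp'
    · refine ⟨2, by norm_num, by simp, le_top, ?_⟩
      have : (1 : ℝ) ≤ m := by exact_mod_cast Nat.one_le_iff_ne_zero.2 hm
      simp
      linarith
    · refine ⟨p, hp, hp', le_rfl, ?_⟩
      have := (ENNReal.toReal_le_toReal (by simp) (ENNReal.mul_ne_top hp' (by simp))).2 hpm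
      simpa [ENNReal.toReal_add] using this
  let K := Metric.closedBall (0 : Fin (m + 1) → ℂ) 1
  have hK : IsCompact K := isCompact_closedBall _ _
  have : IsFiniteMeasure (volume.restrict K) := ⟨by simpa using hK.measure_lt_top⟩
  have h1 := (h.memLpLocal_pogD2 hp (Pi.single (Fin.last m) 1) (Pi.single (Fin.last m) 1)
    K hK).mono_exponent hqp
  have h2 := (h.memLpLocal_pogD2 hp (Pi.single (Fin.last m) Complex.I)
    (Pi.single (Fin.last m) Complex.I) K hK).mono_exponent hqp
  have h3 := ((h1.add h2).const_mul (4 * pogConst m * pogExp m ^ 2)⁻¹).mono_measure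
    (Measure.restrict_mono_set volume Metric.ball_subset_closedBall)
  have h4 : MemLp (fun z : Fin (m + 1) → ℂ => ‖z (Fin.last m)‖ ^ (2 * pogExp m - 2)) q
      (volume.restrict (Metric.ball 0 1)) := by
    refine h3.of_le (by fun_prop : Measurable fun z : Fin (m + 1) → ℂ =>
      ‖z (Fin.last m)‖ ^ (2 * pogExp m - 2)).aestronglyMeasurable ?_
    filter_upwards [ae_restrict_of_ae ae_last_ne_zero] with z hz
    have hc := pogConst_pos m
    have ha := pogExp_pos m
    rw [Pi.add_apply, pogD2_last_add_pogD2_last hz, mul_assoc _ (pogBase z),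
      inv_mul_cancel_left₀ (by positivity), norm_mul, Real.norm_of_nonneg (pogBase_pos z).le]
    exact le_mul_of_one_le_left (norm_nonneg _) (one_le_pogBase z)
  rw [memLp_norm_last_rpow_iff one_pos (one_pos.trans_le hq1).ne' hq] at h4
  have h5 : 2 * pogExp m - 2 = - (2 * m / ((m : ℝ) + 1)) := by
    unfold pogExp
    field_simp
    ring
  have h6 : 2 ≤ 2 * m / ((m : ℝ) + 1) * q.toReal := by
    rw [div_mul_eq_mul_div, le_div_iff₀ (by positivity)]
    linarith
  rw [h5] at h4
  linarith

theorem memW2Local_pogorelov_iff {p : ℝ≥0∞} (hp : 1 ≤ p) :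
    MemW2Local (pogorelov m) p ↔ p * (m : ℝ≥0∞) < (m : ℝ≥0∞) + 1 :=
  ⟨fun h => not_le.1 fun h' => not_memW2Local_pogorelov hp h' h, memW2Local_pogorelov⟩

end Sobolev

/-! ### Plurisubharmonicity -/

section Plurisubharmonic

variable {m : ℕ}

/-- On the unit circle `|1 + aξ| = |ξ⁻¹ + a|`, and circle averages are invariant under `ξ ↦ ξ⁻¹`, so
the mean equals `log⁺ |a|`. -/
theorem circleAverage_log_norm_one_add_mul_nonneg (a : ℂ) :
    0 ≤ Real.circleAverage (fun ξ : ℂ => Real.log ‖1 + a * ξ‖) 0 1 := by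
  have h : Real.circleAverage (fun ξ : ℂ => Real.log ‖1 + a * ξ‖) 0 1 =
      Real.circleAverage (fun ξ : ℂ => Real.log ‖ξ⁻¹ + a‖) 0 1 := by
    refine Real.circleAverage_congr_sphere fun ξ hξ => ?_
    have hξ1 : ‖ξ‖ = 1 := by simpa using hξ
    have hξ0 : ξ ≠ 0 := by
      rintro rfl
      simp at hξ1
    have : 1 + a * ξ = (ξ⁻¹ + a) * ξ := by field_simp
    rw [this, norm_mul, hξ1, mul_one]
  rw [h, Real.circleAverage_zero_one_congr_inv (f := fun ξ : ℂ => Real.log ‖ξ + a‖),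
    circleAverage_log_norm_add_const_eq_posLog]
  exact Real.posLog_nonneg

theorem circleIntegrable_log_norm_one_add_mul (a : ℂ) :
    CircleIntegrable (fun ξ : ℂ => Real.log ‖1 + a * ξ‖) 0 1 :=
  MeromorphicOn.circleIntegrable_log_norm (f := fun ξ : ℂ => 1 + a * ξ) fun _ _ => by fun_prop

theorem ae_one_add_mul_circleMap_ne_zero (a : ℂ) :
    ∀ᵐ θ : ℝ, 1 + a * circleMap 0 1 θ ≠ 0 := by
  have hc : {θ : ℝ | 1 + a * circleMap 0 1 θ = 0}.Countable := by
    refine ((countable_singleton (-a⁻¹)).preimage_circleMap 0 one_ne_zero).mono fun θ hθ => ?_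
    have hθ' : 1 + a * circleMap 0 1 θ = 0 := hθ
    have ha : a ≠ 0 := by
      rintro rfl
      simp at hθ'
    rw [mem_preimage, mem_singleton_iff]
    field_simp
    linear_combination hθ'
  exact measure_eq_zero_iff_ae_notMem.1 (hc.measure_zero volume)

/-- The logarithms have nonnegative mean, so averaging the lower bound gives `f₀`. Zeros of the
linear factors are excluded because the convention `Real.log 0 = 0` would make the hypothesis too
strong there; on the circle they form a null set. -/
theorem le_circleAverage_of_log_le {f : ℂ → ℝ} (hf : Continuous f) {f₀ α : ℝ} (hf₀ : 0 ≤ f₀)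
    (hα : 0 ≤ α) (a b : ℂ) (h : ∀ ξ : ℂ, 1 + a * ξ ≠ 0 → 1 + b * ξ ≠ 0 →
      f₀ * (1 + (2 * Real.log ‖1 + a * ξ‖ + 2 * α * Real.log ‖1 + b * ξ‖)) ≤ f ξ) :
    f₀ ≤ Real.circleAverage f 0 1 := by
  have ia := (circleIntegrable_log_norm_one_add_mul a).const_fun_smul (a := (2 : ℝ))
  have ib := (circleIntegrable_log_norm_one_add_mul b).const_fun_smul (a := 2 * α)
  have i1 := (circleIntegrable_const (1 : ℝ) 0 1)
  have iab := ia.add ib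
  have ig := (i1.add iab).const_fun_smul (a := f₀)
  have e : Real.circleAverage (fun ξ : ℂ => f₀ • ((fun _ => 1) +
      ((fun ξ : ℂ => (2 : ℝ) • Real.log ‖1 + a * ξ‖) +
        fun ξ : ℂ => (2 * α) • Real.log ‖1 + b * ξ‖) : ℂ → ℝ) ξ) 0 1 =
      f₀ * (1 + (2 * Real.circleAverage (fun ξ : ℂ => Real.log ‖1 + a * ξ‖) 0 1 +
        2 * α * Real.circleAverage (fun ξ : ℂ => Real.log ‖1 + b * ξ‖) 0 1)) := by
    rw [Real.circleAverage_fun_smul, Real.circleAverage_add i1 iab, Real.circleAverage_add ia ib,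
      Real.circleAverage_fun_smul, Real.circleAverage_fun_smul, Real.circleAverage_const]
    rfl
  have ha := circleAverage_log_norm_one_add_mul_nonneg a
  have hb := circleAverage_log_norm_one_add_mul_nonneg b
  calc f₀ = f₀ * (1 + (2 * 0 + 2 * α * 0)) := by ring
    _ ≤ f₀ * (1 + (2 * Real.circleAverage (fun ξ : ℂ => Real.log ‖1 + a * ξ‖) 0 1 +
        2 * α * Real.circleAverage (fun ξ : ℂ => Real.log ‖1 + b * ξ‖) 0 1)) := by gcongr
    _ ≤ Real.circleAverage f 0 1 := by
      rw [← e, Real.circleAverage_def, Real.circleAverage_def]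
      refine smul_le_smul_of_nonneg_left ?_ (by positivity)
      refine intervalIntegral.integral_mono_ae (by positivity) ig
        (hf.comp (continuous_circleMap 0 1)).continuousOn.intervalIntegrable ?_
      filter_upwards [ae_one_add_mul_circleMap_ne_zero a, ae_one_add_mul_circleMap_ne_zero b]
        with θ h1 h2 using h _ h1 h2

/-- Cauchy–Schwarz for the vectors `(√ε, x)` and `(√ε, y)`. -/
theorem norm_add_sum_conj_mul_sq_le {ι : Type*} [Fintype ι] {ε : ℝ} (hε : 0 ≤ ε) (x y : ι → ℂ) :
    ‖(ε : ℂ) + ∑ i, (starRingEnd ℂ) (x i) * y i‖ ^ 2 ≤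
      (ε + ∑ i, ‖x i‖ ^ 2) * (ε + ∑ i, ‖y i‖ ^ 2) := by
  have h1 : ‖(ε : ℂ) + ∑ i, (starRingEnd ℂ) (x i) * y i‖ ≤ ε + ∑ i, ‖x i‖ * ‖y i‖ := by
    refine (norm_add_le _ _).trans (add_le_add ?_ ((norm_sum_le _ _).trans_eq ?_))
    · simp [abs_of_nonneg hε]
    · simp
  have h2 := Finset.sum_mul_sq_le_sq_mul_sq Finset.univ (fun i => ‖x i‖) (fun i => ‖y i‖)
  have h3 : 2 * ∑ i, ‖x i‖ * ‖y i‖ ≤ ∑ i, ‖x i‖ ^ 2 + ∑ i, ‖y i‖ ^ 2 := by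
    rw [Finset.mul_sum, ← Finset.sum_add_distrib]
    exact Finset.sum_le_sum fun i _ => by linarith [two_mul_le_add_sq ‖x i‖ ‖y i‖]
  calc ‖(ε : ℂ) + ∑ i, (starRingEnd ℂ) (x i) * y i‖ ^ 2 ≤ (ε + ∑ i, ‖x i‖ * ‖y i‖) ^ 2 := by gcongr
    _ ≤ _ := by nlinarith [mul_le_mul_of_nonneg_left h3 hε]

/-- The logarithm of `ε + ∑ |x_i|²` is subharmonic along complex lines, in quantitative form. -/
theorem exists_mul_norm_one_add_mul_sq_le {ι : Type*} [Fintype ι] {ε : ℝ} (hε : 0 ≤ ε)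
    (x ζ : ι → ℂ) (h : 0 < ε + ∑ i, ‖x i‖ ^ 2) :
    ∃ a : ℂ, ∀ ξ : ℂ, (ε + ∑ i, ‖x i‖ ^ 2) * ‖1 + a * ξ‖ ^ 2 ≤ ε + ∑ i, ‖x i + ξ * ζ i‖ ^ 2 := by
  set P := ε + ∑ i, ‖x i‖ ^ 2 with hP
  -- With `a = ⟨x, ζ⟩ / P` the pairing `ε + ⟨x, x + ξζ⟩` equals `P (1 + aξ)`; Cauchy–Schwarz for it,
  -- divided by `P`, is the claim.
  refine ⟨(∑ i, (starRingEnd ℂ) (x i) * ζ i) / P, fun ξ => ?_⟩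
  have hPc : (P : ℂ) ≠ 0 := by exact_mod_cast h.ne'
  have h1 := norm_add_sum_conj_mul_sq_le hε x (fun i => x i + ξ * ζ i)
  have h2 : (ε : ℂ) + ∑ i, (starRingEnd ℂ) (x i) * (x i + ξ * ζ i) =
      P * (1 + (∑ i, (starRingEnd ℂ) (x i) * ζ i) / P * ξ) := by
    have : (P : ℂ) = ε + ∑ i, (starRingEnd ℂ) (x i) * x i := by
      rw [hP]
      push_cast
      congr 1
      exact Finset.sum_congr rfl fun i _ => (Complex.conj_mul' _).symm
    rw [mul_add, mul_one]
    nth_rewrite 1 [this]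
    rw [← mul_assoc, mul_div_cancel₀ _ hPc, add_assoc, Finset.sum_mul, ← Finset.sum_add_distrib]
    congr 1
    exact Finset.sum_congr rfl fun i _ => by ring
  rw [h2, norm_mul, mul_pow, Complex.norm_real, Real.norm_of_nonneg h.le] at h1
  have h3 : P * (P * ‖1 + (∑ i, (starRingEnd ℂ) (x i) * ζ i) / P * ξ‖ ^ 2) ≤
      P * (ε + ∑ i, ‖x i + ξ * ζ i‖ ^ 2) := by
    rw [← mul_assoc, ← sq]
    exact h1
  exact le_of_mul_le_mul_left h3 h

theorem continuous_pogorelovApprox {ε : ℝ} (hε : 0 ≤ ε) : Continuous (pogorelovApprox m ε) := by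
  rcases hε.eq_or_lt with rfl | hε
  · rw [pogorelovApprox_zero]
    exact continuous_pogorelov
  · exact (contDiff_pogorelovApprox hε).continuous

theorem pogorelovApprox_nonneg {ε : ℝ} (hε : 0 ≤ ε) (z : Fin (m + 1) → ℂ) :
    0 ≤ pogorelovApprox m ε z := by
  have h1 := pogConst_pos m
  have h2 := pogBase_pos z
  have h3 := regSq_nonneg hε z
  rw [pogorelovApprox_eq]
  positivity

/-- Multiplying the lower bounds for the two factors along a complex line gives `v_ε(z + ξζ) ≥
v_ε(z) |1 + aξ|² |1 + bξ|^{2α}`, and `e^x ≥ 1 + x` makes the right side linear in the logarithms.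
The case `ε = 0` is included and gives the statement for `v`. -/
theorem continuousPSH_pogorelovApprox {ε : ℝ} (hε : 0 ≤ ε) :
    ContinuousPSH (pogorelovApprox m ε) := by
  refine ⟨continuous_pogorelovApprox hε, fun z ζ => ?_⟩
  rcases (regSq_nonneg hε z).eq_or_lt with hs | hs
  -- Where `regSq` vanishes the function attains its minimum `0`, so the mean value inequality is
  -- trivial.
  · rw [pogorelovApprox_eq, ← hs, Real.zero_rpow (pogExp_pos m).ne', mul_zero]
    exact Real.circleAverage_nonneg_of_nonneg fun ξ _ => pogorelovApprox_nonneg hε _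
  obtain ⟨a, ha⟩ := exists_mul_norm_one_add_mul_sq_le zero_le_one
    (fun i : Fin m => z i.castSucc) (fun i => ζ i.castSucc) (pogBase_pos z)
  obtain ⟨b, hb⟩ := exists_mul_norm_one_add_mul_sq_le hε
    (fun _ : Unit => z (Fin.last m)) (fun _ => ζ (Fin.last m))
    (by simpa [regSq, add_comm] using hs)
  have hb' : ∀ ξ : ℂ, regSq ε z * ‖1 + b * ξ‖ ^ 2 ≤ regSq ε (z + ξ • ζ) := fun ξ => by
    simpa [regSq, add_comm] using hb ξ
  have hα := pogExp_pos m
  have hc := pogConst_pos m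
  refine le_circleAverage_of_log_le
    ((continuous_pogorelovApprox hε).comp (by fun_prop : Continuous fun ξ : ℂ => z + ξ • ζ))
    (pogorelovApprox_nonneg hε z) hα.le a b fun ξ h1 h2 => ?_
  have n1 := norm_pos_iff.2 h1
  have n2 := norm_pos_iff.2 h2
  have hA := pogBase_pos z
  have e1 : Real.exp (2 * Real.log ‖1 + a * ξ‖ + 2 * pogExp m * Real.log ‖1 + b * ξ‖) =
      ‖1 + a * ξ‖ ^ 2 * (‖1 + b * ξ‖ ^ 2) ^ pogExp m := by
    rw [Real.exp_add, Real.rpow_def_of_pos (by positivity), Real.log_pow]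
    congr 1
    · rw [two_mul, Real.exp_add, Real.exp_log n1, sq]
    · congr 1
      push_cast
      ring
  calc pogorelovApprox m ε z *
        (1 + (2 * Real.log ‖1 + a * ξ‖ + 2 * pogExp m * Real.log ‖1 + b * ξ‖))
      ≤ pogorelovApprox m ε z * (‖1 + a * ξ‖ ^ 2 * (‖1 + b * ξ‖ ^ 2) ^ pogExp m) := by
        rw [← e1, add_comm 1]
        exact mul_le_mul_of_nonneg_left (Real.add_one_le_exp _) (pogorelovApprox_nonneg hε z)
    _ = pogConst m * (pogBase z * ‖1 + a * ξ‖ ^ 2) * (regSq ε z * ‖1 + b * ξ‖ ^ 2) ^ pogExp m := by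
        rw [Real.mul_rpow hs.le (by positivity), pogorelovApprox_eq]
        ring
    _ ≤ pogConst m * pogBase (z + ξ • ζ) * regSq ε (z + ξ • ζ) ^ pogExp m := by
        have := hb' ξ
        have : pogBase z * ‖1 + a * ξ‖ ^ 2 ≤ pogBase (z + ξ • ζ) := ha ξ
        have := pogBase_pos (z + ξ • ζ)
        have : 0 ≤ pogConst m * pogBase (z + ξ • ζ) := by positivity
        gcongr
    _ = _ := rfl

/-- Since `α ≤ 1`, `t ↦ t^α` is subadditive, so `0 ≤ v_ε - v ≤ c A ε^α`. -/
theorem tendstoLocallyUniformly_pogorelovApprox :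
    TendstoLocallyUniformly (pogorelovApprox m) (pogorelov m) (𝓝[>] 0) := by
  rw [tendstoLocallyUniformly_iff_forall_isCompact]
  intro K hK
  rw [Metric.tendstoUniformlyOn_iff]
  intro δ hδ
  obtain ⟨M, hM⟩ := hK.exists_bound_of_continuousOn
    (contDiff_pogBase (m := m)).continuous.continuousOn
  have hα := pogExp_pos m
  have hc := pogConst_pos m
  have ht : Tendsto (fun ε : ℝ => pogConst m * M * ε ^ pogExp m) (𝓝[>] 0) (𝓝 0) := by
    have h : ContinuousAt (fun ε : ℝ => pogConst m * M * ε ^ pogExp m) 0 :=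
      (continuousAt_id.rpow_const (Or.inr hα.le)).const_mul _
    simpa [ContinuousAt, Real.zero_rpow hα.ne'] using h.tendsto.mono_left nhdsWithin_le_nhds
  filter_upwards [ht.eventually (gt_mem_nhds hδ), self_mem_nhdsWithin] with ε hε hε0 z hz
  have hε0' : 0 < ε := hε0
  refine lt_of_le_of_lt ?_ hε
  have h0 : 0 ≤ ‖z (Fin.last m)‖ ^ 2 := by positivity
  have h1 : regSq ε z ^ pogExp m ≤ regSq 0 z ^ pogExp m + ε ^ pogExp m := by
    simpa [regSq] using Real.rpow_add_le_add_rpow h0 hε0'.le hα.le (pogExp_le_one m)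
  have h2 : regSq 0 z ^ pogExp m ≤ regSq ε z ^ pogExp m :=
    Real.rpow_le_rpow (regSq_nonneg le_rfl z) (by unfold regSq; linarith) hα.le
  have h3 : pogBase z ≤ M := (le_abs_self _).trans (hM z hz)
  have hA := pogBase_pos z
  rw [dist_comm, Real.dist_eq, ← pogorelovApprox_zero, pogorelovApprox_eq, pogorelovApprox_eq,
    ← mul_sub, abs_of_nonneg (by have := sub_nonneg.2 h2; positivity)]
  have h4 : regSq ε z ^ pogExp m - regSq 0 z ^ pogExp m ≤ ε ^ pogExp m := by linarith
  have h5 : 0 ≤ pogConst m * M := mul_nonneg hc.le (hA.le.trans h3)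
  gcongr

end Plurisubharmonic

/-! ### The complex Hessian -/

section Hessian

theorem fderiv_ofReal_comp {n : ℕ} {u : (Fin n → ℂ) → ℝ} {z : Fin n → ℂ}
    (hu : DifferentiableAt ℝ u z) (ξ : Fin n → ℂ) :
    fderiv ℝ (fun x => (u x : ℂ)) z ξ = ((fderiv ℝ u z ξ : ℝ) : ℂ) := by
  have h : HasFDerivAt (fun x => (u x : ℂ)) (Complex.ofRealCLM.comp (fderiv ℝ u z)) z :=
    Complex.ofRealCLM.hasFDerivAt.comp z hu.hasFDerivAt
  rw [h.fderiv]
  rfl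

/-- Being `C²` at the point gives `C²` nearby, which allows the inner Wirtinger derivative to be
rewritten on a neighbourhood before differentiating again. -/
theorem complexHessian_apply {n : ℕ} {u : (Fin n → ℂ) → ℝ} {z : Fin n → ℂ}
    (hu : ContDiffAt ℝ 2 u z) (i j : Fin n) :
    complexHessian u z i j =
      1 / 4 * (((fderiv ℝ (fun y => fderiv ℝ u y (Pi.single j 1)) z (Pi.single i 1) +
          fderiv ℝ (fun y => fderiv ℝ u y (Pi.single j Complex.I)) z (Pi.single i Complex.I) :
            ℝ) : ℂ) +
        Complex.I *
          ((fderiv ℝ (fun y => fderiv ℝ u y (Pi.single j Complex.I)) z (Pi.single i 1) -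
            fderiv ℝ (fun y => fderiv ℝ u y (Pi.single j 1)) z (Pi.single i Complex.I) :
              ℝ) : ℂ)) := by
  have h1 : ∀ ξ, DifferentiableAt ℝ (fun y => fderiv ℝ u y ξ) z := fun ξ =>
    (((hu.fderiv_right (m := 1) (by norm_num)).differentiableAt (by simp)).clm_apply
      (differentiableAt_const ξ))
  have h2 : dzbar j (fun x => (u x : ℂ)) =ᶠ[𝓝 z] fun y =>
      (1 / 2) * (((fderiv ℝ u y (Pi.single j 1) : ℝ) : ℂ) +
        Complex.I * ((fderiv ℝ u y (Pi.single j Complex.I) : ℝ) : ℂ)) := by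
    filter_upwards [hu.eventually (by simp)] with y hy
    have hd := hy.differentiableAt (by simp)
    rw [dzbar, fderiv_ofReal_comp hd, fderiv_ofReal_comp hd]
  have h3 : ∀ ξ, HasFDerivAt (fun y => ((fderiv ℝ u y ξ : ℝ) : ℂ))
      (Complex.ofRealCLM.comp (fderiv ℝ (fun y => fderiv ℝ u y ξ) z)) z := fun ξ =>
    Complex.ofRealCLM.hasFDerivAt.comp z (h1 ξ).hasFDerivAt
  have h4 := ((h3 (Pi.single j 1)).add ((h3 (Pi.single j Complex.I)).const_mul
    Complex.I)).const_mul (1 / 2 : ℂ)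
  have h5 : fderiv ℝ (dzbar j (fun x => (u x : ℂ))) z = _ := h2.fderiv_eq.trans h4.fderiv
  simp only [complexHessian, Matrix.of_apply, dz, h5]
  simp only [_root_.smul_apply, _root_.add_apply, ContinuousLinearMap.comp_apply, smul_eq_mul,
    Complex.ofRealCLM_apply]
  push_cast
  linear_combination (-1 / 4 * ((fderiv ℝ (fun y => fderiv ℝ u y (Pi.single j Complex.I)) z
    (Pi.single i Complex.I) : ℝ) : ℂ)) * Complex.I_sq

variable {m : ℕ}

theorem complexHessian_pogorelovApprox_apply {ε : ℝ} {z : Fin (m + 1) → ℂ} (hz : 0 < regSq ε z)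
    (i j : Fin (m + 1)) :
    complexHessian (pogorelovApprox m ε) z i j =
      1 / 4 * (((pogD2 ε (Pi.single j 1) (Pi.single i 1) z +
          pogD2 ε (Pi.single j Complex.I) (Pi.single i Complex.I) z : ℝ) : ℂ) +
        Complex.I * ((pogD2 ε (Pi.single j Complex.I) (Pi.single i 1) z -
          pogD2 ε (Pi.single j 1) (Pi.single i Complex.I) z : ℝ) : ℂ)) := by
  have h : ∀ ξ η, fderiv ℝ (fun y => fderiv ℝ (pogorelovApprox m ε) y ξ) z η = pogD2 ε ξ η z := by
    intro ξ η
    rw [← fderiv_pogD1 hz]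
    congr 1
    refine Filter.EventuallyEq.fderiv_eq ?_
    filter_upwards [(contDiff_regSq ε).continuous.continuousAt.eventually (lt_mem_nhds hz)]
      with y hy using fderiv_pogorelovApprox hy ξ
  rw [complexHessian_apply ((contDiffAt_pogorelovApprox hz).of_le (by norm_cast))]
  simp only [h]

/-! ### Entries and determinant of the complex Hessian of the approximants -/

theorem single_castSucc_last (i : Fin m) (a : ℂ) :
    (Pi.single i.castSucc a : Fin (m + 1) → ℂ) (Fin.last m) = 0 :=
  Pi.single_eq_of_ne (Fin.castSucc_lt_last i).ne' _

theorem single_last_castSucc (i : Fin m) (a : ℂ) :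
    (Pi.single (Fin.last m) a : Fin (m + 1) → ℂ) i.castSucc = 0 :=
  Pi.single_eq_of_ne (Fin.castSucc_lt_last i).ne _

theorem single_castSucc_castSucc (i k : Fin m) (a : ℂ) :
    (Pi.single i.castSucc a : Fin (m + 1) → ℂ) k.castSucc = if k = i then a else 0 := by
  simp [Pi.single_apply]

theorem pogBaseD_single_castSucc (i : Fin m) (a : ℂ) (z : Fin (m + 1) → ℂ) :
    pogBaseD (Pi.single i.castSucc a) z = 2 * inner ℝ (z i.castSucc) a := by
  rw [pogBaseD, Finset.sum_eq_single i]
  · simp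
  · intro k _ hk
    simp [hk]
  · simp

theorem pogBaseD_single_last (a : ℂ) (z : Fin (m + 1) → ℂ) :
    pogBaseD (Pi.single (Fin.last m) a) z = 0 := by
  simp [pogBaseD]

theorem regSqD_single_castSucc (i : Fin m) (a : ℂ) (z : Fin (m + 1) → ℂ) :
    regSqD (Pi.single i.castSucc a) z = 0 := by
  simp [regSqD]

theorem regSqD_single_last (a : ℂ) (z : Fin (m + 1) → ℂ) :
    regSqD (Pi.single (Fin.last m) a) z = 2 * inner ℝ (z (Fin.last m)) a := by
  simp [regSqD]

theorem complexHessian_castSucc_castSucc {ε : ℝ} {z : Fin (m + 1) → ℂ} (hz : 0 < regSq ε z)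
    (i j : Fin m) :
    complexHessian (pogorelovApprox m ε) z i.castSucc j.castSucc =
      if i = j then ((pogConst m * regSq ε z ^ pogExp m : ℝ) : ℂ) else 0 := by
  rw [complexHessian_pogorelovApprox_apply hz]
  simp only [pogD2, regSqD_single_castSucc, pogBaseD_single_castSucc, single_castSucc_castSucc]
  by_cases h : i = j
  · simp [h]
    ring
  · simp [h, Ne.symm h]

theorem complexHessian_castSucc_last {ε : ℝ} {z : Fin (m + 1) → ℂ} (hz : 0 < regSq ε z)
    (i : Fin m) :
    complexHessian (pogorelovApprox m ε) z i.castSucc (Fin.last m) =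
      ((pogConst m * pogExp m * regSq ε z ^ (pogExp m - 1) : ℝ) : ℂ) *
        ((starRingEnd ℂ) (z i.castSucc) * z (Fin.last m)) := by
  rw [complexHessian_pogorelovApprox_apply hz]
  simp only [pogD2, regSqD_single_castSucc, pogBaseD_single_castSucc, pogBaseD_single_last,
    regSqD_single_last, single_castSucc_last]
  generalize regSq ε z ^ (pogExp m - 1) = S
  apply Complex.ext <;> simp <;> ring

theorem complexHessian_last_castSucc {ε : ℝ} {z : Fin (m + 1) → ℂ} (hz : 0 < regSq ε z)
    (i : Fin m) :
    complexHessian (pogorelovApprox m ε) z (Fin.last m) i.castSucc =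
      ((pogConst m * pogExp m * regSq ε z ^ (pogExp m - 1) : ℝ) : ℂ) *
        ((starRingEnd ℂ) (z (Fin.last m)) * z i.castSucc) := by
  rw [complexHessian_pogorelovApprox_apply hz]
  simp only [pogD2, regSqD_single_castSucc, pogBaseD_single_castSucc, pogBaseD_single_last,
    regSqD_single_last, single_last_castSucc]
  generalize regSq ε z ^ (pogExp m - 1) = S
  apply Complex.ext <;> simp <;> ring

theorem complexHessian_last_last {ε : ℝ} {z : Fin (m + 1) → ℂ} (hz : 0 < regSq ε z) :
    complexHessian (pogorelovApprox m ε) z (Fin.last m) (Fin.last m) =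
      ((pogConst m * pogBase z * pogExp m * regSq ε z ^ (pogExp m - 2) *
        (ε + pogExp m * ‖z (Fin.last m)‖ ^ 2) : ℝ) : ℂ) := by
  have h1 : regSq ε z ^ (pogExp m - 1) = regSq ε z ^ (pogExp m - 2) * regSq ε z := by
    rw [← Real.rpow_add_one hz.ne']
    congr 1
    ring
  have h2 : ‖z (Fin.last m)‖ ^ 2 = (z (Fin.last m)).re * (z (Fin.last m)).re +
      (z (Fin.last m)).im * (z (Fin.last m)).im := by
    rw [Complex.sq_norm, Complex.normSq_apply]
  rw [complexHessian_pogorelovApprox_apply hz]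
  simp only [pogD2, pogBaseD_single_last, regSqD_single_last, Pi.single_eq_same]
  rw [h1]
  generalize regSq ε z ^ (pogExp m - 2) = S
  rw [regSq, h2]
  apply Complex.ext <;> simp <;> ring

/-- The Schur complement of the scalar block `k • 1`. -/
theorem det_eq_of_castSucc_block {k : ℂ} (hk : k ≠ 0) (M : Matrix (Fin (m + 1)) (Fin (m + 1)) ℂ)
    (hM : ∀ i j : Fin m, M i.castSucc j.castSucc = if i = j then k else 0) :
    M.det = k ^ m * (M (Fin.last m) (Fin.last m) -
      (∑ i : Fin m, M (Fin.last m) i.castSucc * M i.castSucc (Fin.last m)) / k) := by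
  let A : Matrix (Fin m) (Fin m) ℂ := k • 1
  let B : Matrix (Fin m) (Fin 1) ℂ := Matrix.of fun i _ => M i.castSucc (Fin.last m)
  let C : Matrix (Fin 1) (Fin m) ℂ := Matrix.of fun _ j => M (Fin.last m) j.castSucc
  let D : Matrix (Fin 1) (Fin 1) ℂ := Matrix.of fun _ _ => M (Fin.last m) (Fin.last m)
  let _ : Invertible A := ⟨k⁻¹ • 1, by simp [A, smul_smul, hk], by simp [A, smul_smul, hk]⟩
  have hi : ⅟A = k⁻¹ • 1 := rfl
  have h : M.submatrix finSumFinEquiv finSumFinEquiv = Matrix.fromBlocks A B C D := by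
    ext i j
    rcases i with i | i <;> rcases j with j | j
    · have := hM i j
      simp only [Matrix.submatrix_apply, finSumFinEquiv_apply_left, Matrix.fromBlocks_apply₁₁, A,
        Matrix.smul_apply, Matrix.one_apply, smul_eq_mul, mul_ite, mul_one, mul_zero]
      exact this
    · have : Fin.natAdd m j = Fin.last m := by ext; simp
      simp [B, this]; rfl
    · have : Fin.natAdd m i = Fin.last m := by ext; simp
      simp [C, this]; rfl
    · have h1 : Fin.natAdd m j = Fin.last m := by ext; simp
      have h2 : Fin.natAdd m i = Fin.last m := by ext; simp
      simp [D, h1, h2]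
  rw [← Matrix.det_submatrix_equiv_self finSumFinEquiv M, h, Matrix.det_fromBlocks₁₁, hi]
  simp [A, B, C, D, Matrix.mul_apply, Finset.sum_mul, div_eq_mul_inv]
  left
  exact Finset.sum_congr rfl fun i _ => by ring

/-- The normalization `c^n = n²` is what makes the determinant equal to `1` rather than to some
other constant. -/
theorem pogConst_pow : pogConst m ^ (m + 1) = ((m : ℝ) + 1) ^ 2 := by
  unfold pogConst
  rw [← Real.rpow_natCast, ← Real.rpow_mul (by positivity), ← Real.rpow_natCast]
  congr 1
  push_cast
  field_simp

/-- In the Schur complement the terms `α A |w|²` and `-α |w|² (A - 1)` leave `α |w|²`, so the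
determinant is `c^n α (A ε + α |w|²) / s`, using `n α = 1` to combine the powers of `s`; finally
`c^n α = n`. -/
theorem det_complexHessian_pogorelovApprox {ε : ℝ} {z : Fin (m + 1) → ℂ} (hz : 0 < regSq ε z) :
    (complexHessian (pogorelovApprox m ε) z).det =
      (((‖z (Fin.last m)‖ ^ 2 + ((m : ℝ) + 1) * pogBase z * ε) / regSq ε z : ℝ) : ℂ) := by
  have hc := pogConst_pos m
  have hk : 0 < pogConst m * regSq ε z ^ pogExp m := by positivity
  rw [det_eq_of_castSucc_block (k := ((pogConst m * regSq ε z ^ pogExp m : ℝ) : ℂ))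
    (by exact_mod_cast hk.ne') _ (complexHessian_castSucc_castSucc hz)]
  simp only [complexHessian_castSucc_last hz, complexHessian_last_castSucc hz,
    complexHessian_last_last hz]
  have h1 : ∑ i : Fin m, ((pogConst m * pogExp m * regSq ε z ^ (pogExp m - 1) : ℝ) : ℂ) *
        ((starRingEnd ℂ) (z (Fin.last m)) * z i.castSucc) *
      (((pogConst m * pogExp m * regSq ε z ^ (pogExp m - 1) : ℝ) : ℂ) *
        ((starRingEnd ℂ) (z i.castSucc) * z (Fin.last m))) =
      (((pogConst m * pogExp m * regSq ε z ^ (pogExp m - 1)) ^ 2 * ‖z (Fin.last m)‖ ^ 2 *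
        (pogBase z - 1) : ℝ) : ℂ) := by
    rw [pogBase, add_sub_cancel_left, Finset.mul_sum]
    push_cast
    refine Finset.sum_congr rfl fun i _ => ?_
    rw [← Complex.conj_mul', ← Complex.conj_mul']
    ring
  rw [h1]
  norm_cast
  have h2 : regSq ε z ^ pogExp m ≠ 0 := (Real.rpow_pos_of_pos hz _).ne'
  have h3 : (regSq ε z ^ pogExp m) ^ m * regSq ε z ^ pogExp m = regSq ε z := by
    rw [← pow_succ, ← Real.rpow_natCast, ← Real.rpow_mul hz.le]
    conv_rhs => rw [← Real.rpow_one (regSq ε z)]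
    congr 1
    unfold pogExp
    push_cast
    field_simp
  have h4 := pogConst_pow (m := m)
  have h5 : pogExp m * ((m : ℝ) + 1) = 1 := by
    unfold pogExp
    field_simp
  rw [show pogExp m - 2 = pogExp m - 1 - 1 by ring]
  simp only [Real.rpow_sub_one hz.ne']
  rw [mul_pow]
  generalize regSq ε z ^ pogExp m = S at *
  generalize regSq ε z = s at *
  generalize pogExp m = α at *
  generalize pogConst m = c at *
  have hS : S ^ m = s / S := by
    field_simp
    exact h3
  rw [hS]
  have h6 : c ^ m = ((m : ℝ) + 1) ^ 2 / c := by
    field_simp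
    rw [← h4, pow_succ]
  rw [h6]
  have hα : α = 1 / ((m : ℝ) + 1) := by
    field_simp
    linarith
  rw [hα]
  field_simp
  push_cast
  ring

theorem tendsto_eLpNorm_det_complexHessian {K : Set (Fin (m + 1) → ℂ)} (hK : IsCompact K)
    {q : ℝ≥0∞} (hq : q ≠ ⊤) :
    Tendsto (fun ε : ℝ => eLpNorm
      (fun z => (complexHessian (pogorelovApprox m ε) z).det - 1) q (volume.restrict K))
      (𝓝[>] 0) (𝓝 0) := by
  rcases eq_or_ne q 0 with rfl | hq0
  · simp
  have hq1 : 0 < q.toReal := ENNReal.toReal_pos hq0 hq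
  -- The exact error `det - 1 = (nA - 1) ε / s`. As `0 ≤ ε / s ≤ 1`, it is dominated on `K` by a
  -- constant, and it tends to `0` off the hyperplane.
  let g : ℝ → (Fin (m + 1) → ℂ) → ℝ := fun ε z =>
    (((m : ℝ) + 1) * pogBase z - 1) * (ε / regSq ε z)
  have hcA : Continuous (pogBase (m := m)) := contDiff_pogBase.continuous
  have hg : ∀ ε > 0, eLpNorm (fun z => (complexHessian (pogorelovApprox m ε) z).det - 1) q
      (volume.restrict K) = eLpNorm (g ε) q (volume.restrict K) := by
    intro ε hε
    rw [← eLpNorm_norm, ← eLpNorm_norm (g ε)]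
    congr 1
    ext z
    have hs := regSq_pos hε z
    rw [det_complexHessian_pogorelovApprox hs, ← Complex.norm_real (g ε z)]
    congr 1
    norm_cast
    simp only [g]
    field_simp
    rw [regSq]
    push_cast
    ring
  refine Tendsto.congr' (f₁ := fun ε => eLpNorm (g ε) q (volume.restrict K)) ?_ ?_
  · filter_upwards [self_mem_nhdsWithin] with ε hε using (hg ε hε).symm
  obtain ⟨M, hM⟩ := hK.exists_bound_of_continuousOn
    (by fun_prop : Continuous fun z : Fin (m + 1) → ℂ => ((m : ℝ) + 1) * pogBase z - 1).continuousOn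
  simp_rw [eLpNorm_eq_lintegral_rpow_enorm_toReal hq0 hq]
  have hlim : Tendsto (fun ε => ∫⁻ z in K, ‖g ε z‖ₑ ^ q.toReal) (𝓝[>] 0)
      (𝓝 (∫⁻ _ in K, 0)) := by
    refine tendsto_lintegral_filter_of_dominated_convergence
      (fun _ => ENNReal.ofReal M ^ q.toReal) ?_ ?_ ?_ ?_
    · filter_upwards with ε
      have h4 := (contDiff_regSq (m := m) ε).continuous.measurable
      have : Measurable (g ε) := by
        have := hcA.measurable
        fun_prop
      fun_prop
    · filter_upwards [self_mem_nhdsWithin] with ε hε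
      rw [ae_restrict_iff' hK.measurableSet]
      filter_upwards with z hz
      have hε' : 0 < ε := hε
      have hs := regSq_pos hε' z
      gcongr
      rw [← ofReal_norm]
      refine ENNReal.ofReal_le_ofReal ?_
      rw [norm_mul]
      refine (mul_le_of_le_one_right (norm_nonneg _) ?_).trans (hM z hz)
      rw [Real.norm_of_nonneg (by positivity), div_le_one hs, regSq]
      have : 0 ≤ ‖z (Fin.last m)‖ ^ 2 := by positivity
      linarith
    · rw [lintegral_const]
      refine ENNReal.mul_ne_top (ENNReal.rpow_ne_top_of_nonneg hq1.le (by simp)) ?_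
      simpa using hK.measure_lt_top.ne
    · filter_upwards [ae_restrict_of_ae ae_last_ne_zero] with z hz
      have h1 : ContinuousAt (fun ε => g ε z) 0 := by
        have h := (regSq_pos_of_ne le_rfl hz).ne'
        have hc : ContinuousAt (fun ε => regSq ε z) 0 := by unfold regSq; fun_prop
        exact (continuousAt_id.div hc h).const_mul _
      have h2 : Tendsto (fun ε => g ε z) (𝓝[>] 0) (𝓝 0) := by
        simpa [ContinuousAt, g] using h1.tendsto.mono_left nhdsWithin_le_nhds
      have h3 := (ENNReal.continuous_rpow_const (y := q.toReal)).continuousAt.tendsto.comp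
        (h2.enorm)
      simpa [Function.comp_def, hq1] using h3
  have h5 := (ENNReal.continuous_rpow_const (y := 1 / q.toReal)).continuousAt.tendsto.comp hlim
  simpa [Function.comp_def, hq1] using h5

end Hessian

/-! ### Monotonicity of the determinant on positive semidefinite matrices -/

section Determinant

variable {ι : Type*} [Fintype ι] [DecidableEq ι]

/-- Every eigenvalue of `1 + E` is at least `1`, by evaluating the quadratic form on unit
eigenvectors. -/
theorem Matrix.PosSemidef.one_le_det_one_add {E : Matrix ι ι ℂ} (hE : E.PosSemidef) :
    1 ≤ (1 + E).det := by
  have hH : (1 + E).IsHermitian := Matrix.isHermitian_one.add hE.1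
  rw [hH.det_eq_prod_eigenvalues]
  have h : ∀ i, 1 ≤ hH.eigenvalues i := by
    intro i
    rw [hH.eigenvalues_eq, Matrix.add_mulVec, Matrix.one_mulVec, dotProduct_add, map_add]
    have h1 : star (hH.eigenvectorBasis i : ι → ℂ) ⬝ᵥ (hH.eigenvectorBasis i : ι → ℂ) = 1 := by
      have := hH.eigenvectorBasis.orthonormal.1 i
      have h2 := inner_self_eq_norm_sq_to_K (𝕜 := ℂ) (hH.eigenvectorBasis i)
      rw [this, EuclideanSpace.inner_eq_star_dotProduct] at h2
      rw [dotProduct_comm]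
      simpa using h2
    have h2 := hE.re_dotProduct_nonneg (hH.eigenvectorBasis i : ι → ℂ)
    rw [h1]
    simpa using h2
  have h3 : ∏ _i : ι, (1 : ℝ) ≤ ∏ i, hH.eigenvalues i :=
    Finset.prod_le_prod (fun _ _ => zero_le_one) fun i _ => h i
  have h4 := Complex.real_le_real.2 h3
  simpa using h4

open scoped MatrixOrder in
-- If `A` is invertible, write `A = B* B`; then `A + D = B* (1 + E) B` with `E` positive
-- semidefinite, which reduces to the case of the identity. If `det A = 0`, only nonnegativity of
-- `det (A + D)` is needed.
theorem Matrix.PosSemidef.det_le_det_add {A D : Matrix ι ι ℂ} (hA : A.PosSemidef)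
    (hD : D.PosSemidef) : A.det ≤ (A + D).det := by
  by_cases h0 : A.det = 0
  · rw [h0]
    exact (hA.add hD).det_nonneg
  obtain ⟨B, hB⟩ := CStarAlgebra.nonneg_iff_eq_star_mul_self.mp hA.nonneg
  have hdB : IsUnit B.det := by
    rw [isUnit_iff_ne_zero]
    intro h
    apply h0
    rw [hB, Matrix.det_mul, h, mul_zero]
  have hE := hD.conjTranspose_mul_mul_same B⁻¹
  have h1 : A + D = B.conjTranspose * (1 + B⁻¹.conjTranspose * D * B⁻¹) * B := by
    rw [mul_add, add_mul, mul_one, hB, Matrix.star_eq_conjTranspose]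
    congr 1
    have e1 : B.conjTranspose * B⁻¹.conjTranspose = 1 := by
      rw [← Matrix.conjTranspose_mul, Matrix.nonsing_inv_mul _ hdB, Matrix.conjTranspose_one]
    calc D = (B.conjTranspose * B⁻¹.conjTranspose) * D * (B⁻¹ * B) := by
          rw [e1, Matrix.nonsing_inv_mul _ hdB, one_mul, mul_one]
      _ = _ := by simp only [Matrix.mul_assoc]
  rw [h1, Matrix.det_mul, Matrix.det_mul, mul_right_comm, ← Matrix.det_mul,
    ← Matrix.star_eq_conjTranspose, ← hB]
  exact le_mul_of_one_le_right hA.det_nonneg hE.one_le_det_one_add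

/-- For a semidefinite form, `⟨e_i, A e_i⟩ = 0` forces `A e_i = 0`. -/
theorem Matrix.PosSemidef.det_eq_zero_of_diag_eq_zero {A : Matrix ι ι ℂ} (hA : A.PosSemidef)
    {i : ι} (h : A i i = 0) : A.det = 0 := by
  refine Matrix.exists_mulVec_eq_zero_iff.1 ⟨Pi.single i 1, by simp, ?_⟩
  rw [← hA.dotProduct_mulVec_zero_iff]
  simp [h]

end Determinant

/-! ### The Levi form and second order conditions -/

section LeviForm

variable {n : ℕ}

/-- The sesquilinear form attached to a real bilinear form `B`. -/
def leviForm (B : (Fin n → ℂ) →L[ℝ] (Fin n → ℂ) →L[ℝ] ℝ) (ξ η : Fin n → ℂ) : ℂ :=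
  1 / 4 * (((B ξ η + B (Complex.I • ξ) (Complex.I • η) : ℝ) : ℂ) +
    Complex.I * ((B ξ (Complex.I • η) - B (Complex.I • ξ) η : ℝ) : ℂ))

variable {B : (Fin n → ℂ) →L[ℝ] (Fin n → ℂ) →L[ℝ] ℝ}

theorem leviForm_sum_left {ι : Type*} (s : Finset ι) (f : ι → Fin n → ℂ) (η : Fin n → ℂ) :
    leviForm B (∑ i ∈ s, f i) η = ∑ i ∈ s, leviForm B (f i) η := by
  simp only [leviForm, map_sum, Finset.smul_sum, _root_.sum_apply, Complex.ofReal_add,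
    Complex.ofReal_sub, Complex.ofReal_sum, Finset.mul_sum, ← Finset.sum_add_distrib,
    ← Finset.sum_sub_distrib]

theorem leviForm_sum_right {ι : Type*} (s : Finset ι) (f : ι → Fin n → ℂ) (ξ : Fin n → ℂ) :
    leviForm B ξ (∑ i ∈ s, f i) = ∑ i ∈ s, leviForm B ξ (f i) := by
  simp only [leviForm, map_sum, Finset.smul_sum, Complex.ofReal_add,
    Complex.ofReal_sub, Complex.ofReal_sum, Finset.mul_sum, ← Finset.sum_add_distrib,
    ← Finset.sum_sub_distrib]

theorem complex_smul_eq (c : ℂ) (ξ : Fin n → ℂ) : c • ξ = c.re • ξ + c.im • (Complex.I • ξ) := by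
  ext i
  simp only [Pi.smul_apply, Pi.add_apply, smul_eq_mul, Complex.real_smul]
  nth_rewrite 1 [← Complex.re_add_im c]
  ring

theorem leviForm_smul_left (c : ℂ) (ξ η : Fin n → ℂ) :
    leviForm B (c • ξ) η = c * leviForm B ξ η := by
  have h : Complex.I • c • ξ = c.re • (Complex.I • ξ) - c.im • ξ := by
    ext i
    apply Complex.ext <;> simp
    ring
  rw [leviForm, h, complex_smul_eq c ξ]
  simp only [map_add, map_sub, map_smul, _root_.add_apply, _root_.sub_apply,
    _root_.smul_apply, smul_eq_mul, leviForm]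
  apply Complex.ext <;> simp <;> ring

theorem leviForm_smul_right (c : ℂ) (ξ η : Fin n → ℂ) :
    leviForm B ξ (c • η) = (starRingEnd ℂ) c * leviForm B ξ η := by
  have h : Complex.I • c • η = c.re • (Complex.I • η) - c.im • η := by
    ext i
    apply Complex.ext <;> simp
    ring
  rw [leviForm, h, complex_smul_eq c η]
  simp only [map_add, map_sub, map_smul, smul_eq_mul, leviForm]
  apply Complex.ext <;> simp <;> ring

theorem sum_smul_single (ξ : Fin n → ℂ) : ∑ i, ξ i • (Pi.single i 1 : Fin n → ℂ) = ξ := by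
  ext j
  simp [Finset.sum_apply, Pi.single_apply]

theorem leviForm_eq_sum (ξ η : Fin n → ℂ) :
    leviForm B ξ η = ∑ i, ∑ j, ξ i * (starRingEnd ℂ) (η j) *
      leviForm B (Pi.single i 1) (Pi.single j 1) := by
  conv_lhs => rw [← sum_smul_single ξ, ← sum_smul_single η]
  rw [leviForm_sum_left]
  refine Finset.sum_congr rfl fun i _ => ?_
  rw [leviForm_sum_right]
  refine Finset.sum_congr rfl fun j _ => ?_
  rw [leviForm_smul_left, leviForm_smul_right, mul_assoc]

theorem leviForm_self (hB : ∀ ξ η, B ξ η = B η ξ) (ξ : Fin n → ℂ) :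
    leviForm B ξ ξ = ((1 / 4 * (B ξ ξ + B (Complex.I • ξ) (Complex.I • ξ)) : ℝ) : ℂ) := by
  rw [leviForm, hB ξ (Complex.I • ξ)]
  simp

theorem leviForm_conj (hB : ∀ ξ η, B ξ η = B η ξ) (ξ η : Fin n → ℂ) :
    (starRingEnd ℂ) (leviForm B ξ η) = leviForm B η ξ := by
  rw [leviForm, leviForm, hB ξ η, hB (Complex.I • ξ) (Complex.I • η), hB ξ (Complex.I • η),
    hB (Complex.I • ξ) η]
  apply Complex.ext <;> simp

variable {u φ : (Fin n → ℂ) → ℝ} {p : Fin n → ℂ}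

theorem complexHessian_eq_leviForm (hu : ContDiffAt ℝ 2 u p) (i j : Fin n) :
    complexHessian u p i j = leviForm (fderiv ℝ (fderiv ℝ u) p) (Pi.single i 1)
      (Pi.single j 1) := by
  have h : ∀ ξ η, fderiv ℝ (fun y => fderiv ℝ u y ξ) p η = fderiv ℝ (fderiv ℝ u) p η ξ := by
    intro ξ η
    have hd := (hu.fderiv_right (m := 1) (by norm_num)).differentiableAt (by simp)
    rw [fderiv_clm_apply hd (differentiableAt_const ξ)]
    simp
  have e : ∀ k : Fin n, Complex.I • (Pi.single k 1 : Fin n → ℂ) = Pi.single k Complex.I := by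
    intro k
    rw [← Pi.single_smul]
    simp
  rw [complexHessian_apply hu, leviForm]
  simp only [h, e]

theorem sndFDeriv_symm (hu : ContDiffAt ℝ 2 u p) (ξ η : Fin n → ℂ) :
    fderiv ℝ (fderiv ℝ u) p ξ η = fderiv ℝ (fderiv ℝ u) p η ξ :=
  hu.isSymmSndFDerivAt (by simp) ξ η

theorem isHermitian_complexHessian (hu : ContDiffAt ℝ 2 u p) :
    (complexHessian u p).IsHermitian := by
  ext i j
  rw [Matrix.conjTranspose_apply, complexHessian_eq_leviForm hu, complexHessian_eq_leviForm hu]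
  exact leviForm_conj (sndFDeriv_symm hu) _ _

/-- The conjugate appears because `leviForm` is linear in its first slot, whereas `x* H x` is
conjugate linear in the vector attached to the row index. -/
theorem dotProduct_complexHessian (hu : ContDiffAt ℝ 2 u p) (x : Fin n → ℂ) :
    star x ⬝ᵥ (complexHessian u p).mulVec x =
      leviForm (fderiv ℝ (fderiv ℝ u) p) (star x) (star x) := by
  rw [leviForm_eq_sum]
  simp only [dotProduct, Matrix.mulVec, Finset.mul_sum, Pi.star_apply,
    complexHessian_eq_leviForm hu]
  refine Finset.sum_congr rfl fun i _ => Finset.sum_congr rfl fun j _ => ?_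
  simp
  ring

theorem complexHessian_sub (hu : ContDiffAt ℝ 2 u p) (hφ : ContDiffAt ℝ 2 φ p) :
    complexHessian (fun z => u z - φ z) p = complexHessian u p - complexHessian φ p := by
  have h1 : fderiv ℝ (fderiv ℝ (fun z => u z - φ z)) p =
      fderiv ℝ (fderiv ℝ u) p - fderiv ℝ (fderiv ℝ φ) p := by
    have hd : fderiv ℝ (fun z => u z - φ z) =ᶠ[𝓝 p] fun y => fderiv ℝ u y - fderiv ℝ φ y := by
      filter_upwards [hu.eventually (by simp), hφ.eventually (by simp)] with y h1 h2
      exact fderiv_fun_sub (h1.differentiableAt (by simp)) (h2.differentiableAt (by simp))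
    rw [hd.fderiv_eq]
    exact fderiv_fun_sub ((hu.fderiv_right (m := 1) (by norm_num)).differentiableAt (by simp))
      ((hφ.fderiv_right (m := 1) (by norm_num)).differentiableAt (by simp))
  ext i j
  rw [Matrix.sub_apply, complexHessian_eq_leviForm (hu.sub hφ), complexHessian_eq_leviForm hu,
    complexHessian_eq_leviForm hφ, h1]
  simp only [leviForm, _root_.sub_apply]
  push_cast
  ring

/-! ### Second order conditions along real lines -/

theorem deriv_comp_line (hu : ContDiffAt ℝ 2 u p) (ξ : Fin n → ℂ) :
    deriv (fun t : ℝ => u (p + t • ξ)) =ᶠ[𝓝 0] fun t => fderiv ℝ u (p + t • ξ) ξ := by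
  have hc : ContinuousAt (fun t : ℝ => p + t • ξ) 0 := by fun_prop
  have h : ∀ᶠ y in 𝓝 (p + (0 : ℝ) • ξ), ContDiffAt ℝ 2 u y := by
    simpa using hu.eventually (by simp)
  filter_upwards [hc.eventually h] with t ht
  have h1 : HasDerivAt (fun t : ℝ => p + t • ξ) ξ t := by
    simpa using ((hasDerivAt_id t).smul_const ξ).const_add p
  exact ((ht.differentiableAt (by simp)).hasFDerivAt.comp_hasDerivAt t h1).deriv

theorem deriv_deriv_comp_line (hu : ContDiffAt ℝ 2 u p) (ξ : Fin n → ℂ) :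
    deriv (deriv fun t : ℝ => u (p + t • ξ)) 0 = fderiv ℝ (fderiv ℝ u) p ξ ξ := by
  rw [(deriv_comp_line hu ξ).deriv_eq]
  have h1 : HasDerivAt (fun t : ℝ => p + t • ξ) ξ 0 := by
    simpa using ((hasDerivAt_id (0 : ℝ)).smul_const ξ).const_add p
  have h2 : HasFDerivAt (fderiv ℝ u) (fderiv ℝ (fderiv ℝ u) p) (p + (0 : ℝ) • ξ) := by
    simpa using
      ((hu.fderiv_right (m := 1) (by norm_num)).differentiableAt (by simp)).hasFDerivAt
  have h3 := (ContinuousLinearMap.apply ℝ ℝ ξ).hasFDerivAt.comp_hasDerivAt (0 : ℝ)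
    (h2.comp_hasDerivAt (0 : ℝ) h1)
  exact h3.deriv

/-- A negative second derivative at a critical point would make it a local maximum as well, hence
the restriction to the line locally constant, a contradiction. Only a minimum along the line is
assumed: at singular points of `v` nothing more is available. -/
theorem sndFDeriv_nonneg_of_isLocalMin_line (hu : ContDiffAt ℝ 2 u p) {ξ : Fin n → ℂ}
    (h : IsLocalMin (fun t : ℝ => u (p + t • ξ)) 0) : 0 ≤ fderiv ℝ (fderiv ℝ u) p ξ ξ := by
  rw [← deriv_deriv_comp_line hu]
  by_contra! hneg
  have hc : ContinuousAt (fun t : ℝ => u (p + t • ξ)) 0 := by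
    have hc' : ContinuousAt (fun t : ℝ => p + t • ξ) 0 := by fun_prop
    refine ContinuousAt.comp (g := u) ?_ hc'
    simpa using hu.continuousAt
  have hmax := isLocalMax_of_deriv_deriv_neg hneg h.deriv_eq_zero hc
  have hconst : (fun t : ℝ => u (p + t • ξ)) =ᶠ[𝓝 0] fun _ => u (p + (0 : ℝ) • ξ) := by
    filter_upwards [h, hmax] with t h1 h2 using le_antisymm h2 h1
  rw [hconst.deriv.deriv_eq] at hneg
  simp at hneg

theorem sndFDeriv_nonneg_of_isLocalMin (hu : ContDiffAt ℝ 2 u p) (h : IsLocalMin u p)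
    (ξ : Fin n → ℂ) : 0 ≤ fderiv ℝ (fderiv ℝ u) p ξ ξ := by
  refine sndFDeriv_nonneg_of_isLocalMin_line hu ?_
  have hc : Tendsto (fun t : ℝ => p + t • ξ) (𝓝 0) (𝓝 p) := by
    have : ContinuousAt (fun t : ℝ => p + t • ξ) 0 := by fun_prop
    simpa [ContinuousAt] using this
  have := hc.eventually h
  simpa [IsLocalMin, IsMinFilter] using this

/-- The Levi form at `ξ` is a quarter of the sum of the real Hessian at `ξ` and at `iξ`. -/
theorem posSemidef_complexHessian_of_isLocalMin (hu : ContDiffAt ℝ 2 u p) (h : IsLocalMin u p) :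
    (complexHessian u p).PosSemidef := by
  refine .of_dotProduct_mulVec_nonneg (isHermitian_complexHessian hu) fun x => ?_
  rw [dotProduct_complexHessian hu, leviForm_self (sndFDeriv_symm hu)]
  have h1 := sndFDeriv_nonneg_of_isLocalMin hu h (star x)
  have h2 := sndFDeriv_nonneg_of_isLocalMin hu h (Complex.I • star x)
  have : 0 ≤ 1 / 4 * (fderiv ℝ (fderiv ℝ u) p (star x) (star x) +
    fderiv ℝ (fderiv ℝ u) p (Complex.I • star x) (Complex.I • star x)) := by positivity
  exact_mod_cast this

end LeviForm

/-! ### The viscosity property -/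

section Viscosity

variable {m : ℕ}

theorem complexHessian_pogorelov_eq {z : Fin (m + 1) → ℂ} :
    complexHessian (pogorelov m) z = complexHessian (pogorelovApprox m 0) z := by
  rw [pogorelovApprox_zero]

theorem posSemidef_complexHessian_pogorelov {z : Fin (m + 1) → ℂ} (hz : z (Fin.last m) ≠ 0) :
    (complexHessian (pogorelov m) z).PosSemidef := by
  have hs : 0 < regSq 0 z := regSq_pos_of_ne le_rfl hz
  have hc := pogConst_pos m
  have hS : 0 < regSq 0 z ^ pogExp m := Real.rpow_pos_of_pos hs _
  set κ : ℝ := √(pogConst m * regSq 0 z ^ pogExp m) with hκ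
  have hκ2 : κ * κ = pogConst m * regSq 0 z ^ pogExp m := Real.mul_self_sqrt (by positivity)
  have hκc : (κ : ℂ) * κ = ((pogConst m * regSq 0 z ^ pogExp m : ℝ) : ℂ) := by exact_mod_cast hκ2
  set β : ℝ := pogExp m / regSq 0 z with hβ
  -- A square root with `κ² = c s^α` and `β = α / s`: `κ` times the identity on the first `m`
  -- columns, and the last column chosen so that the mixed entries come out right. Its bottom entry
  -- accounts for the summand `1` in `A`.
  let L : Matrix (Fin (m + 1)) (Fin (m + 1)) ℂ := Matrix.of fun k j =>
    if j = Fin.last m then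
      if k = Fin.last m then (κ : ℂ) * β * z (Fin.last m)
      else κ * β * ((starRingEnd ℂ) (z k) * z (Fin.last m))
    else if k = j then (κ : ℂ) else 0
  have hne : ∀ i : Fin m, i.castSucc ≠ Fin.last m := fun i => (Fin.castSucc_lt_last i).ne
  have hne' : ∀ i : Fin m, Fin.last m ≠ i.castSucc := fun i => (hne i).symm
  have hL : complexHessian (pogorelov m) z = L.conjTranspose * L := by
    have h1 : pogConst m * pogExp m * regSq 0 z ^ (pogExp m - 1) = κ * κ * β := by
      rw [hκ2, hβ, Real.rpow_sub_one hs.ne']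
      field_simp
    have h2 : pogConst m * pogBase z * pogExp m * regSq 0 z ^ (pogExp m - 2) *
        (0 + pogExp m * ‖z (Fin.last m)‖ ^ 2) =
        κ * κ * β ^ 2 * ‖z (Fin.last m)‖ ^ 2 * pogBase z := by
      rw [hκ2, hβ, show pogExp m - 2 = pogExp m - 1 - 1 by ring]
      simp only [Real.rpow_sub_one hs.ne']
      field_simp
      ring
    rw [complexHessian_pogorelov_eq]
    ext i j
    rw [Matrix.mul_apply, Fin.sum_univ_castSucc]
    refine Fin.lastCases ?_ (fun i => ?_) i <;> refine Fin.lastCases ?_ (fun j => ?_) j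
    · rw [complexHessian_last_last hs, h2, pogBase]
      simp only [Matrix.conjTranspose_apply, L, Matrix.of_apply, if_true, hne, if_false]
      push_cast
      rw [mul_add, add_comm, mul_one, Finset.mul_sum]
      congr 1
      · refine Finset.sum_congr rfl fun k _ => ?_
        rw [← Complex.conj_mul', ← Complex.conj_mul']
        simp
        ring
      · rw [← Complex.conj_mul']
        simp
        ring
    · rw [complexHessian_last_castSucc hs, h1]
      simp [Matrix.conjTranspose_apply, L, hne, hne']
      ring
    · rw [complexHessian_castSucc_last hs, h1]
      simp [Matrix.conjTranspose_apply, L, hne, hne', apply_ite (starRingEnd ℂ)]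
      ring
    · rw [complexHessian_castSucc_castSucc hs, ← hκc]
      by_cases hij : i = j
      · simp [Matrix.conjTranspose_apply, L, hne, hne', hij]
      · simp [Matrix.conjTranspose_apply, L, hne, hne', hij, Ne.symm hij]
  rw [hL]
  exact Matrix.posSemidef_conjTranspose_mul_self L

/-- For `n = 1`, `|z|² = (|z|² + 1) - 1`: with `ε = 1` the formulas hold at the origin too, so there
is no singular set. -/
theorem pogorelov_zero_eq : pogorelov 0 = fun z => pogorelovApprox 0 1 z - 1 := by
  ext z
  simp [pogorelov, pogorelovApprox]

/-- Away from the singular set, the function is smooth with positive semidefinite complex Hessian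
of determinant one. -/
theorem regular_pogorelov {z : Fin (m + 1) → ℂ} (hz : z (Fin.last m) ≠ 0 ∨ m = 0) :
    ContDiffAt ℝ 2 (pogorelov m) z ∧ (complexHessian (pogorelov m) z).PosSemidef ∧
      (complexHessian (pogorelov m) z).det = 1 := by
  by_cases h0 : m = 0
  · subst h0
    have hs : 0 < regSq 1 z := regSq_pos one_pos z
    have hd : ContDiffAt ℝ 2 (pogorelovApprox 0 1) z :=
      (contDiffAt_pogorelovApprox hs).of_le (by norm_cast)
    have h1 : complexHessian (pogorelov 0) z = 1 := by
      have hconst : complexHessian (fun _ : Fin (0 + 1) → ℂ => (1 : ℝ)) z = 0 := by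
        ext i j
        rw [complexHessian_eq_leviForm contDiffAt_const]
        simp [leviForm]
      rw [pogorelov_zero_eq, complexHessian_sub hd contDiffAt_const, hconst, sub_zero]
      ext i j
      have hi : i = Fin.last 0 := Subsingleton.elim (α := Fin 1) _ _
      have hj : j = Fin.last 0 := Subsingleton.elim (α := Fin 1) _ _
      rw [hi, hj, complexHessian_last_last hs]
      have e : pogConst 0 * pogBase z * pogExp 0 * regSq 1 z ^ (pogExp 0 - 2) *
          (1 + pogExp 0 * ‖z (Fin.last 0)‖ ^ 2) = 1 := by
        have h2 : regSq 1 z ^ (-1 : ℝ) = (regSq 1 z)⁻¹ := Real.rpow_neg_one _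
        have h3 : (1 : ℝ) + ‖z (Fin.last 0)‖ ^ 2 = regSq 1 z := by rw [regSq, add_comm]
        norm_num [pogConst, pogBase, pogExp]
        have h4 : (1 : ℝ) + ‖z 0‖ ^ 2 = regSq 1 z := h3
        rw [h2, h4, inv_mul_cancel₀ hs.ne']
      rw [e]
      simp
    refine ⟨?_, ?_, ?_⟩
    · rw [pogorelov_zero_eq]
      exact hd.sub contDiffAt_const
    · rw [h1]
      exact Matrix.PosSemidef.one
    · rw [h1, Matrix.det_one]
  · have hz' : z (Fin.last m) ≠ 0 := hz.resolve_right h0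
    have hs : 0 < regSq 0 z := regSq_pos_of_ne le_rfl hz'
    refine ⟨?_, posSemidef_complexHessian_pogorelov hz', ?_⟩
    · rw [← pogorelovApprox_zero]
      exact (contDiffAt_pogorelovApprox hs).of_le (by norm_cast)
    · have h1 : (‖z (Fin.last m)‖ ^ 2 + ((m : ℝ) + 1) * pogBase z * 0) / regSq 0 z = 1 := by
        rw [mul_zero]
        exact div_self hs.ne'
      rw [complexHessian_pogorelov_eq, det_complexHessian_pogorelovApprox hs, h1]
      simp

theorem maOperator_nonneg {n : ℕ} {X : Matrix (Fin n) (Fin n) ℂ}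
    (h : X.PosSemidef → X.det.re ≤ 1) : 0 ≤ maOperator X := by
  unfold maOperator
  split_ifs with hX
  · exact_mod_cast sub_nonneg.2 (h hX)
  · exact le_top

theorem maOperator_nonpos {n : ℕ} {X : Matrix (Fin n) (Fin n) ℂ} (hX : X.PosSemidef)
    (h : 1 ≤ X.det.re) : maOperator X ≤ 0 := by
  rw [maOperator, if_pos hX]
  exact_mod_cast sub_nonpos.2 h

theorem pogorelov_eq_zero {z : Fin (m + 1) → ℂ} (hz : z (Fin.last m) = 0) : pogorelov m z = 0 := by
  rw [pogorelov, hz, norm_zero, Real.zero_rpow (by positivity), mul_zero]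

theorem tendsto_line {n : ℕ} (p ξ : Fin n → ℂ) :
    Tendsto (fun t : ℝ => p + t • ξ) (𝓝 0) (𝓝 p) := by
  have : ContinuousAt (fun t : ℝ => p + t • ξ) 0 := by fun_prop
  simpa [ContinuousAt] using this

/-- Along a direction inside the hyperplane `v` is identically `0`, so `φ` has a local maximum there
and the corresponding diagonal entry of its complex Hessian is `≤ 0`. If the Hessian is semidefinite
this entry is `0`, hence so is the determinant. -/
theorem maOperator_nonneg_of_isLocalMin_singular (hm : m ≠ 0) {φ : (Fin (m + 1) → ℂ) → ℝ}
    {p : Fin (m + 1) → ℂ} (hp : p (Fin.last m) = 0) (hφ : ContDiffAt ℝ 2 φ p)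
    (h : IsLocalMin (fun z => pogorelov m z - φ z) p) :
    0 ≤ maOperator (complexHessian φ p) := by
  refine maOperator_nonneg fun hpsd => ?_
  -- A coordinate tangent to the hyperplane exists because `m ≠ 0`.
  let i : Fin m := ⟨0, Nat.pos_of_ne_zero hm⟩
  have key : ∀ a : ℂ, fderiv ℝ (fderiv ℝ φ) p (Pi.single i.castSucc a)
      (Pi.single i.castSucc a) ≤ 0 := by
    intro a
    have hneg : ContDiffAt ℝ 2 (fun z => 0 - φ z) p := contDiffAt_const.sub hφ
    have h1 : IsLocalMin (fun t : ℝ => 0 - φ (p + t • (Pi.single i.castSucc a : Fin (m + 1) → ℂ))) 0 := by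
      filter_upwards [(tendsto_line p (Pi.single i.castSucc a)).eventually h] with t ht
      rw [pogorelov_eq_zero hp, pogorelov_eq_zero (by simp [hp])] at ht
      simpa using ht
    have h2 := sndFDeriv_nonneg_of_isLocalMin_line hneg h1
    have h3 : fderiv ℝ (fderiv ℝ fun z => 0 - φ z) p = - fderiv ℝ (fderiv ℝ φ) p := by
      have : fderiv ℝ (fun z => 0 - φ z) = fun z => - fderiv ℝ φ z := by
        ext z
        simp [fderiv_fun_neg]
      rw [this, fderiv_fun_neg]
    rw [h3] at h2
    simpa using h2
  have hd : complexHessian φ p i.castSucc i.castSucc = 0 := by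
    have h1 := hpsd.diag_nonneg (i := i.castSucc)
    have h2 : complexHessian φ p i.castSucc i.castSucc ≤ 0 := by
      rw [complexHessian_eq_leviForm hφ, leviForm_self (sndFDeriv_symm hφ)]
      have e : Complex.I • (Pi.single i.castSucc 1 : Fin (m + 1) → ℂ) =
          Pi.single i.castSucc Complex.I := by
        rw [← Pi.single_smul]
        simp
      rw [e]
      have := key 1
      have := key Complex.I
      have h3 : 1 / 4 * (fderiv ℝ (fderiv ℝ φ) p (Pi.single i.castSucc 1)
          (Pi.single i.castSucc 1) + fderiv ℝ (fderiv ℝ φ) p (Pi.single i.castSucc Complex.I)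
            (Pi.single i.castSucc Complex.I)) ≤ 0 := by linarith
      exact_mod_cast h3
    exact le_antisymm h2 h1
  rw [hpsd.det_eq_zero_of_diag_eq_zero hd]
  simp

/-- Since `2/n ≤ 1`, transversally to the hyperplane `v` grows at least like `c |t|`. The increment
of `φ` would dominate this cone; having a minimum at `0` it has zero derivative and is `o(t)`, which
is impossible. -/
theorem not_isLocalMax_singular (hm : m ≠ 0) {φ : (Fin (m + 1) → ℂ) → ℝ}
    {p : Fin (m + 1) → ℂ} (hp : p (Fin.last m) = 0) (hφ : DifferentiableAt ℝ φ p) :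
    ¬ IsLocalMax (fun z => pogorelov m z - φ z) p := by
  intro h
  set ξ : Fin (m + 1) → ℂ := Pi.single (Fin.last m) 1 with hξ
  have hc := pogConst_pos m
  have hα1 : 2 / ((m : ℝ) + 1) ≤ 1 := by
    rw [div_le_one (by positivity)]
    have : (1 : ℝ) ≤ m := by exact_mod_cast Nat.one_le_iff_ne_zero.2 hm
    linarith
  have hv : ∀ t : ℝ, |t| ≤ 1 → pogConst m * |t| ≤ pogorelov m (p + t • ξ) := by
    intro t ht
    have h1 : ‖(p + t • ξ) (Fin.last m)‖ = |t| := by simp [hξ, hp]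
    rw [pogorelov, h1, mul_assoc]
    refine mul_le_mul_of_nonneg_left ?_ hc.le
    have h2 : |t| ≤ |t| ^ (2 / ((m : ℝ) + 1)) :=
      Real.self_le_rpow_of_le_one (abs_nonneg t) ht hα1
    exact h2.trans (le_mul_of_one_le_left (by positivity) (one_le_pogBase _))
  set g : ℝ → ℝ := fun t => φ (p + t • ξ) - φ p with hg
  have hg1 : ∀ᶠ t in 𝓝 (0 : ℝ), pogConst m * |t| ≤ g t := by
    filter_upwards [(tendsto_line p ξ).eventually h, Metric.closedBall_mem_nhds (0 : ℝ) one_pos]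
      with t ht ht1
    rw [pogorelov_eq_zero hp] at ht
    have := hv t (by simpa using ht1)
    simp only [hg]
    linarith
  have hg0 : g 0 = 0 := by simp [hg]
  have hgmin : IsLocalMin g 0 := by
    filter_upwards [hg1] with t ht
    rw [hg0]
    exact le_trans (by positivity) ht
  have hgd : DifferentiableAt ℝ g 0 := by
    refine DifferentiableAt.sub_const ?_ _
    refine DifferentiableAt.comp (g := φ) (f := fun t : ℝ => p + t • ξ) (0 : ℝ) ?_ (by fun_prop)
    simpa using hφ
  have hgd' := hgd.hasDerivAt
  rw [hgmin.deriv_eq_zero, hasDerivAt_iff_isLittleO] at hgd'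
  have h1 := hgd'.def (half_pos hc)
  obtain ⟨t, ⟨ht1, ht2⟩, ht0⟩ := ((hg1.and h1).filter_mono nhdsWithin_le_nhds |>.and
    (self_mem_nhdsWithin : {0}ᶜ ∈ 𝓝[≠] (0 : ℝ))).exists
  have ht0' : 0 < |t| := abs_pos.2 ht0
  simp only [hg0, sub_zero, smul_zero, Real.norm_eq_abs] at ht2
  have := le_abs_self (g t)
  nlinarith

/-- At regular points the difference of the two complex Hessians is semidefinite, and monotonicity
of the determinant compares `det` of the test Hessian with `1`. In the maximum case the test Hessian
is a sum of two semidefinite matrices, so it is itself semidefinite. -/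
theorem isViscositySolution_pogorelov : IsViscositySolution (pogorelov m) := by
  refine ⟨continuous_pogorelov, fun φ p hφ => ⟨fun h => ?_, fun h => ?_⟩⟩
  · by_cases hz : p (Fin.last m) ≠ 0 ∨ m = 0
    · obtain ⟨hv, -, hdet⟩ := regular_pogorelov hz
      refine maOperator_nonneg fun hpsd => ?_
      have h1 := posSemidef_complexHessian_of_isLocalMin (hv.sub hφ) h
      rw [complexHessian_sub hv hφ] at h1
      have h2 := hpsd.det_le_det_add h1
      rw [add_sub_cancel, hdet] at h2
      simpa using (Complex.le_def.1 h2).1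
    · push Not at hz
      exact maOperator_nonneg_of_isLocalMin_singular hz.2 hz.1 hφ h
  · by_cases hz : p (Fin.last m) ≠ 0 ∨ m = 0
    · obtain ⟨hv, hvpsd, hdet⟩ := regular_pogorelov hz
      have h0 : IsLocalMin (fun z => φ z - pogorelov m z) p := by
        filter_upwards [h] with z hz
        linarith
      have h1 := posSemidef_complexHessian_of_isLocalMin (hφ.sub hv) h0
      rw [complexHessian_sub hφ hv] at h1
      have h2 := hvpsd.det_le_det_add h1
      have h3 := hvpsd.add h1
      rw [add_sub_cancel] at h2 h3
      rw [hdet] at h2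
      exact maOperator_nonpos h3 (by simpa using (Complex.le_def.1 h2).1)
    · push Not at hz
      exact absurd h (not_isLocalMax_singular hz.2 hz.1 (hφ.differentiableAt (by simp)))

end Viscosity

/-! ### Hölder continuity -/

section Holder

variable {m : ℕ}

theorem holderOnWith_of_dist_le {X Y : Type*} [PseudoMetricSpace X] [PseudoMetricSpace Y]
    {C r : ℝ≥0} {f : X → Y} {s : Set X}
    (h : ∀ x ∈ s, ∀ y ∈ s, dist (f x) (f y) ≤ C * dist x y ^ (r : ℝ)) : HolderOnWith C r f s := by
  intro x hx y hy
  rw [edist_nndist, edist_nndist, ← ENNReal.coe_rpow_of_nonneg _ r.coe_nonneg]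
  exact_mod_cast h x hx y hy

theorem HolderOnWith.dist_le' {X Y : Type*} [PseudoMetricSpace X] [PseudoMetricSpace Y]
    {C r : ℝ≥0} {f : X → Y} {s : Set X} (h : HolderOnWith C r f s) {x y : X} (hx : x ∈ s)
    (hy : y ∈ s) : dist (f x) (f y) ≤ C * dist x y ^ (r : ℝ) := by
  have := h x hx y hy
  rw [edist_nndist, edist_nndist, ← ENNReal.coe_rpow_of_nonneg _ r.coe_nonneg] at this
  exact_mod_cast this

/-- Subadditivity of `t ↦ t^r` for `0 ≤ r ≤ 1`. -/
theorem abs_rpow_sub_rpow_le {a b r : ℝ} (ha : 0 ≤ a) (hb : 0 ≤ b) (hr : 0 ≤ r) (hr1 : r ≤ 1) :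
    |a ^ r - b ^ r| ≤ |a - b| ^ r := by
  wlog h : b ≤ a generalizing a b
  · rw [abs_sub_comm, abs_sub_comm a b]
    exact this hb ha (le_of_not_ge h)
  have h1 := Real.rpow_add_le_add_rpow hb (sub_nonneg.2 h) hr hr1
  rw [add_sub_cancel] at h1
  rw [abs_of_nonneg (sub_nonneg.2 (Real.rpow_le_rpow hb h hr)), abs_of_nonneg (sub_nonneg.2 h)]
  linarith

theorem abs_pogBase_sub_le {R : ℝ} {x y : Fin (m + 1) → ℂ} (hx : ‖x‖ ≤ R) (hy : ‖y‖ ≤ R) :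
    |pogBase x - pogBase y| ≤ m * (2 * R) * dist x y := by
  have hR : 0 ≤ R := (norm_nonneg x).trans hx
  rw [pogBase, pogBase, add_sub_add_left_eq_sub, ← Finset.sum_sub_distrib]
  refine (Finset.abs_sum_le_sum_abs _ _).trans ?_
  calc ∑ i : Fin m, |‖x i.castSucc‖ ^ 2 - ‖y i.castSucc‖ ^ 2|
      ≤ ∑ _i : Fin m, 2 * R * dist x y := by
        refine Finset.sum_le_sum fun i _ => ?_
        have h1 : |‖x i.castSucc‖ - ‖y i.castSucc‖| ≤ dist x y :=
          (abs_norm_sub_norm_le _ _).trans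
            ((dist_eq_norm (x i.castSucc) (y i.castSucc)).symm.le.trans
              (dist_le_pi_dist x y i.castSucc))
        have h2 : ‖x i.castSucc‖ + ‖y i.castSucc‖ ≤ 2 * R := by
          linarith [norm_le_pi_norm x i.castSucc, norm_le_pi_norm y i.castSucc]
        rw [sq_sub_sq, abs_mul, abs_of_nonneg (by positivity)]
        gcongr
    _ = m * (2 * R) * dist x y := by
        simp
        ring

theorem exists_holderOnWith_pogorelov (hm : 1 ≤ m) {K : Set (Fin (m + 1) → ℂ)} (hK : IsCompact K) :
    ∃ C : ℝ≥0, HolderOnWith C (2 / ((m : ℝ≥0) + 1)) (pogorelov m) K := by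
  obtain ⟨R, hR, hKR⟩ := hK.isBounded.subset_closedBall_lt 0 0
  obtain ⟨M, hM⟩ := hK.exists_bound_of_continuousOn
    (contDiff_pogBase (m := m)).continuous.continuousOn
  have hc := pogConst_pos m
  set r : ℝ := 2 / ((m : ℝ) + 1) with hr
  have hr0 : 0 < r := by positivity
  have hr1 : r ≤ 1 := by
    rw [hr, div_le_one (by positivity)]
    have : (1 : ℝ) ≤ m := by exact_mod_cast hm
    linarith
  have hn : ∀ x ∈ K, ‖x‖ ≤ R := fun x hx => by simpa using hKR hx
  -- The two summands bound the two terms of the product rule for differences: variation of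
  -- `pogBase` times the size of `|z_n|^r`, and size of `pogBase` times the variation of `|z_n|^r`.
  let C : ℝ := pogConst m * (m * (2 * R) * (2 * R) ^ (1 - r) * R ^ r + |M|)
  refine ⟨C.toNNReal, holderOnWith_of_dist_le fun x hx y hy => ?_⟩
  have e : (((2 / ((m : ℝ≥0) + 1) : ℝ≥0)) : ℝ) = r := by
    rw [hr]
    push_cast
    rfl
  rw [e, Real.coe_toNNReal _ (by positivity)]
  -- On a bounded set a Lipschitz bound is an `r`-Hölder bound, at the cost of the diameter to the
  -- power `1 - r`.
  have hd : dist x y ≤ (2 * R) ^ (1 - r) * dist x y ^ r := by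
    have h1 : dist x y ≤ 2 * R := by
      rw [dist_eq_norm]
      linarith [norm_sub_le x y, hn x hx, hn y hy]
    calc dist x y = dist x y ^ (1 - r) * dist x y ^ r := by
          rw [← Real.rpow_add_of_nonneg dist_nonneg (by linarith) hr0.le, sub_add_cancel,
            Real.rpow_one]
      _ ≤ _ := by
          gcongr
  have h1 : |pogBase x - pogBase y| ≤ m * (2 * R) * ((2 * R) ^ (1 - r) * dist x y ^ r) :=
    (abs_pogBase_sub_le (hn x hx) (hn y hy)).trans (by gcongr)
  have h2 : |‖x (Fin.last m)‖ ^ r - ‖y (Fin.last m)‖ ^ r| ≤ dist x y ^ r := by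
    refine (abs_rpow_sub_rpow_le (norm_nonneg _) (norm_nonneg _) hr0.le hr1).trans ?_
    refine Real.rpow_le_rpow (abs_nonneg _) ?_ hr0.le
    exact (abs_norm_sub_norm_le _ _).trans
      ((dist_eq_norm (x (Fin.last m)) (y (Fin.last m))).symm.le.trans
        (dist_le_pi_dist x y (Fin.last m)))
  have h3 : ‖x (Fin.last m)‖ ^ r ≤ R ^ r :=
    Real.rpow_le_rpow (norm_nonneg _) ((norm_le_pi_norm x _).trans (hn x hx)) hr0.le
  have h4 : |pogBase y| ≤ |M| := (hM y hy).trans (le_abs_self M)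
  have h5 : pogorelov m x - pogorelov m y = pogConst m *
      ((pogBase x - pogBase y) * ‖x (Fin.last m)‖ ^ r +
        pogBase y * (‖x (Fin.last m)‖ ^ r - ‖y (Fin.last m)‖ ^ r)) := by
    change pogConst m * pogBase x * ‖x (Fin.last m)‖ ^ r -
      pogConst m * pogBase y * ‖y (Fin.last m)‖ ^ r = _
    ring
  rw [Real.dist_eq, h5, abs_mul, abs_of_pos hc]
  calc pogConst m * |(pogBase x - pogBase y) * ‖x (Fin.last m)‖ ^ r +
        pogBase y * (‖x (Fin.last m)‖ ^ r - ‖y (Fin.last m)‖ ^ r)|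
      ≤ pogConst m * (m * (2 * R) * ((2 * R) ^ (1 - r) * dist x y ^ r) * R ^ r +
          |M| * dist x y ^ r) := by
        refine mul_le_mul_of_nonneg_left ((abs_add_le _ _).trans ?_) hc.le
        rw [abs_mul, abs_mul, abs_of_nonneg (Real.rpow_nonneg (norm_nonneg (x (Fin.last m))) r)]
        gcongr
    _ = C * dist x y ^ r := by
        simp only [C]
        ring

/-- Moving from `p` by `t` in the direction of `z_n`, `v` increases by at least `c t^{2/n}`; a
larger Hölder exponent would give `c ≤ C t^{β - 2/n}`, whose right side tends to `0`. -/
theorem not_holderOnWith_pogorelov {p : Fin (m + 1) → ℂ} (hp : p (Fin.last m) = 0) {β : ℝ≥0}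
    (hβ : 2 / ((m : ℝ≥0) + 1) < β) {U : Set (Fin (m + 1) → ℂ)} (hU : U ∈ 𝓝 p) (C : ℝ≥0) :
    ¬ HolderOnWith C β (pogorelov m) U := by
  intro h
  set r : ℝ := 2 / ((m : ℝ) + 1) with hr
  have hc := pogConst_pos m
  have hβr : 0 < (β : ℝ) - r := by
    have : ((2 / ((m : ℝ≥0) + 1) : ℝ≥0) : ℝ) < β := by exact_mod_cast hβ
    push_cast at this
    linarith
  set ξ : Fin (m + 1) → ℂ := Pi.single (Fin.last m) 1 with hξ
  have hξn : ‖ξ‖ = 1 := by rw [hξ, Pi.norm_single, norm_one]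
  have h1 : ∀ᶠ t in 𝓝[>] (0 : ℝ), pogConst m ≤ C * t ^ ((β : ℝ) - r) := by
    filter_upwards [((tendsto_line p ξ).eventually hU).filter_mono nhdsWithin_le_nhds,
      self_mem_nhdsWithin] with t ht ht0
    have ht0' : 0 < t := ht0
    have h2 := h.dist_le' (mem_of_mem_nhds hU) ht
    have h3 : dist p (p + t • ξ) = t := by
      rw [dist_self_add_right, norm_smul, hξn, mul_one, Real.norm_of_nonneg ht0'.le]
    have h4 : ‖(p + t • ξ) (Fin.last m)‖ = t := by simp [hξ, hp, abs_of_pos ht0']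
    have h5 : pogConst m * t ^ r ≤ pogorelov m (p + t • ξ) := by
      rw [pogorelov, h4]
      refine mul_le_mul_of_nonneg_right ?_ (by positivity)
      exact le_mul_of_one_le_right hc.le (one_le_pogBase _)
    rw [h3, pogorelov_eq_zero hp, dist_zero_left, Real.norm_eq_abs] at h2
    have h6 : pogConst m * t ^ r ≤ C * t ^ ((β : ℝ) - r) * t ^ r := by
      rw [mul_assoc, ← Real.rpow_add ht0', sub_add_cancel]
      exact h5.trans ((le_abs_self _).trans h2)
    exact le_of_mul_le_mul_right h6 (Real.rpow_pos_of_pos ht0' _)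
  have h2 : Tendsto (fun t : ℝ => C * t ^ ((β : ℝ) - r)) (𝓝[>] 0) (𝓝 0) := by
    have : ContinuousAt (fun t : ℝ => C * t ^ ((β : ℝ) - r)) 0 :=
      (continuousAt_id.rpow_const (Or.inr hβr.le)).const_mul _
    simpa [ContinuousAt, Real.zero_rpow hβr.ne'] using this.tendsto.mono_left nhdsWithin_le_nhds
  exact hc.not_ge (ge_of_tendsto h2 h1)

end Holder

/-! ### Minors of complex Hessians are divergence free -/

section Minors

theorem det_of_cons_updateCol_swap {k : ℕ} (B : Matrix (Fin (k + 1)) (Fin k) ℂ) (j : Fin k)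
    (x y : Fin (k + 1) → ℂ) :
    (Matrix.of fun i (c : Fin (k + 1)) => Fin.cases (motive := fun _ => ℂ) (x i)
      (fun l => B.updateCol j y i l) c).det =
    - (Matrix.of fun i (c : Fin (k + 1)) => Fin.cases (motive := fun _ => ℂ) (y i)
      (fun l => B.updateCol j x i l) c).det := by
  have h := Matrix.det_permute' (Equiv.swap 0 j.succ)
    (Matrix.of fun i (c : Fin (k + 1)) => Fin.cases (motive := fun _ => ℂ) (y i)
      (fun l => B.updateCol j x i l) c)
  rw [Equiv.Perm.sign_swap (Fin.succ_ne_zero j).symm] at h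
  have h2 : (Matrix.of fun i (c : Fin (k + 1)) => Fin.cases (motive := fun _ => ℂ) (x i)
      (fun l => B.updateCol j y i l) c) =
      (Matrix.of fun i (c : Fin (k + 1)) => Fin.cases (motive := fun _ => ℂ) (y i)
        (fun l => B.updateCol j x i l) c).submatrix id (Equiv.swap 0 j.succ) := by
    ext i c
    refine Fin.cases ?_ (fun l => ?_) c
    · simp
    · by_cases hl : l = j
      · subst hl
        simp
      · have : Equiv.swap 0 j.succ l.succ = l.succ :=
          Equiv.swap_apply_of_ne_of_ne (Fin.succ_ne_zero l) (by simpa using hl)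
        simp [this, hl]
  rw [h2, h]
  simp

/-- The sum is a contraction of the symmetric array `T` with the form `(x, y) ↦ det (x | B with
column j replaced by y)`, which is antisymmetric; hence it vanishes. -/
theorem sum_det_updateCol_eq_zero {k : ℕ} (B : Matrix (Fin (k + 1)) (Fin k) ℂ) (j : Fin k)
    (T : Fin (k + 1) → Fin (k + 1) → ℂ) (hT : ∀ p q, T p q = T q p) :
    ∑ r : Fin (k + 1), (-1) ^ (r : ℕ) *
      ((B.submatrix r.succAbove id).updateCol j fun i => T r (r.succAbove i)).det = 0 := by
  let N : (Fin (k + 1) → ℂ) → (Fin (k + 1) → ℂ) → Matrix (Fin (k + 1)) (Fin (k + 1)) ℂ :=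
    fun x y => Matrix.of fun i (c : Fin (k + 1)) => Fin.cases (motive := fun _ => ℂ) (x i)
      (fun l => B.updateCol j y i l) c
  have hN : ∀ x y, (N x y).det = -(N y x).det := fun x y => det_of_cons_updateCol_swap B j x y
  have hlin : ∀ x y, (N x y).det = ∑ q, y q * (N x (Pi.single q 1)).det := by
    intro x y
    have h1 : ∀ y', N x y' = (N x 0).updateCol j.succ y' := by
      intro y'
      ext i c
      refine Fin.cases ?_ (fun l => ?_) c
      · simp [N, Matrix.updateCol_apply, (Fin.succ_ne_zero j).symm]
      · by_cases hl : l = j <;> simp [N, Matrix.updateCol_apply, hl]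
    simp_rw [h1 y, h1 (Pi.single _ 1), ← Matrix.cramer_apply]
    conv_lhs => rw [pi_eq_sum_univ' y]
    rw [map_sum, Finset.sum_apply]
    refine Finset.sum_congr rfl fun q _ => ?_
    rw [map_smul, Pi.smul_apply, smul_eq_mul]
  -- Expansion along a zeroth column equal to `e_r` deletes row `r` and produces the sign `(-1)^r`.
  have hexp : ∀ r : Fin (k + 1), (-1) ^ (r : ℕ) *
      ((B.submatrix r.succAbove id).updateCol j fun i => T r (r.succAbove i)).det =
      (N (Pi.single r 1) (T r)).det := by
    intro r
    rw [Matrix.det_succ_column_zero, Finset.sum_eq_single r]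
    · have : (N (Pi.single r 1) (T r)).submatrix r.succAbove Fin.succ =
          (B.submatrix r.succAbove id).updateCol j fun i => T r (r.succAbove i) := by
        ext i l
        simp [N, Matrix.updateCol_apply]
      rw [this]
      simp [N]
    · intro i _ hi
      simp [N, hi]
    · simp
  simp_rw [hexp, hlin _ (T _)]
  have h2 : ∑ r, ∑ q, T r q * (N (Pi.single r 1) (Pi.single q 1)).det =
      - ∑ r, ∑ q, T r q * (N (Pi.single r 1) (Pi.single q 1)).det := by
    conv_lhs => rw [Finset.sum_comm]
    rw [← Finset.sum_neg_distrib]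
    refine Finset.sum_congr rfl fun r _ => ?_
    rw [← Finset.sum_neg_distrib]
    refine Finset.sum_congr rfl fun q _ => ?_
    rw [hT, hN]
    ring
  exact CharZero.eq_neg_self_iff.1 h2

/-- The Wirtinger operator `(1/2) (∂/∂x_i + s ∂/∂y_i)`; `s = -√-1` gives `∂/∂z_i` and `s = √-1`
gives `∂/∂z̄_i`. -/
def wirtinger {n : ℕ} (s : ℂ) (i : Fin n) (f : (Fin n → ℂ) → ℂ) (z : Fin n → ℂ) : ℂ :=
  (1 / 2) * (fderiv ℝ f z (Pi.single i 1) + s * fderiv ℝ f z (Pi.single i Complex.I))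

variable {n : ℕ}

theorem dz_eq_wirtinger (i : Fin n) : dz i = wirtinger (-Complex.I) i := by
  ext f z
  rw [dz, wirtinger, neg_mul, sub_eq_add_neg]

theorem dzbar_eq_wirtinger (i : Fin n) : dzbar i = wirtinger Complex.I i := rfl

theorem contDiff_wirtinger (s : ℂ) (i : Fin n) {f : (Fin n → ℂ) → ℂ} (hf : ContDiff ℝ ∞ f) :
    ContDiff ℝ ∞ (wirtinger s i f) := by
  have h : ContDiff ℝ ∞ (fderiv ℝ f) := hf.fderiv_right (by simp)
  unfold wirtinger
  fun_prop

theorem wirtinger_mul (s : ℂ) (i : Fin n) {f g : (Fin n → ℂ) → ℂ} {z : Fin n → ℂ}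
    (hf : DifferentiableAt ℝ f z) (hg : DifferentiableAt ℝ g z) :
    wirtinger s i (fun y => f y * g y) z = wirtinger s i f z * g z + f z * wirtinger s i g z := by
  simp only [wirtinger, fderiv_fun_mul hf hg, _root_.add_apply, _root_.smul_apply, smul_eq_mul]
  ring

theorem wirtinger_comm (s t : ℂ) (i j : Fin n) {f : (Fin n → ℂ) → ℂ} (hf : ContDiff ℝ ∞ f) :
    wirtinger s i (wirtinger t j f) = wirtinger t j (wirtinger s i f) := by
  ext z
  have hd : DifferentiableAt ℝ (fderiv ℝ f) z :=
    ((hf.fderiv_right (m := ∞) (by simp)).differentiable (by simp)) z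
  have h : ∀ (s : ℂ) (i : Fin n) (ξ : Fin n → ℂ), fderiv ℝ (wirtinger s i f) z ξ =
      (1 / 2) * (fderiv ℝ (fderiv ℝ f) z ξ (Pi.single i 1) +
        s * fderiv ℝ (fderiv ℝ f) z ξ (Pi.single i Complex.I)) := by
    intro s i ξ
    have h1 : ∀ η, HasFDerivAt (fun y => fderiv ℝ f y η)
        ((ContinuousLinearMap.apply ℝ ℂ η).comp (fderiv ℝ (fderiv ℝ f) z)) z := fun η =>
      (ContinuousLinearMap.apply ℝ ℂ η).hasFDerivAt.comp z hd.hasFDerivAt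
    have h2 : HasFDerivAt (wirtinger s i f) _ z :=
      ((h1 (Pi.single i 1)).add ((h1 (Pi.single i Complex.I)).const_mul s)).const_mul (1 / 2 : ℂ)
    rw [h2.fderiv]
    simp [mul_add]
  have hs : ∀ ξ η, fderiv ℝ (fderiv ℝ f) z ξ η = fderiv ℝ (fderiv ℝ f) z η ξ := fun ξ η =>
    ((hf.of_le (m := 2) (by norm_cast)).contDiffAt.isSymmSndFDerivAt (by simp)) ξ η
  rw [wirtinger, wirtinger, h, h, h, h, hs (Pi.single j 1) (Pi.single i 1),
    hs (Pi.single j 1) (Pi.single i Complex.I), hs (Pi.single j Complex.I) (Pi.single i 1),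
    hs (Pi.single j Complex.I) (Pi.single i Complex.I)]
  ring

theorem integral_mul_wirtinger (s : ℂ) (i : Fin n) {f φ : (Fin n → ℂ) → ℂ} (hf : ContDiff ℝ ∞ f)
    (hφ : ContDiff ℝ ∞ φ) (hφ' : HasCompactSupport φ) :
    ∫ z, f z * wirtinger s i φ z = - ∫ z, wirtinger s i f z * φ z := by
  have c1 : ∀ ξ, Continuous fun z => fderiv ℝ f z ξ := fun ξ =>
    (hf.continuous_fderiv (by simp)).clm_apply continuous_const
  have c2 : ∀ ξ, Continuous fun z => fderiv ℝ φ z ξ := fun ξ =>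
    (hφ.continuous_fderiv (by simp)).clm_apply continuous_const
  have c3 : ∀ ξ, HasCompactSupport fun z => fderiv ℝ φ z ξ := fun ξ => hφ'.fderiv_apply ℝ ξ
  have i1 : ∀ ξ, Integrable fun z => fderiv ℝ f z ξ * φ z := fun ξ =>
    ((c1 ξ).mul hφ.continuous).integrable_of_hasCompactSupport hφ'.mul_left
  have i2 : ∀ ξ, Integrable fun z => f z * fderiv ℝ φ z ξ := fun ξ =>
    (hf.continuous.mul (c2 ξ)).integrable_of_hasCompactSupport (c3 ξ).mul_left
  have key : ∀ ξ, ∫ z, f z * fderiv ℝ φ z ξ = - ∫ z, fderiv ℝ f z ξ * φ z := fun ξ =>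
    integral_mul_fderiv_eq_neg_fderiv_mul_of_integrable (i1 ξ) (i2 ξ)
      ((hf.continuous.mul hφ.continuous).integrable_of_hasCompactSupport hφ'.mul_left)
      (fun z _ => hf.differentiable (by simp) z) (fun z _ => hφ.differentiable (by simp) z)
  have e1 : (fun z => f z * wirtinger s i φ z) = fun z =>
      (1 / 2) * (f z * fderiv ℝ φ z (Pi.single i 1)) +
        (s / 2) * (f z * fderiv ℝ φ z (Pi.single i Complex.I)) := by
    ext z
    rw [wirtinger]
    ring
  have e2 : (fun z => wirtinger s i f z * φ z) = fun z =>
      (1 / 2) * (fderiv ℝ f z (Pi.single i 1) * φ z) +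
        (s / 2) * (fderiv ℝ f z (Pi.single i Complex.I) * φ z) := by
    ext z
    rw [wirtinger]
    ring
  rw [e1, e2, integral_add ((i2 _).const_mul _) ((i2 _).const_mul _),
    integral_add ((i1 _).const_mul _) ((i1 _).const_mul _)]
  simp only [integral_const_mul, key]
  ring

/-- The product rule, organized column by column. -/
theorem wirtinger_det {k : ℕ} (s : ℂ) (i : Fin n) {M : Fin k → Fin k → (Fin n → ℂ) → ℂ}
    {z : Fin n → ℂ} (hM : ∀ p q, DifferentiableAt ℝ (M p q) z) :
    wirtinger s i (fun y => (Matrix.of fun p q => M p q y).det) z =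
      ∑ j, ((Matrix.of fun p q => M p q z).updateCol j fun p => wirtinger s i (M p j) z).det := by
  have h1 : HasFDerivAt (fun y => (Matrix.of fun p q => M p q y).det)
      (∑ σ : Equiv.Perm (Fin k), ((Equiv.Perm.sign σ : ℤ) : ℂ) •
        ∑ j, (∏ l ∈ Finset.univ.erase j, M (σ l) l z) • fderiv ℝ (M (σ j) j) z) z := by
    have h2 : (fun y => (Matrix.of fun p q => M p q y).det) = fun y =>
        ∑ σ : Equiv.Perm (Fin k), ((Equiv.Perm.sign σ : ℤ) : ℂ) * ∏ l, M (σ l) l y := by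
      ext y
      rw [Matrix.det_apply']
      rfl
    rw [h2]
    refine HasFDerivAt.fun_sum fun σ _ => HasFDerivAt.const_mul ?_ _
    exact HasFDerivAt.finsetProd fun l _ => (hM (σ l) l).hasFDerivAt
  have h3 : ∀ (j : Fin k) (c : Fin k → ℂ),
      ((Matrix.of fun p q => M p q z).updateCol j c).det =
        ∑ σ : Equiv.Perm (Fin k), ((Equiv.Perm.sign σ : ℤ) : ℂ) *
          ((∏ l ∈ Finset.univ.erase j, M (σ l) l z) * c (σ j)) := by
    intro j c
    rw [Matrix.det_apply']
    refine Finset.sum_congr rfl fun σ _ => ?_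
    rw [← Finset.prod_erase_mul _ _ (Finset.mem_univ j)]
    congr 2
    · refine Finset.prod_congr rfl fun l hl => ?_
      rw [Matrix.updateCol_ne (Finset.ne_of_mem_erase hl)]
      rfl
    · rw [Matrix.updateCol_self]
  simp only [h3]
  rw [Finset.sum_comm, wirtinger, h1.fderiv]
  simp only [_root_.sum_apply, _root_.smul_apply, smul_eq_mul, Finset.mul_sum,
    ← Finset.sum_add_distrib, wirtinger]
  refine Finset.sum_congr rfl fun σ _ => Finset.sum_congr rfl fun j _ => ?_
  ring

/-- After differentiating one column, the summand is the contraction treated in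
`sum_det_updateCol_eq_zero`. The symmetry `hs` will come from commuting derivatives when `h` is part
of a Hessian. -/
theorem sum_wirtinger_det_eq_zero {k : ℕ} (s : ℂ) (c : Fin (k + 1) → Fin n)
    {h : Fin (k + 1) → Fin k → (Fin n → ℂ) → ℂ} {z : Fin n → ℂ}
    (hd : ∀ p q, DifferentiableAt ℝ (h p q) z)
    (hs : ∀ p q j, wirtinger s (c p) (h q j) z = wirtinger s (c q) (h p j) z) :
    ∑ r : Fin (k + 1), (-1) ^ (r : ℕ) *
      wirtinger s (c r) (fun y => (Matrix.of fun i j => h (r.succAbove i) j y).det) z = 0 := by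
  have h1 : ∀ r : Fin (k + 1), (-1) ^ (r : ℕ) *
      wirtinger s (c r) (fun y => (Matrix.of fun i j => h (r.succAbove i) j y).det) z =
      ∑ j, (-1) ^ (r : ℕ) * (((Matrix.of fun i j => h i j z).submatrix r.succAbove id).updateCol j
        fun i => wirtinger s (c r) (h (r.succAbove i) j) z).det := by
    intro r
    rw [wirtinger_det s (c r) (M := fun i j => h (r.succAbove i) j) (fun p q => hd _ _),
      Finset.mul_sum]
    rfl
  simp only [h1]
  rw [Finset.sum_comm]
  exact Finset.sum_eq_zero fun j _ => sum_det_updateCol_eq_zero (Matrix.of fun i j => h i j z) j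
    (fun p q => wirtinger s (c p) (h q j) z) fun p q => hs p q j

/-- Integration by parts in which the derivatives of the coefficients `M r` cancel in the sum, so
that the derivative is transferred from `ψ` to `G` alone. -/
theorem sum_integral_mul_wirtinger {ι : Type*} [Fintype ι] (s : ℂ) (e : ι → ℂ) (c : ι → Fin n)
    {M : ι → (Fin n → ℂ) → ℂ} {G ψ : (Fin n → ℂ) → ℂ} (hM : ∀ r, ContDiff ℝ ∞ (M r))
    (hG : ContDiff ℝ ∞ G) (hψ : ContDiff ℝ ∞ ψ) (hψ' : HasCompactSupport ψ)
    (hdiv : ∀ z, ∑ r, e r * wirtinger s (c r) (M r) z = 0) :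
    ∑ r, e r * ∫ z, M r z * (G z * wirtinger s (c r) ψ z) =
      - ∑ r, e r * ∫ z, M r z * (wirtinger s (c r) G z * ψ z) := by
  have i1 : ∀ r, Integrable fun z => wirtinger s (c r) (M r) z * G z * ψ z := fun r =>
    (((contDiff_wirtinger s (c r) (hM r)).continuous.mul hG.continuous).mul
      hψ.continuous).integrable_of_hasCompactSupport hψ'.mul_left
  have i2 : ∀ r, Integrable fun z => M r z * (wirtinger s (c r) G z * ψ z) := fun r =>
    ((hM r).continuous.mul ((contDiff_wirtinger s (c r) hG).continuous.mul
      hψ.continuous)).integrable_of_hasCompactSupport (hψ'.mul_left).mul_left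
  have h1 : ∀ r, e r * ∫ z, M r z * (G z * wirtinger s (c r) ψ z) =
      - (∫ z, e r * wirtinger s (c r) (M r) z * (G z * ψ z)) -
        e r * ∫ z, M r z * (wirtinger s (c r) G z * ψ z) := by
    intro r
    have h2 := integral_mul_wirtinger s (c r) ((hM r).mul hG) hψ hψ'
    simp_rw [← mul_assoc]
    rw [h2]
    have h3 : ∀ z, wirtinger s (c r) (fun y => M r y * G y) z * ψ z =
        wirtinger s (c r) (M r) z * G z * ψ z + M r z * (wirtinger s (c r) G z * ψ z) := by
      intro z
      rw [wirtinger_mul s (c r) ((hM r).differentiable (by simp) z)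
        (hG.differentiable (by simp) z)]
      ring
    simp_rw [h3]
    rw [integral_add (i1 r) (i2 r)]
    simp_rw [mul_assoc, integral_const_mul]
    ring
  simp_rw [h1]
  rw [Finset.sum_sub_distrib, Finset.sum_neg_distrib, ← integral_finsetSum]
  · simp_rw [← Finset.sum_mul, hdiv]
    simp
  · intro r _
    have := (i1 r).const_mul (e r)
    refine this.congr (.of_forall fun z => ?_)
    simp only
    ring

end Minors

/-! ### The Bedford-Taylor recursion for smooth functions -/

section SmoothRecursion

variable {n : ℕ}

/-- The minor of the complex Hessian of `u` with rows `a` and columns `b`. -/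
def hessianMinor (u : (Fin n → ℂ) → ℝ) {k : ℕ} (a b : Fin k → Fin n) (z : Fin n → ℂ) : ℂ :=
  ((complexHessian u z).submatrix a b).det

variable {u : (Fin n → ℂ) → ℝ}

theorem contDiff_complexHessian_apply (hu : ContDiff ℝ ∞ u) (i j : Fin n) :
    ContDiff ℝ ∞ fun z => complexHessian u z i j :=
  contDiff_dz i (contDiff_dzbar j (Complex.ofRealCLM.contDiff.comp hu))

theorem contDiff_hessianMinor (hu : ContDiff ℝ ∞ u) {k : ℕ} (a b : Fin k → Fin n) :
    ContDiff ℝ ∞ (hessianMinor u a b) := by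
  unfold hessianMinor
  simp only [Matrix.det_apply']
  refine ContDiff.sum fun σ _ => contDiff_const.mul (contDiff_prod fun i _ => ?_)
  exact contDiff_complexHessian_apply hu _ _

theorem sum_dz_hessianMinor_eq_zero (hu : ContDiff ℝ ∞ u) {k : ℕ} (a : Fin (k + 1) → Fin n)
    (b : Fin k → Fin n) (z : Fin n → ℂ) :
    ∑ r : Fin (k + 1), (-1) ^ (r : ℕ) *
      wirtinger (-Complex.I) (a r) (hessianMinor u (a ∘ r.succAbove) b) z = 0 := by
  have hU : ContDiff ℝ ∞ fun x => (u x : ℂ) := Complex.ofRealCLM.contDiff.comp hu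
  refine sum_wirtinger_det_eq_zero (-Complex.I) a
    (h := fun p q y => complexHessian u y (a p) (b q))
    (fun p q => (contDiff_complexHessian_apply hu _ _).differentiable (by simp) z)
    fun p q j => ?_
  have h : ∀ i l, (fun y => complexHessian u y i l) =
      wirtinger (-Complex.I) i (dzbar l fun x => (u x : ℂ)) := by
    intro i l
    rw [← dz_eq_wirtinger]
    rfl
  simp only [h]
  rw [wirtinger_comm _ _ _ _ (contDiff_dzbar _ hU)]

theorem sum_dzbar_hessianMinor_eq_zero (hu : ContDiff ℝ ∞ u) {k : ℕ} (a : Fin k → Fin n)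
    (b : Fin (k + 1) → Fin n) (z : Fin n → ℂ) :
    ∑ s : Fin (k + 1), (-1) ^ (s : ℕ) *
      wirtinger Complex.I (b s) (hessianMinor u a (b ∘ s.succAbove)) z = 0 := by
  have hU : ContDiff ℝ ∞ fun x => (u x : ℂ) := Complex.ofRealCLM.contDiff.comp hu
  -- Transposing turns the deleted column into a deleted row, the form that
  -- `sum_wirtinger_det_eq_zero` treats.
  have h0 : ∀ s : Fin (k + 1), hessianMinor u a (b ∘ s.succAbove) = fun y =>
      (Matrix.of fun i j => complexHessian u y (a j) (b (s.succAbove i))).det := by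
    intro s
    ext y
    rw [hessianMinor, ← Matrix.det_transpose]
    rfl
  simp only [h0]
  refine sum_wirtinger_det_eq_zero Complex.I b
    (h := fun p q y => complexHessian u y (a q) (b p))
    (fun p q => (contDiff_complexHessian_apply hu _ _).differentiable (by simp) z)
    fun p q j => ?_
  have h : ∀ i l, (fun y => complexHessian u y i l) =
      wirtinger Complex.I l (dz i fun x => (u x : ℂ)) := by
    intro i l
    change dz i (dzbar l fun x => (u x : ℂ)) = _
    rw [dz_eq_wirtinger, dzbar_eq_wirtinger, wirtinger_comm _ _ _ _ hU]
  simp only [h]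
  rw [wirtinger_comm _ _ _ _ (contDiff_dz _ hU)]

/-- Expanding the minor along each of its `k + 1` rows gives the factor `k + 1` and a double sum of
cofactors times `u_{a_r b̄_s}`. Divergence-freeness in the columns (`s2`, for fixed `r`) and in the
rows (`s1`, for fixed `s`) then moves both derivatives from `u` to `φ`; the two minus signs cancel.
-/
theorem hessianMinor_recursion (hu : ContDiff ℝ ∞ u) {k : ℕ} (a b : Fin (k + 1) → Fin n)
    {φ : (Fin n → ℂ) → ℂ} (hφ : ContDiff ℝ ∞ φ) (hφ' : HasCompactSupport φ) :
    ((k : ℂ) + 1) * ∫ z, hessianMinor u a b z * φ z =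
      ∑ r : Fin (k + 1), ∑ s : Fin (k + 1), (-1) ^ ((r : ℕ) + (s : ℕ)) *
        ∫ z, hessianMinor u (a ∘ r.succAbove) (b ∘ s.succAbove) z *
          ((u z : ℂ) * dz (a r) (dzbar (b s) φ) z) := by
  have hU : ContDiff ℝ ∞ fun x => (u x : ℂ) := Complex.ofRealCLM.contDiff.comp hu
  have hm : ∀ r s : Fin (k + 1),
      ContDiff ℝ ∞ (hessianMinor u (a ∘ r.succAbove) (b ∘ s.succAbove)) :=
    fun r s => contDiff_hessianMinor hu _ _
  have s1 : ∀ s : Fin (k + 1), ∑ r : Fin (k + 1), (-1) ^ (r : ℕ) *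
      ∫ z, hessianMinor u (a ∘ r.succAbove) (b ∘ s.succAbove) z *
        ((u z : ℂ) * dz (a r) (dzbar (b s) φ) z) =
      - ∑ r : Fin (k + 1), (-1) ^ (r : ℕ) *
        ∫ z, hessianMinor u (a ∘ r.succAbove) (b ∘ s.succAbove) z *
          (dz (a r) (fun x => (u x : ℂ)) z * dzbar (b s) φ z) := by
    intro s
    simp only [dz_eq_wirtinger]
    exact sum_integral_mul_wirtinger (-Complex.I) (fun r : Fin (k + 1) => (-1) ^ (r : ℕ)) a
      (fun r => hm r s) hU (contDiff_dzbar _ hφ) (hasCompactSupport_dzbar _ hφ')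
      (sum_dz_hessianMinor_eq_zero hu a _)
  have s2 : ∀ r : Fin (k + 1), ∑ s : Fin (k + 1), (-1) ^ (s : ℕ) *
      ∫ z, hessianMinor u (a ∘ r.succAbove) (b ∘ s.succAbove) z *
        (dz (a r) (fun x => (u x : ℂ)) z * dzbar (b s) φ z) =
      - ∑ s : Fin (k + 1), (-1) ^ (s : ℕ) *
        ∫ z, hessianMinor u (a ∘ r.succAbove) (b ∘ s.succAbove) z *
          (complexHessian u z (a r) (b s) * φ z) := by
    intro r
    have h : ∀ s z, complexHessian u z (a r) (b s) =
        wirtinger Complex.I (b s) (dz (a r) (fun x => (u x : ℂ))) z := by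
      intro s z
      change dz (a r) (dzbar (b s) fun x => (u x : ℂ)) z = _
      rw [dz_eq_wirtinger, dzbar_eq_wirtinger, wirtinger_comm _ _ _ _ hU]
    simp only [h, dzbar_eq_wirtinger]
    exact sum_integral_mul_wirtinger Complex.I (fun s : Fin (k + 1) => (-1) ^ (s : ℕ)) b
      (fun s => hm r s) (contDiff_dz _ hU) hφ hφ' (sum_dzbar_hessianMinor_eq_zero hu _ b)
  have i1 : ∀ r s : Fin (k + 1), Integrable fun z =>
      (-1) ^ ((r : ℕ) + (s : ℕ)) * (hessianMinor u (a ∘ r.succAbove) (b ∘ s.succAbove) z *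
        (complexHessian u z (a r) (b s) * φ z)) := fun r s =>
    (((hm r s).continuous.mul ((contDiff_complexHessian_apply hu _ _).continuous.mul
      hφ.continuous)).integrable_of_hasCompactSupport hφ'.mul_left.mul_left).const_mul _
  calc ((k : ℂ) + 1) * ∫ z, hessianMinor u a b z * φ z
      = ∑ r : Fin (k + 1), ∫ z, hessianMinor u a b z * φ z := by
        simp
    _ = ∑ r : Fin (k + 1), ∫ z, ∑ s : Fin (k + 1), (-1) ^ ((r : ℕ) + (s : ℕ)) *
          (hessianMinor u (a ∘ r.succAbove) (b ∘ s.succAbove) z *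
            (complexHessian u z (a r) (b s) * φ z)) := by
        refine Finset.sum_congr rfl fun r _ => integral_congr_ae (.of_forall fun z => ?_)
        simp only
        rw [hessianMinor, Matrix.det_succ_row _ r, Finset.sum_mul]
        refine Finset.sum_congr rfl fun s _ => ?_
        rw [hessianMinor, Matrix.submatrix_submatrix, Matrix.submatrix_apply]
        ring
    _ = ∑ r : Fin (k + 1), (-1) ^ (r : ℕ) * ∑ s : Fin (k + 1), (-1) ^ (s : ℕ) *
          ∫ z, hessianMinor u (a ∘ r.succAbove) (b ∘ s.succAbove) z *
            (complexHessian u z (a r) (b s) * φ z) := by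
        refine Finset.sum_congr rfl fun r _ => ?_
        rw [integral_finsetSum _ fun s _ => i1 r s, Finset.mul_sum]
        refine Finset.sum_congr rfl fun s _ => ?_
        rw [integral_const_mul, pow_add, mul_assoc]
    _ = - ∑ r : Fin (k + 1), (-1) ^ (r : ℕ) * ∑ s : Fin (k + 1), (-1) ^ (s : ℕ) *
          ∫ z, hessianMinor u (a ∘ r.succAbove) (b ∘ s.succAbove) z *
            (dz (a r) (fun x => (u x : ℂ)) z * dzbar (b s) φ z) := by
        simp only [s2, mul_neg, Finset.sum_neg_distrib, neg_neg]
    _ = - ∑ s : Fin (k + 1), (-1) ^ (s : ℕ) * ∑ r : Fin (k + 1), (-1) ^ (r : ℕ) *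
          ∫ z, hessianMinor u (a ∘ r.succAbove) (b ∘ s.succAbove) z *
            (dz (a r) (fun x => (u x : ℂ)) z * dzbar (b s) φ z) := by
        simp only [Finset.mul_sum]
        rw [Finset.sum_comm]
        simp only [mul_left_comm]
    _ = ∑ s : Fin (k + 1), (-1) ^ (s : ℕ) * ∑ r : Fin (k + 1), (-1) ^ (r : ℕ) *
          ∫ z, hessianMinor u (a ∘ r.succAbove) (b ∘ s.succAbove) z *
            ((u z : ℂ) * dz (a r) (dzbar (b s) φ) z) := by
        simp only [s1, mul_neg, Finset.sum_neg_distrib]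
    _ = _ := by
        simp only [Finset.mul_sum]
        rw [Finset.sum_comm]
        refine Finset.sum_congr rfl fun r _ => Finset.sum_congr rfl fun s _ => ?_
        rw [pow_add]
        ring

end SmoothRecursion

/-! ### The Monge-Ampère measure of the Pogorelov-type function -/

section BedfordTaylor

variable {m : ℕ}

/-- The size of the entries of the complex Hessian in row or column `i`, relative to the others. -/
def hessWeight (ε : ℝ) (z : Fin (m + 1) → ℂ) (i : Fin (m + 1)) : ℝ :=
  if i = Fin.last m then (√(regSq ε z))⁻¹ else 1

theorem hessWeight_pos {ε : ℝ} {z : Fin (m + 1) → ℂ} (hz : 0 < regSq ε z) (i : Fin (m + 1)) :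
    0 < hessWeight ε z i := by
  unfold hessWeight
  split_ifs
  · exact inv_pos.2 (Real.sqrt_pos.2 hz)
  · exact one_pos

/-- Relative to `s^α`, the entries have size `1` in the scalar block, `|w| / s ≤ s^{-1/2}` in the
last row and column, and `s^{-1}` in the corner, up to a locally bounded factor. This is a product
of a row weight and a column weight. -/
theorem norm_complexHessian_apply_le {ε R M : ℝ} (hε : 0 ≤ ε) {z : Fin (m + 1) → ℂ}
    (hz : 0 < regSq ε z) (hR : ‖z‖ ≤ R) (hM : pogBase z ≤ M) (i j : Fin (m + 1)) :
    ‖complexHessian (pogorelovApprox m ε) z i j‖ ≤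
      pogConst m * (R + M) * (regSq ε z ^ pogExp m * (hessWeight ε z i * hessWeight ε z j)) := by
  have hc := pogConst_pos m
  have hα := pogExp_pos m
  have hα1 := pogExp_le_one m
  have hA := one_le_pogBase z
  have hR0 : 0 ≤ R := (norm_nonneg z).trans hR
  have hRM : 0 ≤ R + M := by linarith
  have hcRM : 0 ≤ pogConst m * (R + M) := mul_nonneg hc.le hRM
  have hS : 0 < regSq ε z ^ pogExp m := Real.rpow_pos_of_pos hz _
  have hσ : 0 < √(regSq ε z) := Real.sqrt_pos.2 hz
  have hσ2 : regSq ε z = √(regSq ε z) ^ 2 := (Real.sq_sqrt hz.le).symm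
  have hw : ‖z (Fin.last m)‖ ≤ √(regSq ε z) := Real.le_sqrt_of_sq_le (by unfold regSq; linarith)
  have hne : ∀ i : Fin m, i.castSucc ≠ Fin.last m := fun i => (Fin.castSucc_lt_last i).ne
  have off : ∀ k : Fin m, pogConst m * pogExp m * regSq ε z ^ (pogExp m - 1) *
      (‖z k.castSucc‖ * ‖z (Fin.last m)‖) ≤
        pogConst m * (R + M) * (regSq ε z ^ pogExp m * (√(regSq ε z))⁻¹) := by
    intro k
    have h1 : regSq ε z ^ (pogExp m - 1) * √(regSq ε z) =
        regSq ε z ^ pogExp m * (√(regSq ε z))⁻¹ := by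
      rw [Real.rpow_sub_one hz.ne']
      nth_rewrite 2 [hσ2]
      field_simp
    rw [← h1]
    have h2 : ‖z k.castSucc‖ ≤ R + M := by linarith [norm_le_pi_norm z k.castSucc]
    calc pogConst m * pogExp m * regSq ε z ^ (pogExp m - 1) *
          (‖z k.castSucc‖ * ‖z (Fin.last m)‖)
        ≤ pogConst m * 1 * regSq ε z ^ (pogExp m - 1) * ((R + M) * √(regSq ε z)) := by
          gcongr
      _ = _ := by ring
  refine Fin.lastCases ?_ (fun i => ?_) i <;> refine Fin.lastCases ?_ (fun j => ?_) j
  · rw [complexHessian_last_last hz, Complex.norm_real, Real.norm_of_nonneg (by positivity)]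
    simp only [hessWeight, if_true]
    have h1 : regSq ε z ^ (pogExp m - 2) * regSq ε z =
        regSq ε z ^ pogExp m * ((√(regSq ε z))⁻¹ * (√(regSq ε z))⁻¹) := by
      rw [← mul_inv, ← sq, ← hσ2, ← Real.rpow_add_one hz.ne', ← div_eq_mul_inv,
        ← Real.rpow_sub_one hz.ne']
      congr 1
      ring
    rw [← h1]
    have h2 : ε + pogExp m * ‖z (Fin.last m)‖ ^ 2 ≤ regSq ε z := by
      rw [regSq]
      nlinarith [sq_nonneg ‖z (Fin.last m)‖]
    have h3 : pogBase z ≤ R + M := by linarith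
    have h4 : 0 ≤ pogConst m * (R + M) * 1 * regSq ε z ^ (pogExp m - 2) := by positivity
    calc pogConst m * pogBase z * pogExp m * regSq ε z ^ (pogExp m - 2) *
          (ε + pogExp m * ‖z (Fin.last m)‖ ^ 2)
        ≤ pogConst m * (R + M) * 1 * regSq ε z ^ (pogExp m - 2) * regSq ε z := by
          gcongr
      _ = _ := by ring
  · rw [complexHessian_last_castSucc hz, norm_mul, Complex.norm_real,
      Real.norm_of_nonneg (by positivity), norm_mul, RCLike.norm_conj, mul_comm ‖z (Fin.last m)‖]
    simpa [hessWeight, hne] using off j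
  · rw [complexHessian_castSucc_last hz, norm_mul, Complex.norm_real,
      Real.norm_of_nonneg (by positivity), norm_mul, RCLike.norm_conj]
    simpa [hessWeight, hne] using off i
  · rw [complexHessian_castSucc_castSucc hz]
    simp only [hessWeight, hne, if_false, mul_one]
    have h1 : pogConst m * regSq ε z ^ pogExp m ≤
        pogConst m * (R + M) * regSq ε z ^ pogExp m := by
      refine mul_le_mul_of_nonneg_right (le_mul_of_one_le_right hc.le ?_) hS.le
      linarith
    split_ifs
    · rwa [Complex.norm_real, Real.norm_of_nonneg (by positivity)]
    · rw [norm_zero]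
      exact le_trans (by positivity) h1

/-- An injective multi-index meets the last coordinate at most once. If it does not, the product is
`1`, which is still at most `S s^{-1/2}` because `√s ≤ S`. -/
theorem prod_hessWeight_le {ε S : ℝ} {z : Fin (m + 1) → ℂ} (hz : 0 < regSq ε z) (hS : 1 ≤ S)
    (hzS : √(regSq ε z) ≤ S) {k : ℕ} {a : Fin k → Fin (m + 1)} (ha : Function.Injective a) :
    ∏ r, hessWeight ε z (a r) ≤ S * (√(regSq ε z))⁻¹ := by
  have hσ : 0 < √(regSq ε z) := Real.sqrt_pos.2 hz
  by_cases h : ∃ r, a r = Fin.last m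
  · obtain ⟨r, hr⟩ := h
    rw [Finset.prod_eq_single r]
    · rw [hessWeight, if_pos hr]
      exact le_mul_of_one_le_left (inv_pos.2 hσ).le hS
    · intro s _ hs
      rw [hessWeight, if_neg]
      intro h
      exact hs (ha (h.trans hr.symm))
    · simp
  · push Not at h
    rw [Finset.prod_eq_one fun r _ => by rw [hessWeight, if_neg (h r)], ← div_eq_mul_inv,
      le_div_iff₀ hσ, one_mul]
    exact hzS

/-- Minors with a repeated index vanish. In the others the weights factor out of rows and columns,
contributing at most a constant times `s^{-1}`, and `s^α` factors out `k` times. Since `αk ≤ 1`, the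
exponent `αk - 1` is nonpositive and `s` may be replaced by `|w|²`. -/
theorem exists_bound_hessianMinor {k : ℕ} (hk : k ≤ m + 1) (a b : Fin k → Fin (m + 1)) (R : ℝ)
    (hR : 0 < R) :
    ∃ C : ℝ, 0 ≤ C ∧ ∀ ε ∈ Icc (0 : ℝ) 1, ∀ z ∈ Metric.ball (0 : Fin (m + 1) → ℂ) R,
      z (Fin.last m) ≠ 0 →
        ‖hessianMinor (pogorelovApprox m ε) a b z‖ ≤
          C * ‖z (Fin.last m)‖ ^ (2 * pogExp m * k - 2) := by
  by_cases ha : Function.Injective a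
  swap
  · refine ⟨0, le_rfl, fun ε _ z _ _ => ?_⟩
    simp only [Function.Injective, not_forall] at ha
    obtain ⟨r, s, hrs, hne⟩ := ha
    rw [hessianMinor, Matrix.det_zero_of_row_eq hne (by ext j; simp [hrs])]
    simp
  by_cases hb : Function.Injective b
  swap
  · refine ⟨0, le_rfl, fun ε _ z _ _ => ?_⟩
    simp only [Function.Injective, not_forall] at hb
    obtain ⟨r, s, hrs, hne⟩ := hb
    rw [hessianMinor, Matrix.det_zero_of_column_eq hne (by intro j; simp [hrs])]
    simp
  obtain ⟨M, hM⟩ := (isCompact_closedBall (0 : Fin (m + 1) → ℂ) R).exists_bound_of_continuousOn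
    (contDiff_pogBase (m := m)).continuous.continuousOn
  have hc := pogConst_pos m
  have hM0 : 0 ≤ M := (norm_nonneg _).trans (hM 0 (by simpa using hR.le))
  set E : ℝ := pogConst m * (R + M) with hE
  have hE0 : 0 ≤ E := by positivity
  -- One factor `R + 1` for the row weights and one for the column weights, as `√s ≤ R + 1` on the
  -- ball; `k! E^k` bounds the determinant of the normalized matrix `N`.
  refine ⟨(R + 1) ^ 2 * (k.factorial * E ^ k), by positivity, fun ε hε z hzR hz => ?_⟩
  have hs : 0 < regSq ε z := regSq_pos_of_ne hε.1 hz
  have hzR' : ‖z‖ < R := by simpa using hzR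
  have hσ : 0 < √(regSq ε z) := Real.sqrt_pos.2 hs
  have hS : 0 < regSq ε z ^ pogExp m := Real.rpow_pos_of_pos hs _
  have hσR : √(regSq ε z) ≤ R + 1 := by
    refine Real.sqrt_le_iff.2 ⟨by positivity, ?_⟩
    have h1 : ‖z (Fin.last m)‖ ≤ R := (norm_le_pi_norm z _).trans hzR'.le
    have h2 : ‖z (Fin.last m)‖ ^ 2 ≤ R ^ 2 := by gcongr
    rw [regSq]
    nlinarith [hε.2]
  let N : Matrix (Fin k) (Fin k) ℂ := Matrix.of fun r s =>
    complexHessian (pogorelovApprox m ε) z (a r) (b s) /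
      ((regSq ε z ^ pogExp m * (hessWeight ε z (a r) * hessWeight ε z (b s)) : ℝ) : ℂ)
  have hN : ∀ r s, ‖N r s‖ ≤ E := by
    intro r s
    have h1 := hessWeight_pos hs (a r)
    have h2 := hessWeight_pos hs (b s)
    have h3 : 0 < regSq ε z ^ pogExp m * (hessWeight ε z (a r) * hessWeight ε z (b s)) := by
      positivity
    simp only [N, Matrix.of_apply]
    rw [norm_div, Complex.norm_real, Real.norm_of_nonneg h3.le, div_le_iff₀ h3]
    exact norm_complexHessian_apply_le hε.1 hs hzR'.le ((le_abs_self _).trans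
      (hM z (Metric.ball_subset_closedBall hzR))) _ _
  have hdet : ‖N.det‖ ≤ k.factorial * E ^ k := by
    have := Matrix.det_le (A := N) (abv := NormedField.toAbsoluteValue ℂ) (x := E) hN
    simp only [nsmul_eq_mul, Fintype.card_fin] at this
    exact this
  have hfac : hessianMinor (pogorelovApprox m ε) a b z =
      (∏ r, ((regSq ε z ^ pogExp m * hessWeight ε z (a r) : ℝ) : ℂ)) *
        ((∏ s, ((hessWeight ε z (b s) : ℝ) : ℂ)) * N.det) := by
    rw [← Matrix.det_mul_row, ← Matrix.det_mul_column, hessianMinor]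
    congr 1
    ext r s
    have h1 := (hessWeight_pos hs (a r)).ne'
    have h2 := (hessWeight_pos hs (b s)).ne'
    have h1' : ((hessWeight ε z (a r) : ℝ) : ℂ) ≠ 0 := by exact_mod_cast h1
    have h2' : ((hessWeight ε z (b s) : ℝ) : ℂ) ≠ 0 := by exact_mod_cast h2
    have h3' : ((regSq ε z ^ pogExp m : ℝ) : ℂ) ≠ 0 := by exact_mod_cast hS.ne'
    simp only [N, Matrix.of_apply, Matrix.submatrix_apply, Complex.ofReal_mul]
    field_simp
  have hα := pogExp_pos m
  have hkα : pogExp m * k ≤ 1 := by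
    rw [pogExp, one_div_mul_eq_div, div_le_one (by positivity)]
    exact_mod_cast hk
  have hpa : 0 ≤ ∏ r, hessWeight ε z (a r) := Finset.prod_nonneg fun r _ => (hessWeight_pos hs _).le
  have hpb : 0 ≤ ∏ r, hessWeight ε z (b r) := Finset.prod_nonneg fun r _ => (hessWeight_pos hs _).le
  have hna : ‖∏ r, ((regSq ε z ^ pogExp m * hessWeight ε z (a r) : ℝ) : ℂ)‖ =
      (regSq ε z ^ pogExp m) ^ k * ∏ r, hessWeight ε z (a r) := by
    rw [← Complex.ofReal_prod, Complex.norm_real, Finset.prod_mul_distrib, Finset.prod_const,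
      Finset.card_univ, Fintype.card_fin, Real.norm_of_nonneg (by positivity)]
  have hnb : ‖∏ s, ((hessWeight ε z (b s) : ℝ) : ℂ)‖ = ∏ s, hessWeight ε z (b s) := by
    rw [← Complex.ofReal_prod, Complex.norm_real, Real.norm_of_nonneg hpb]
  rw [hfac, norm_mul, norm_mul, hna, hnb]
  have hpow : (regSq ε z ^ pogExp m) ^ k * (√(regSq ε z))⁻¹ ^ 2 ≤
      ‖z (Fin.last m)‖ ^ (2 * pogExp m * k - 2) := by
    have h1 : (regSq ε z ^ pogExp m) ^ k * (√(regSq ε z))⁻¹ ^ 2 =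
        regSq ε z ^ (pogExp m * k - 1) := by
      rw [← Real.rpow_natCast, ← Real.rpow_mul hs.le, inv_pow, Real.sq_sqrt hs.le,
        Real.rpow_sub_one hs.ne', div_eq_mul_inv]
    have hw := norm_pos_iff.2 hz
    rw [h1]
    calc regSq ε z ^ (pogExp m * k - 1) ≤ (‖z (Fin.last m)‖ ^ 2) ^ (pogExp m * k - 1) :=
          Real.rpow_le_rpow_of_nonpos (by positivity) (by rw [regSq]; linarith [hε.1])
            (by linarith)
      _ = _ := by
          rw [← Real.rpow_natCast, ← Real.rpow_mul hw.le]
          congr 1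
          push_cast
          ring
  have hS1 : (1 : ℝ) ≤ R + 1 := by linarith
  calc (regSq ε z ^ pogExp m) ^ k * (∏ r, hessWeight ε z (a r)) *
        ((∏ s, hessWeight ε z (b s)) * ‖N.det‖)
      ≤ (regSq ε z ^ pogExp m) ^ k * ((R + 1) * (√(regSq ε z))⁻¹) *
        (((R + 1) * (√(regSq ε z))⁻¹) * (k.factorial * E ^ k)) := by
        gcongr
        · exact prod_hessWeight_le hs hS1 hσR ha
        · exact prod_hessWeight_le hs hS1 hσR hb
    _ = (R + 1) ^ 2 * (k.factorial * E ^ k) *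
        ((regSq ε z ^ pogExp m) ^ k * (√(regSq ε z))⁻¹ ^ 2) := by ring
    _ ≤ _ := by gcongr

/-! ### Passage to the limit in the minors, and the resulting currents -/

theorem continuousAt_hessianMinor_eps {k : ℕ} (a b : Fin k → Fin (m + 1))
    {z : Fin (m + 1) → ℂ} (hz : z (Fin.last m) ≠ 0) :
    ContinuousAt (fun ε => hessianMinor (pogorelovApprox m ε) a b z) 0 := by
  have hc : ContinuousAt (fun ε => regSq ε z) 0 := by unfold regSq; fun_prop
  have hev := hc.eventually (lt_mem_nhds (regSq_pos_of_ne le_rfl hz))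
  have h1 : ∀ i j, ContinuousAt (fun ε => complexHessian (pogorelovApprox m ε) z i j) 0 := by
    intro i j
    have h2 : ∀ ξ η, ContinuousAt (fun ε => ((pogD2 ε ξ η z : ℝ) : ℂ)) 0 := fun ξ η =>
      Complex.continuous_ofReal.continuousAt.comp (continuousAt_pogD2_eps hz ξ η)
    have h3 : ContinuousAt (fun ε => 1 / 4 *
        ((((pogD2 ε (Pi.single j 1) (Pi.single i 1) z : ℝ) : ℂ) +
          ((pogD2 ε (Pi.single j Complex.I) (Pi.single i Complex.I) z : ℝ) : ℂ)) +
        Complex.I * (((pogD2 ε (Pi.single j Complex.I) (Pi.single i 1) z : ℝ) : ℂ) -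
          ((pogD2 ε (Pi.single j 1) (Pi.single i Complex.I) z : ℝ) : ℂ)))) 0 :=
      (((h2 _ _).add (h2 _ _)).add (((h2 _ _).sub (h2 _ _)).const_mul _)).const_mul _
    refine h3.congr ?_
    filter_upwards [hev] with ε hε
    rw [complexHessian_pogorelovApprox_apply hε]
    push_cast
    rfl
  unfold hessianMinor
  simp only [Matrix.det_apply', Matrix.submatrix_apply]
  refine tendsto_finsetSum _ fun σ _ => Tendsto.const_mul _ (tendsto_finsetProd _ fun i _ => h1 _ _)

theorem aestronglyMeasurable_hessianMinor {ε : ℝ} (hε : 0 ≤ ε) {k : ℕ}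
    (a b : Fin k → Fin (m + 1)) :
    AEStronglyMeasurable (hessianMinor (pogorelovApprox m ε) a b) volume := by
  have hpos : ∀ ε > 0, AEStronglyMeasurable (hessianMinor (pogorelovApprox m ε) a b) volume :=
    fun ε hε => (contDiff_hessianMinor
      (contDiff_pogorelovApprox hε) a b).continuous.aestronglyMeasurable
  rcases hε.eq_or_lt with rfl | hε
  · refine aestronglyMeasurable_of_tendsto_ae (u := atTop)
      (f := fun n : ℕ => hessianMinor (pogorelovApprox m (1 / ((n : ℝ) + 1))) a b)
      (fun n => hpos _ (by positivity)) ?_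
    filter_upwards [ae_last_ne_zero] with z hz
    exact (continuousAt_hessianMinor_eps a b hz).tendsto.comp tendsto_one_div_add_atTop_nhds_zero_nat
  · exact hpos ε hε

theorem neg_two_lt_minorExp (k : ℕ) : k = 0 ∨ -2 < 2 * pogExp m * k - 2 := by
  rcases Nat.eq_zero_or_pos k with h | h
  · exact Or.inl h
  · right
    have h1 : (0 : ℝ) < k := by exact_mod_cast h
    have := pogExp_pos m
    have : 0 < 2 * pogExp m * k := by positivity
    linarith

/-- The bound for minors, with an exponent above `-2` in all cases. -/
theorem exists_bound_hessianMinor' {k : ℕ} (hk : k ≤ m + 1) (a b : Fin k → Fin (m + 1)) :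
    ∃ t : ℝ, -2 < t ∧ ∀ R : ℝ, 0 < R → ∃ C : ℝ, 0 ≤ C ∧ ∀ ε ∈ Icc (0 : ℝ) 1,
      ∀ z ∈ Metric.ball (0 : Fin (m + 1) → ℂ) R, z (Fin.last m) ≠ 0 →
        ‖hessianMinor (pogorelovApprox m ε) a b z‖ ≤ C * ‖z (Fin.last m)‖ ^ t := by
  rcases neg_two_lt_minorExp (m := m) k with h | h
  · subst h
    -- For `k = 0` the general exponent is exactly `-2`, which is not integrable; but the empty
    -- minor is the constant `1`, so exponent `0` works.
    refine ⟨0, by norm_num, fun R _ => ⟨1, zero_le_one, fun ε _ z _ _ => ?_⟩⟩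
    simp [hessianMinor]
  · exact ⟨_, h, fun R hR => exists_bound_hessianMinor hk a b R hR⟩

theorem locallyIntegrable_hessianMinor {k : ℕ} (hk : k ≤ m + 1) (a b : Fin k → Fin (m + 1)) :
    LocallyIntegrable (hessianMinor (pogorelov m) a b) volume := by
  obtain ⟨t, ht, hb⟩ := exists_bound_hessianMinor' hk a b
  rw [← pogorelovApprox_zero]
  refine LastBound.locallyIntegrable (t := t) (fun R hR => ?_)
    (aestronglyMeasurable_hessianMinor le_rfl a b) ht
  obtain ⟨C, hC0, hC⟩ := hb R hR
  exact ⟨C, hC0, hC 0 (by simp)⟩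

theorem exists_bound_abs_pogorelovApprox (R : ℝ) :
    ∃ C : ℝ, 0 ≤ C ∧ ∀ ε ∈ Icc (0 : ℝ) 1, ∀ z ∈ Metric.ball (0 : Fin (m + 1) → ℂ) R,
      ‖pogorelovApprox m ε z‖ ≤ C := by
  have hcont : Continuous fun p : ℝ × (Fin (m + 1) → ℂ) =>
      pogConst m * pogBase p.2 * regSq p.1 p.2 ^ pogExp m := by
    have h1 := (contDiff_pogBase (m := m)).continuous
    have h2 := (continuous_regSq_uncurry (m := m)).rpow_const (p := pogExp m)
      fun _ => Or.inr (pogExp_pos m).le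
    fun_prop
  obtain ⟨C, hC⟩ := (isCompact_Icc.prod (isCompact_closedBall (0 : Fin (m + 1) → ℂ) R) :
    IsCompact (Icc (0 : ℝ) 1 ×ˢ _)).exists_bound_of_continuousOn hcont.continuousOn
  exact ⟨max C 0, le_max_right _ _, fun ε hε z hz =>
    (hC (ε, z) ⟨hε, Metric.ball_subset_closedBall hz⟩).trans (le_max_left _ _)⟩

theorem tendsto_integral_hessianMinor_mul {k : ℕ} (hk : k ≤ m + 1) (a b : Fin k → Fin (m + 1))
    {φ : (Fin (m + 1) → ℂ) → ℂ} (hφ : Continuous φ) (hφ' : HasCompactSupport φ) :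
    Tendsto (fun ε => ∫ z, hessianMinor (pogorelovApprox m ε) a b z * φ z) (𝓝[>] 0)
      (𝓝 (∫ z, hessianMinor (pogorelov m) a b z * φ z)) := by
  obtain ⟨t, ht, hb⟩ := exists_bound_hessianMinor' hk a b
  have := tendsto_integral_mul_of_lastBound ht
    (G := fun ε => hessianMinor (pogorelovApprox m ε) a b)
    (fun ε hε => aestronglyMeasurable_hessianMinor (le_of_lt hε) a b) hb
    (fun z hz => continuousAt_hessianMinor_eps a b hz) hφ hφ'
  simpa only [pogorelovApprox_zero] using this

theorem tendsto_integral_hessianMinor_mul_mul {k : ℕ} (hk : k ≤ m + 1)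
    (a b : Fin k → Fin (m + 1)) {φ : (Fin (m + 1) → ℂ) → ℂ} (hφ : Continuous φ)
    (hφ' : HasCompactSupport φ) :
    Tendsto (fun ε => ∫ z, hessianMinor (pogorelovApprox m ε) a b z *
        ((pogorelovApprox m ε z : ℂ) * φ z)) (𝓝[>] 0)
      (𝓝 (∫ z, hessianMinor (pogorelov m) a b z * ((pogorelov m z : ℂ) * φ z))) := by
  obtain ⟨t, ht, hb⟩ := exists_bound_hessianMinor' hk a b
  have := tendsto_integral_mul_of_lastBound ht
    (G := fun ε z => hessianMinor (pogorelovApprox m ε) a b z * (pogorelovApprox m ε z : ℂ))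
    (fun ε hε => (aestronglyMeasurable_hessianMinor (le_of_lt hε) a b).mul
      (Complex.continuous_ofReal.comp
        (continuous_pogorelovApprox (le_of_lt hε))).aestronglyMeasurable) ?_ ?_ hφ hφ'
  · simpa only [pogorelovApprox_zero, mul_assoc] using this
  · intro R hR
    obtain ⟨C, hC0, hC⟩ := hb R hR
    obtain ⟨C', hC0', hC'⟩ := exists_bound_abs_pogorelovApprox (m := m) R
    refine ⟨C * C', by positivity, fun ε hε z hzR hz => ?_⟩
    rw [norm_mul, Complex.norm_real, mul_right_comm]
    exact mul_le_mul (hC ε hε z hzR hz) (hC' ε hε z hzR) (norm_nonneg _) (by positivity)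
  · intro z hz
    refine (continuousAt_hessianMinor_eps a b hz).mul
      (Complex.continuous_ofReal.continuousAt.comp ?_)
    have hc : ContinuousAt (fun ε => regSq ε z) 0 := by unfold regSq; fun_prop
    exact (hc.rpow_const (Or.inl (regSq_pos_of_ne le_rfl hz).ne')).const_mul _

open Classical in
/-- The linear functional `f ↦ ∫ g f` on `C_c`, for locally integrable `g`. -/
def densityFunctional {n : ℕ} (g : (Fin n → ℂ) → ℂ) : C_c(Fin n → ℂ, ℂ) →ₗ[ℂ] ℂ :=
  if hg : LocallyIntegrable g volume then
    { toFun := fun f => ∫ z, g z * f z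
      map_add' := fun f₁ f₂ => by
        have h : ∀ f : C_c(Fin n → ℂ, ℂ), Integrable fun z => g z * f z := fun f => by
          simpa [mul_comm] using
            hg.integrable_smul_left_of_hasCompactSupport f.continuous f.hasCompactSupport
        simp only [CompactlySupportedContinuousMap.coe_add, Pi.add_apply, mul_add]
        exact integral_add (h f₁) (h f₂)
      map_smul' := fun c f => by
        simp only [CompactlySupportedContinuousMap.coe_smul, Pi.smul_apply, smul_eq_mul,
          mul_left_comm _ c, integral_const_mul, RingHom.id_apply] }
  else 0

theorem densityFunctional_apply {n : ℕ} {g : (Fin n → ℂ) → ℂ} (hg : LocallyIntegrable g volume)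
    (f : C_c(Fin n → ℂ, ℂ)) : densityFunctional g f = ∫ z, g z * f z := by
  rw [densityFunctional, dif_pos hg]
  rfl

theorem isOrderZero_densityFunctional {n : ℕ} {g : (Fin n → ℂ) → ℂ}
    (hg : LocallyIntegrable g volume) : IsOrderZero (densityFunctional g) := by
  intro K hK
  refine ⟨∫ z in K, ‖g z‖, fun f M hf hM => ?_⟩
  have hgK : IntegrableOn g K := hg.integrableOn_isCompact hK
  rw [densityFunctional_apply hg]
  have h1 : ∫ z, g z * f z = ∫ z in K, g z * f z := by
    refine (setIntegral_eq_integral_of_forall_compl_eq_zero fun z hz => ?_).symm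
    rw [image_eq_zero_of_notMem_tsupport fun h => hz (hf h), mul_zero]
  rw [h1, ← integral_mul_const]
  refine norm_integral_le_of_norm_le (hgK.norm.mul_const M) (.of_forall fun z => ?_)
  rw [norm_mul]
  exact mul_le_mul_of_nonneg_left (hM z) (norm_nonneg _)

/-- The minors of `v` are locally integrable, hence of order zero. The recursion is exact for each
`v_ε`, and both sides converge to those for `v`, so no singular part supported on the hyperplane
appears. -/
theorem isBedfordTaylor_pogorelov :
    IsBedfordTaylor ⟨pogorelov m, continuous_pogorelov⟩
      (fun _ a b => densityFunctional (hessianMinor (pogorelov m) a b)) where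
  orderZero k hk a b := isOrderZero_densityFunctional (locallyIntegrable_hessianMinor hk a b)
  zero a b f := by
    rw [densityFunctional_apply (locallyIntegrable_hessianMinor (Nat.zero_le _) a b)]
    simp [hessianMinor]
  succ k hk a b φ hφ := by
    rw [densityFunctional_apply (locallyIntegrable_hessianMinor hk a b)]
    simp only [densityFunctional_apply (locallyIntegrable_hessianMinor hk.le _ _)]
    have L1 := (tendsto_integral_hessianMinor_mul hk a b φ.continuous
      φ.hasCompactSupport).const_mul ((k : ℂ) + 1)
    have L2 := tendsto_finsetSum (Finset.univ : Finset (Fin (k + 1))) fun r _ =>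
      tendsto_finsetSum (Finset.univ : Finset (Fin (k + 1))) fun s _ =>
        (tendsto_integral_hessianMinor_mul_mul hk.le (a ∘ r.succAbove) (b ∘ s.succAbove)
          (contDiff_dz (a r) (contDiff_dzbar (b s) hφ)).continuous
          (hasCompactSupport_dz (a r) (hasCompactSupport_dzbar (b s)
            φ.hasCompactSupport))).const_mul ((-1 : ℂ) ^ ((r : ℕ) + (s : ℕ)))
    refine tendsto_nhds_unique L1 (L2.congr' ?_)
    filter_upwards [self_mem_nhdsWithin] with ε hε
    exact (hessianMinor_recursion (contDiff_pogorelovApprox hε) a b hφ φ.hasCompactSupport).symm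

theorem isGeneralizedSolution_pogorelov :
    IsGeneralizedSolution (pogorelov m) (fun _ => 1) := by
  refine ⟨?_, continuous_pogorelov, _, isBedfordTaylor_pogorelov, fun f => ?_⟩
  · rw [← pogorelovApprox_zero]
    exact continuousPSH_pogorelovApprox le_rfl
  · rw [densityFunctional_apply (locallyIntegrable_hessianMinor le_rfl _ _)]
    refine integral_congr_ae ?_
    -- The top density is the determinant of the Hessian of `v`, which equals `1` off a null set.
    filter_upwards [ae_last_ne_zero] with z hz
    rw [hessianMinor, Matrix.submatrix_id_id, (regular_pogorelov (Or.inl hz)).2.2]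
    simp

end BedfordTaylor

end

theorem theorem1p2 (m : ℕ) :
    -- generalized solution in the sense of Bedford and Taylor
    IsGeneralizedSolution (pogorelov m) (fun _ => 1) ∧
    -- the limit of smooth approximate solutions
    ((∀ ε : ℝ, 0 < ε →
        ContDiff ℝ ∞ (pogorelovApprox m ε) ∧ ContinuousPSH (pogorelovApprox m ε)) ∧
      TendstoLocallyUniformly (pogorelovApprox m) (pogorelov m) (𝓝[>] 0) ∧
      ∀ K : Set (Fin (m + 1) → ℂ), IsCompact K → ∀ q : ℝ≥0∞, q ≠ ⊤ →
        Tendsto (fun ε : ℝ => eLpNorm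
            (fun z => (complexHessian (pogorelovApprox m ε) z).det - 1) q (volume.restrict K))
          (𝓝[>] 0) (𝓝 0)) ∧
    -- viscosity solution
    IsViscositySolution (pogorelov m) ∧
    -- Hölder continuity with the exponent `2/n` and no larger one
    (1 ≤ m →
      (∀ K : Set (Fin (m + 1) → ℂ), IsCompact K →
        ∃ C : ℝ≥0, HolderOnWith C (2 / ((m : ℝ≥0) + 1)) (pogorelov m) K) ∧
      ∀ p : Fin (m + 1) → ℂ, p (Fin.last m) = 0 → ∀ β : ℝ≥0, 2 / ((m : ℝ≥0) + 1) < β →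
        ∀ U ∈ 𝓝 p, ¬ ∃ C : ℝ≥0, HolderOnWith C β (pogorelov m) U) ∧
    -- Sobolev regularity: `W^{2,p}_loc` if and only if `p (n - 1) < n`
    (∀ p : ℝ≥0∞, 1 ≤ p → (MemW2Local (pogorelov m) p ↔ p * (m : ℝ≥0∞) < (m : ℝ≥0∞) + 1)) :=
  ⟨isGeneralizedSolution_pogorelov,
    ⟨fun _ hε => ⟨contDiff_pogorelovApprox hε, continuousPSH_pogorelovApprox hε.le⟩,
      tendstoLocallyUniformly_pogorelovApprox,
      fun _ hK _ hq => tendsto_eLpNorm_det_complexHessian hK hq⟩,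
    isViscositySolution_pogorelov,
    fun hm => ⟨fun _ hK => exists_holderOnWith_pogorelov hm hK,
      fun _ hp _ hβ _ hU ⟨C, hC⟩ => not_holderOnWith_pogorelov hp hβ hU C hC⟩,
    fun _ hp => memW2Local_pogorelov_iff hp⟩
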